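/- Let $\|\cdot\|$ denote the Euclidean norm. Let $X$ be a random vector in $\mathbb{R}^d$ with law $\mu$, let $g(x,\theta)\in\mathbb{R}^r$ be an estimating function of $x\in\mathbb{R}^d$ and $\theta\in\mathbb{R}^p$, and let $\theta_0$ satisfy $E[g(X,\theta_0)]=0$. Assume that there is an open neighbourhood $\mathcal N$ of $\theta_0$ such that $g(\cdot,\theta)$ is measurable for every $\theta\in\mathcal N$ and such that the following conditions hold. 1. $E[g(X,\theta_0)g(X,\theta_0)']$ is positive definite. 2. For every $x$, the derivatives $\partial g(x,\theta)/\partial\theta$ and $\partial^2 g(x,\theta)/\partial\theta\,\partial\theta'$ exist and are continuous in $\theta\in\mathcal N$. 3. There is a function $H$ with $E|H(X)|<\infty$ such that $\|\partial g(x,\theta)/\partial\theta\|\le H(x)$, $\|\partial^2 g(x,\theta)/\partial\theta\,\partial\theta'\|\le H(x)$ and $\|g(x,\theta)\|^3\le H(x)$ for all $x$ and all $\theta\in\mathcal N$. 4. The $r\times p$ matrix $E[\partial g(X,\theta_0)/\partial\theta']$ has rank $p$. For observations $\{X_{ij}\}_{1\le i\le n,\,1\le j\le m}$ divided into $n$ groups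 of equal size $m$, put $N=nm$. The grouped empirical likelihood ratio is $$R_G(\theta)=\sup\Big\{\prod_{i=1}^n (Nq_i)^m \;:\; q_i\ge 0,\ \sum_{i=1}^n q_i=\frac1m,\ \sum_{i=1}^n q_i\sum_{j=1}^m g(X_{ij},\theta)=0\Big\},$$ with $\sup\emptyset=0$, and $-2\log R_G(\theta)=+\infty$ if $R_G(\theta)=0$. The grouped empirical likelihood estimator is a minimizer of $-2\log R_G$ over a closed ball around $\theta_0$. Then there is a $\rho_0>0$, which depends only on $\mu$, $g$, $\theta_0$, $\mathcal N$ and $H$, with the following two properties. (a) For all $n,m\ge1$, every sample and every $\rho\in[0,\rho_0]$, the function $-2\log R_G$ attains its minimum over the ball $\{\|\theta-\theta_0\|\le\rho\}$. (b) Let $(m_n)$ be any sequence of group sizes with $m_n\ge1$ (constant, tending to infinity, or arbitrary), and put $N=nm_n$. For each $n$ let $\{X_{ij}\}_{i\le n,\,j\le m_n}$ be independent with law $\mu$. Let $\rho_n$ be radii with $\rho_n\le\rho_0$ for all large $n$ and $\sqrt N\,\rho_n\to\infty$ (for instance $\rho_n=N^{-1/3}$, or $\rho_n=\rho_0$). Let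 $\hat\theta_{GEL}$ be random vectors which, with probability tending to one, minimize $-2\log R_G$ over $\{\|\theta-\theta_0\|\le\rho_n\}$. Then, as $n\to\infty$, $$\sqrt N\,(\hat\theta_{GEL}-\theta_0)\ \xrightarrow{d}\ \mathcal N(0,V),$$ where $$V=\Big\{E\Big(\frac{\partial g(X,\theta_0)}{\partial\theta'}\Big)'\big(E[g(X,\theta_0)g(X,\theta_0)']\big)^{-1}E\Big(\frac{\partial g(X,\theta_0)}{\partial\theta'}\Big)\Big\}^{-1}.$$ -/

import Mathlib

open MeasureTheory ProbabilityTheory Filter Topology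
open scoped ENNReal Matrix

noncomputable section

namespace GEL

variable {𝓧 : Type*} {p r n m : ℕ}

/-- The constraints on the group weights `q₁, …, qₙ` at the parameter value `θ`, for observations
`x i j` (the `j`-th observation of the `i`-th of `n` groups of size `m`) and the estimating
function `g`. -/
def IsFeasible (g : 𝓧 → EuclideanSpace ℝ (Fin p) → EuclideanSpace ℝ (Fin r))
    (x : Fin n → Fin m → 𝓧) (θ : EuclideanSpace ℝ (Fin p)) (q : Fin n → ℝ) : Prop :=
  (∀ i, 0 ≤ q i) ∧ ∑ i, q i = 1 / (m : ℝ) ∧ ∑ i, q i • ∑ j, g (x i j) θ = 0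

/-- The grouped empirical likelihood ratio `R_G(θ) = sup ∏ᵢ (N qᵢ) ^ m` with `N = n m`, the
supremum being over the feasible weights; it is `0` if there are none. -/
def ratio (g : 𝓧 → EuclideanSpace ℝ (Fin p) → EuclideanSpace ℝ (Fin r))
    (x : Fin n → Fin m → 𝓧) (θ : EuclideanSpace ℝ (Fin p)) : ℝ≥0∞ :=
  ⨆ q ∈ {q : Fin n → ℝ | IsFeasible g x θ q},
    ENNReal.ofReal (∏ i, ((n : ℝ) * (m : ℝ) * q i) ^ m)

/-- The statistic `-2 log R_G(θ)`, with the value `+∞` where `R_G(θ) = 0`. -/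
def negTwoLogRatio (g : 𝓧 → EuclideanSpace ℝ (Fin p) → EuclideanSpace ℝ (Fin r))
    (x : Fin n → Fin m → 𝓧) (θ : EuclideanSpace ℝ (Fin p)) : EReal :=
  -2 * ENNReal.log (ratio g x θ)

/-- `θ` is a grouped empirical likelihood estimate over the set `S` of parameter values: it
minimizes `-2 log R_G` over `S`. -/
def IsEstimate (g : 𝓧 → EuclideanSpace ℝ (Fin p) → EuclideanSpace ℝ (Fin r))
    (x : Fin n → Fin m → 𝓧) (S : Set (EuclideanSpace ℝ (Fin p)))
    (θ : EuclideanSpace ℝ (Fin p)) : Prop :=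
  θ ∈ S ∧ ∀ θ' ∈ S, negTwoLogRatio g x θ ≤ negTwoLogRatio g x θ'

variable [MeasurableSpace 𝓧]

/-- The `r × r` matrix `E[g(X, θ) g(X, θ)']`, where `X` has law `μ`. -/
def secondMoment (μ : Measure 𝓧)
    (g : 𝓧 → EuclideanSpace ℝ (Fin p) → EuclideanSpace ℝ (Fin r))
    (θ : EuclideanSpace ℝ (Fin p)) : Matrix (Fin r) (Fin r) ℝ :=
  Matrix.of fun k l => ∫ x, g x θ k * g x θ l ∂μ

/-- The `r × p` matrix `E[∂g(X, θ)/∂θ']`, where `X` has law `μ`. -/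
def meanJacobian (μ : Measure 𝓧)
    (g : 𝓧 → EuclideanSpace ℝ (Fin p) → EuclideanSpace ℝ (Fin r))
    (θ : EuclideanSpace ℝ (Fin p)) : Matrix (Fin r) (Fin p) ℝ :=
  Matrix.of fun k l => ∫ x, fderiv ℝ (g x) θ (EuclideanSpace.single l 1) k ∂μ

/-- The covariance matrix `V = {E(∂g/∂θ')' (E g g')⁻¹ E(∂g/∂θ')}⁻¹`. -/
def asympCov (μ : Measure 𝓧)
    (g : 𝓧 → EuclideanSpace ℝ (Fin p) → EuclideanSpace ℝ (Fin r))
    (θ : EuclideanSpace ℝ (Fin p)) : Matrix (Fin p) (Fin p) ℝ :=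
  ((meanJacobian μ g θ)ᵀ * (secondMoment μ g θ)⁻¹ * meanJacobian μ g θ)⁻¹

end GEL

end

/-! Write a weight as q_i = y_i / (n m) and let z_i(θ) be √m times the mean of g(·, θ) over group i.
Then -2 log R_G(θ) is m times the infimum of 2 ∑ -log y_i over positive y with mean one and ∑ y_i
z_i(θ) = 0. The factor m does not affect minimization. What remains is ordinary empirical likelihood
for n independent vectors z_i, whose second moment matrix at θ₀ is S = E[g g'] for every m.

The deterministic half concerns samples whose averages at θ₀ are within ε of their expectations
(`IsTypical`). Put t = √N (θ - θ₀), let s₀ be the normalized sum of the z_i(θ₀), and J the mean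
Jacobian. For bounded t the statistic 2 ∑ -log y_i has infimum ⟨S⁻¹ s, s⟩ + O(ε) with s = s₀ + J t
(`exists_quadratic_approx`). The lower bound is weak duality at the explicit multiplier n^{-1/2} S⁻¹
s; the upper bound uses explicit weights affine in z_i. Hence neither the optimal multiplier, nor
first order conditions, nor a convex hull argument is needed. A bounded statistic forces the weights
to be close to one in mean square; the moment equation and the injectivity of J then give ‖θ - θ₀‖ =
O(N^{-1/2}) on the whole ball (`IsTypical.norm_le`), which is consistency and rate in one step.
Comparing a minimizer with the point where the quadratic is least, t = Γ s₀, and using coercivity,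
gives √N (θ̂ - θ₀) = Γ s₀ + small (`exists_linear_approx`).

The probabilistic half shows that samples are typical with high probability for any group sizes
(`exists_measure_not_isTypical_le`). Third absolute moments of √m times a group mean are bounded
uniformly in m (`integral_abs_sum_cube_le`), so products of two coordinates are uniformly
integrable, and a truncation argument gives the law of large numbers and the o(n) bound on maxima
for the resulting triangular arrays. Finally s₀ is N^{-1/2} times the sum over all N observations,
so the grouping disappears from the leading term. The central limit theorem and Slutsky's lemma
conclude, because Γ S Γ' = V. -/

namespace GEL

/-! ### Two-sided bounds for the empirical likelihood of fixed vectors. -/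

/-- Second order lower bound for the logarithm near `1`. -/
lemma sub_sq_le_log_one_add {x κ : ℝ} (hx : |x| ≤ κ) (hκ : κ ≤ 1 / 2) :
    x - (1 + 4 * κ) / 2 * x ^ 2 ≤ Real.log (1 + x) := by
  have h1 : |(-x)| < 1 := by rw [abs_neg]; linarith
  have h := Real.abs_log_sub_add_sum_range_le h1 2
  simp only [Finset.sum_range_succ, Finset.sum_range_zero, abs_neg] at h
  -- The cubic remainder of the series loses at most a factor 2, as 1 - |x| ≥ 1/2. One factor |x| is
  -- spent as κ, so the error stays quadratic in x.
  have h2 : |x| ^ (2 + 1) / (1 - |x|) ≤ 2 * κ * x ^ 2 := by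
    rw [div_le_iff₀ (by linarith)]
    have h3 : |x| ^ (2 + 1) = |x| * x ^ 2 := by rw [pow_succ, sq_abs]; ring
    rw [h3]
    have h4 : 0 ≤ x ^ 2 := sq_nonneg x
    have h5 : |x| * x ^ 2 ≤ κ * x ^ 2 := mul_le_mul_of_nonneg_right hx h4
    have h6 : 0 ≤ κ * x ^ 2 := mul_nonneg ((abs_nonneg x).trans hx) h4
    nlinarith
  have h7 := (abs_le.1 (h.trans h2)).1
  norm_num at h7
  linarith

/-- Relative weights `y` (with mean one and positive) that satisfy the moment restriction `z`. -/
structure IsAdmissible {n : ℕ} {F : Type*} [AddCommGroup F] [Module ℝ F]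
    (z : Fin n → F) (y : Fin n → ℝ) : Prop where
  pos : ∀ i, 0 < y i
  sum_eq : ∑ i, y i = n
  moment : ∑ i, y i • z i = 0

section Weights

variable {n : ℕ} {F : Type*} [NormedAddCommGroup F] [InnerProductSpace ℝ F]

lemma IsAdmissible.smul {z : Fin n → F} {y : Fin n → ℝ} (h : IsAdmissible z y) (a : ℝ) :
    IsAdmissible (fun i => a • z i) y := by
  refine ⟨h.pos, h.sum_eq, ?_⟩
  simp_rw [smul_comm _ a, ← Finset.smul_sum, h.moment, smul_zero]

lemma IsAdmissible.of_smul {z : Fin n → F} {y : Fin n → ℝ} {a : ℝ} (ha : a ≠ 0)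
    (h : IsAdmissible (fun i => a • z i) y) : IsAdmissible z y := by
  have := h.smul a⁻¹
  simpa [smul_smul, inv_mul_cancel₀ ha] using this

/-- Weak duality for the empirical likelihood. -/
lemma IsAdmissible.sum_log_le {z : Fin n → F} {y : Fin n → ℝ} (h : IsAdmissible z y) (l : F)
    (hl : ∀ i, 0 < 1 + inner ℝ l (z i)) :
    ∑ i, Real.log (1 + inner ℝ l (z i)) ≤ ∑ i, -Real.log (y i) := by
  -- This is log a ≤ a - 1 at a = y_i (1 + ⟨l, z_i⟩). The right-hand sides sum to zero by the two
  -- constraints on y.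
  have h1 : ∀ i, Real.log (1 + inner ℝ l (z i)) + Real.log (y i) ≤
      y i * (1 + inner ℝ l (z i)) - 1 := by
    intro i
    rw [add_comm, ← Real.log_mul (h.pos i).ne' (hl i).ne']
    exact Real.log_le_sub_one_of_pos (mul_pos (h.pos i) (hl i))
  have h2 : ∑ i, (y i * (1 + inner ℝ l (z i)) - 1) = 0 := by
    have h3 : ∑ i, y i * inner ℝ l (z i) = 0 := by
      simp_rw [← real_inner_smul_right, ← inner_sum, h.moment, inner_zero_right]
    simp [mul_add, Finset.sum_add_distrib, h3, h.sum_eq]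
  have h4 := Finset.sum_le_sum fun i (_ : i ∈ Finset.univ) => h1 i
  rw [h2, Finset.sum_add_distrib] at h4
  rw [Finset.sum_neg_distrib]
  linarith

/-- A bound on the log likelihood ratio keeps the relative weights close to one in mean square. -/
lemma IsAdmissible.sum_sub_one_sq_le {z : Fin n → F} {y : Fin n → ℝ} (h : IsAdmissible z y)
    {C : ℝ} (hC : ∑ i, -Real.log (y i) ≤ C) :
    ∑ i, (y i - 1) ^ 2 ≤ (2 + √C) ^ 2 * C := by
  -- Hellinger distance is dominated by relative entropy: use log √y ≤ √y - 1. The terms y_i - 1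
  -- cancel in the sum.
  have h1 : ∀ i, (√(y i) - 1) ^ 2 ≤ y i - 1 - Real.log (y i) := by
    intro i
    have h2 : 0 < √(y i) := Real.sqrt_pos.2 (h.pos i)
    have h3 := Real.log_le_sub_one_of_pos h2
    rw [Real.log_sqrt (h.pos i).le] at h3
    have h4 := Real.sq_sqrt (h.pos i).le
    nlinarith
  have h5 : ∑ i, (√(y i) - 1) ^ 2 ≤ C := by
    refine (Finset.sum_le_sum fun i _ => h1 i).trans ?_
    simp only [Finset.sum_sub_distrib, h.sum_eq]
    simp only [Finset.sum_neg_distrib] at hC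
    simpa using hC
  have hC0 : 0 ≤ C := (Finset.sum_nonneg fun i _ => sq_nonneg _).trans h5
  have h6 : ∀ i, (y i - 1) ^ 2 ≤ (2 + √C) ^ 2 * (√(y i) - 1) ^ 2 := by
    intro i
    have h7 : (√(y i) - 1) ^ 2 ≤ C :=
      (Finset.single_le_sum (f := fun i => (√(y i) - 1) ^ 2)
        (fun i _ => sq_nonneg _) (Finset.mem_univ i)).trans h5
    have h8 : √(y i) - 1 ≤ √C := Real.le_sqrt_of_sq_le h7
    have h9 : y i - 1 = (√(y i) + 1) * (√(y i) - 1) := by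
      have h4 := Real.sq_sqrt (h.pos i).le
      nlinarith
    rw [h9, mul_pow]
    have := Real.sqrt_nonneg (y i)
    have h10 : (√(y i) + 1) ^ 2 ≤ (2 + √C) ^ 2 := pow_le_pow_left₀ (by linarith) (by linarith) 2
    exact mul_le_mul_of_nonneg_right h10 (sq_nonneg _)
  refine (Finset.sum_le_sum fun i _ => h6 i).trans ?_
  rw [← Finset.mul_sum]
  gcongr

/-- The sample second moment operator `u ↦ n⁻¹ ∑ ⟨u, zᵢ⟩ zᵢ`. -/
noncomputable def sampleMoment (z : Fin n → F) (u : F) : F :=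
  (n : ℝ)⁻¹ • ∑ i, (inner ℝ u (z i) : ℝ) • z i

lemma inner_sampleMoment (z : Fin n → F) (u v : F) :
    inner ℝ v (sampleMoment z u) = (n : ℝ)⁻¹ * ∑ i, inner ℝ u (z i) * inner ℝ v (z i) := by
  simp [sampleMoment, inner_smul_right, inner_sum]

/-- The normalized sum `n^{-1/2} ∑ zᵢ`. -/
noncomputable def normSum (z : Fin n → F) : F := (√(n : ℝ))⁻¹ • ∑ i, z i

variable {S B : F →L[ℝ] F} {β ε M : ℝ}

/-- Lower bound for the empirical log likelihood ratio statistic. -/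
lemma IsAdmissible.le_statistic {z : Fin n → F} {y : Fin n → ℝ} (h : IsAdmissible z y)
    (hn : 0 < n) (hSB : ∀ u, S (B u) = u) (hβ : ∀ u, ‖B u‖ ≤ β * ‖u‖) (hβ0 : 0 ≤ β)
    (hε : 0 ≤ ε) (hA : ∀ u, ‖sampleMoment z u - S u‖ ≤ ε * ‖u‖)
    (hmax : ∀ i, ‖z i‖ ≤ ε * √(n : ℝ)) (hM : ‖normSum z‖ ≤ M)
    (hκ : β * M * ε ≤ 1 / 2) :
    inner ℝ (B (normSum z)) (normSum z) - ε * (4 * β ^ 2 * M ^ 3 + 3 * β ^ 2 * M ^ 2) ≤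
      2 * ∑ i, -Real.log (y i) := by
  set s := normSum z with hs
  set κ := β * M * ε with hκdef
  have hM0 : 0 ≤ M := (norm_nonneg _).trans hM
  have hsn : 0 < √(n : ℝ) := Real.sqrt_pos.2 (by exact_mod_cast hn)
  have hsq : √(n : ℝ) * √(n : ℝ) = n := Real.mul_self_sqrt (by positivity)
  have hBs : ‖B s‖ ≤ β * M := (hβ s).trans (by gcongr)
  -- The maximizer of the second order expansion of the dual function, with the sample moment
  -- operator replaced by S. Any multiplier gives a valid lower bound, so it need not be optimal.
  set l : F := (√(n : ℝ))⁻¹ • B s with hl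
  have hlz : ∀ i, |(inner ℝ l (z i) : ℝ)| ≤ κ := by
    intro i
    calc |(inner ℝ l (z i) : ℝ)| ≤ ‖l‖ * ‖z i‖ := abs_real_inner_le_norm _ _
      _ ≤ ((√(n : ℝ))⁻¹ * (β * M)) * (ε * √(n : ℝ)) := by
          rw [hl, norm_smul, Real.norm_of_nonneg (by positivity)]
          gcongr
          exact hmax i
      _ = κ := by field_simp; exact hκdef.symm
  have hκ0 : 0 ≤ κ := by positivity
  have h1 := h.sum_log_le l fun i => by linarith [(abs_le.1 (hlz i)).1]
  have h2 : ∑ i, ((inner ℝ l (z i) : ℝ) - (1 + 4 * κ) / 2 * (inner ℝ l (z i) : ℝ) ^ 2) ≤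
      ∑ i, Real.log (1 + inner ℝ l (z i)) :=
    Finset.sum_le_sum fun i _ => sub_sq_le_log_one_add (hlz i) hκ
  have h3 : ∑ i, (inner ℝ l (z i) : ℝ) = inner ℝ (B s) s := by
    rw [← inner_sum, hl, real_inner_smul_left, ← real_inner_smul_right, hs, normSum]
  have h4 : ∑ i, (inner ℝ l (z i) : ℝ) ^ 2 = inner ℝ (B s) (sampleMoment z (B s)) := by
    rw [inner_sampleMoment, Finset.mul_sum]
    refine Finset.sum_congr rfl fun i _ => ?_
    rw [hl, real_inner_smul_left, mul_pow, inv_pow, sq √(n : ℝ), hsq, sq]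
  have h5 : inner ℝ (B s) (sampleMoment z (B s)) ≤ inner ℝ (B s) s + ε * (β * M) ^ 2 := by
    have h6 : sampleMoment z (B s) = s + (sampleMoment z (B s) - S (B s)) := by
      rw [hSB]; abel
    rw [h6, inner_add_right]
    gcongr
    refine (real_inner_le_norm _ _).trans ?_
    calc ‖B s‖ * ‖sampleMoment z (B s) - S (B s)‖ ≤ ‖B s‖ * (ε * ‖B s‖) := by
          gcongr; exact hA _
      _ ≤ (β * M) * (ε * (β * M)) := by gcongr
      _ = _ := by ring
  have h7 : inner ℝ (B s) s ≤ β * M ^ 2 := by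
    refine (real_inner_le_norm _ _).trans ?_
    calc ‖B s‖ * ‖s‖ ≤ (β * M) * M := by gcongr
      _ = _ := by ring
  rw [Finset.sum_sub_distrib, ← Finset.mul_sum, h3, h4] at h2
  have h8 : (1 + 4 * κ) * inner ℝ (B s) (sampleMoment z (B s)) ≤
      inner ℝ (B s) s + 4 * κ * (β * M ^ 2) + 3 * (ε * (β * M) ^ 2) := by
    have h9 : 0 ≤ ε * (β * M) ^ 2 := by positivity
    calc (1 + 4 * κ) * inner ℝ (B s) (sampleMoment z (B s))
        ≤ (1 + 4 * κ) * (inner ℝ (B s) s + ε * (β * M) ^ 2) := by gcongr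
      _ = inner ℝ (B s) s + 4 * κ * inner ℝ (B s) s + (1 + 4 * κ) * (ε * (β * M) ^ 2) := by ring
      _ ≤ _ := by gcongr; linarith
  have h10 : 4 * κ * (β * M ^ 2) + 3 * (ε * (β * M) ^ 2) =
      ε * (4 * β ^ 2 * M ^ 3 + 3 * β ^ 2 * M ^ 2) := by rw [hκdef]; ring
  linarith

/-- Upper bound for the empirical log likelihood ratio statistic, by explicit weights. -/
lemma exists_statistic_le [FiniteDimensional ℝ F] {z : Fin n → F}
    (hn : 0 < n) (hBS : ∀ u, B (S u) = u) (hβ : ∀ u, ‖B u‖ ≤ β * ‖u‖) (hβ0 : 0 ≤ β)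
    (hε : 0 ≤ ε) (hA : ∀ u, ‖sampleMoment z u - S u‖ ≤ ε * ‖u‖)
    (hmax : ∀ i, ‖z i‖ ≤ ε * √(n : ℝ)) (hM : ‖normSum z‖ ≤ M) (hM1 : 1 ≤ M)
    (hMn : M ^ 2 ≤ ε * n) (hβε : 4 * β * ε ≤ 1) (hκ : 4 * β * M * ε ≤ 1 / 2) :
    ∃ y, IsAdmissible z y ∧ 2 * ∑ i, -Real.log (y i) ≤
      inner ℝ (B (normSum z)) (normSum z) + ε * (16 * β ^ 2 * M ^ 3 + 12 * β ^ 2 * M ^ 2) := by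
  set s := normSum z with hs
  set κ := 4 * β * M * ε with hκdef
  have hn' : (0 : ℝ) < n := by exact_mod_cast hn
  have hsn : 0 < √(n : ℝ) := Real.sqrt_pos.2 hn'
  have hsq : √(n : ℝ) * √(n : ℝ) = n := Real.mul_self_sqrt (by positivity)
  set zb : F := (√(n : ℝ))⁻¹ • s with hzb
  have hzsum : ∑ i, z i = (n : ℝ) • zb := by
    rw [hzb, hs, normSum, smul_smul, smul_smul, mul_assoc, ← mul_inv, hsq,
      mul_inv_cancel₀ hn'.ne', one_smul]
  have hzbn : ‖zb‖ ≤ (√(n : ℝ))⁻¹ * M := by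
    rw [hzb, norm_smul, Real.norm_of_nonneg (by positivity)]; gcongr
  have hzbsq : ‖zb‖ ^ 2 ≤ ε := by
    have : ‖zb‖ ^ 2 ≤ ((√(n : ℝ))⁻¹ * M) ^ 2 := by gcongr
    refine this.trans ?_
    rw [mul_pow, inv_pow, sq (√(n : ℝ)), hsq, inv_mul_le_iff₀ hn']
    linarith
  -- the centred operator
  let A : F →ₗ[ℝ] F :=
    { toFun := fun u => sampleMoment z u - (inner ℝ u zb : ℝ) • zb
      map_add' := by
        intro u v
        simp only [sampleMoment, inner_add_left, add_smul, Finset.sum_add_distrib, smul_add]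
        abel
      map_smul' := by
        intro c u
        simp only [sampleMoment, real_inner_smul_left, mul_smul, ← Finset.smul_sum,
          RingHom.id_apply, smul_sub, smul_comm _ c] }
  have hAdef : ∀ u, A u = sampleMoment z u - (inner ℝ u zb : ℝ) • zb := fun _ => rfl
  have hAS : ∀ u, ‖A u - S u‖ ≤ 2 * ε * ‖u‖ := by
    intro u
    have h1 : A u - S u = (sampleMoment z u - S u) - (inner ℝ u zb : ℝ) • zb := by
      rw [hAdef]; abel
    have h2 : ‖(inner ℝ u zb : ℝ) • zb‖ ≤ ε * ‖u‖ := by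
      rw [norm_smul]
      calc ‖(inner ℝ u zb : ℝ)‖ * ‖zb‖ ≤ (‖u‖ * ‖zb‖) * ‖zb‖ := by
            gcongr; exact norm_inner_le_norm _ _
        _ = ‖zb‖ ^ 2 * ‖u‖ := by ring
        _ ≤ ε * ‖u‖ := by gcongr
    rw [h1]
    linarith [norm_sub_le (sampleMoment z u - S u) ((inner ℝ u zb : ℝ) • zb), hA u]
  -- A perturbation of S of size 2ε: since 2βε ≤ 1/2, half of ‖u‖ can be absorbed. This makes the
  -- centred operator invertible.
  have hnorm : ∀ u, ‖u‖ ≤ 2 * β * ‖A u‖ := by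
    intro u
    have h1 : ‖u‖ ≤ β * ‖S u‖ := by
      have := hβ (S u)
      rwa [hBS] at this
    have h2 : ‖S u‖ ≤ ‖A u‖ + 2 * ε * ‖u‖ := by
      have h3 : S u = A u - (A u - S u) := by abel
      calc ‖S u‖ = ‖A u - (A u - S u)‖ := by rw [← h3]
        _ ≤ ‖A u‖ + ‖A u - S u‖ := norm_sub_le _ _
        _ ≤ _ := by gcongr; exact hAS u
    have h4 : ‖u‖ ≤ β * (‖A u‖ + 2 * ε * ‖u‖) := h1.trans (by gcongr)
    have h5 : 4 * β * ε * ‖u‖ ≤ 1 * ‖u‖ := by gcongr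
    linarith
  have hinj : Function.Injective A := by
    rw [← LinearMap.ker_eq_bot, LinearMap.ker_eq_bot']
    intro u hu
    have := hnorm u
    rw [hu, norm_zero, mul_zero] at this
    exact norm_le_zero_iff.1 this
  -- The equation for u is solved exactly, not with S in place of the centred operator, because the
  -- moment restriction on the weights has to hold exactly.
  obtain ⟨u, hu⟩ := LinearMap.surjective_of_injective hinj zb
  have hun : ‖u‖ ≤ 2 * β * ‖zb‖ := hu ▸ hnorm u
  -- the weights
  set w : Fin n → ℝ := fun i => -inner ℝ u (z i - zb) with hw
  have hwk : ∀ i, |w i| ≤ κ := by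
    intro i
    have h1 : |w i| ≤ ‖u‖ * (‖z i‖ + ‖zb‖) := by
      rw [hw, abs_neg]
      exact (abs_real_inner_le_norm _ _).trans (by gcongr; exact norm_sub_le _ _)
    have h2 : (√(n : ℝ))⁻¹ * M ≤ ε * √(n : ℝ) := by
      rw [inv_mul_le_iff₀ hsn]
      nlinarith
    -- The value 4βMε of κ is the product of ‖u‖ ≤ 2βM/√n and ‖z_i - zb‖ ≤ 2ε√n.
    calc |w i| ≤ ‖u‖ * (‖z i‖ + ‖zb‖) := h1
      _ ≤ (2 * β * ((√(n : ℝ))⁻¹ * M)) * (ε * √(n : ℝ) + ε * √(n : ℝ)) := by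
          gcongr
          · exact hun.trans (by gcongr)
          · exact hmax i
          · exact hzbn.trans h2
      _ = κ := by rw [hκdef]; field_simp; ring
  have hκ0 : 0 ≤ κ := by positivity
  have hwsum : ∑ i, w i = 0 := by
    simp only [hw, Finset.sum_neg_distrib, ← inner_sum, Finset.sum_sub_distrib, hzsum]
    simp [← Nat.cast_smul_eq_nsmul ℝ]
  have hwz : ∑ i, w i • z i = -((n : ℝ) • zb) := by
    have h1 : ∑ i, w i • z i = -((n : ℝ) • A u) := by
      rw [hAdef, smul_sub, sampleMoment, smul_smul, mul_inv_cancel₀ hn'.ne', one_smul,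
        smul_comm, ← hzsum]
      simp only [hw, inner_sub_right, neg_smul, sub_smul, Finset.sum_neg_distrib,
        Finset.sum_sub_distrib, Finset.smul_sum]
    rw [h1, hu]
  -- One factor w_i is expanded and the two linear constraints on w applied. Since u is close to B
  -- zb, the value is close to ⟨B s, s⟩.
  have hwsq : ∑ i, w i ^ 2 = n * inner ℝ u zb := by
    have h1 : ∀ i, w i ^ 2 = -inner ℝ u (w i • z i) + w i * inner ℝ u zb := by
      intro i
      rw [real_inner_smul_right]
      simp only [hw, inner_sub_right]
      ring
    simp_rw [h1, Finset.sum_add_distrib, Finset.sum_neg_distrib, ← inner_sum, hwz,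
      ← Finset.sum_mul, hwsum]
    rw [inner_neg_right, real_inner_smul_right]
    ring
  refine ⟨fun i => 1 + w i, ⟨fun i => ?_, ?_, ?_⟩, ?_⟩
  · linarith [(abs_le.1 (hwk i)).1]
  · simp [Finset.sum_add_distrib, hwsum]
  · simp [add_smul, Finset.sum_add_distrib, hzsum, hwz]
  have h1 : ∑ i, -Real.log (1 + w i) ≤ (1 + 4 * κ) / 2 * (n * inner ℝ u zb) := by
    have h2 : ∑ i, (w i - (1 + 4 * κ) / 2 * w i ^ 2) ≤ ∑ i, Real.log (1 + w i) :=
      Finset.sum_le_sum fun i _ => sub_sq_le_log_one_add (hwk i) hκ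
    rw [Finset.sum_sub_distrib, ← Finset.mul_sum, hwsum, hwsq] at h2
    rw [Finset.sum_neg_distrib]
    linarith
  have h3 : n * inner ℝ u zb ≤ inner ℝ (B s) s + 4 * β ^ 2 * ε * M ^ 2 := by
    have h4 : ‖u - B zb‖ ≤ β * (2 * ε * (2 * β * ‖zb‖)) := by
      have h5 : u - B zb = -B (A u - S u) := by rw [map_sub, hBS, hu]; abel
      rw [h5, norm_neg]
      exact (hβ _).trans (by gcongr; exact (hAS u).trans (by gcongr))
    have h6 : (inner ℝ u zb : ℝ) ≤ inner ℝ (B zb) zb + β * (2 * ε * (2 * β * ‖zb‖)) * ‖zb‖ := by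
      have h7 : (inner ℝ u zb : ℝ) = inner ℝ (B zb) zb + inner ℝ (u - B zb) zb := by
        rw [← inner_add_left]; congr 1; abel
      rw [h7]
      gcongr
      exact (real_inner_le_norm _ _).trans (by gcongr)
    have h8 : (n : ℝ) * inner ℝ (B zb) zb = inner ℝ (B s) s := by
      rw [hzb, map_smul, real_inner_smul_left, real_inner_smul_right, ← mul_assoc, ← mul_assoc,
        mul_assoc (n : ℝ), ← mul_inv, hsq, mul_inv_cancel₀ hn'.ne', one_mul]
    have h9 : (n : ℝ) * ‖zb‖ ^ 2 ≤ M ^ 2 := by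
      calc (n : ℝ) * ‖zb‖ ^ 2 ≤ n * ((√(n : ℝ))⁻¹ * M) ^ 2 := by gcongr
        _ = M ^ 2 := by rw [mul_pow, inv_pow, sq (√(n : ℝ)), hsq]; field_simp
    calc (n : ℝ) * inner ℝ u zb
        ≤ n * (inner ℝ (B zb) zb + β * (2 * ε * (2 * β * ‖zb‖)) * ‖zb‖) := by gcongr
      _ = inner ℝ (B s) s + 4 * β ^ 2 * ε * (n * ‖zb‖ ^ 2) := by rw [← h8]; ring
      _ ≤ _ := by gcongr
  have h10 : inner ℝ (B s) s ≤ β * M ^ 2 := by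
    refine (real_inner_le_norm _ _).trans ?_
    calc ‖B s‖ * ‖s‖ ≤ (β * ‖s‖) * ‖s‖ := by gcongr; exact hβ s
      _ ≤ (β * M) * M := by gcongr
      _ = _ := by ring
  have h11 : 2 * ∑ i, -Real.log (1 + w i) ≤
      (1 + 4 * κ) * (inner ℝ (B s) s + 4 * β ^ 2 * ε * M ^ 2) :=
    calc _ ≤ (1 + 4 * κ) * (n * inner ℝ u zb) := by linarith
      _ ≤ _ := by gcongr
  have h12 : 4 * κ * inner ℝ (B s) s ≤ 4 * κ * (β * M ^ 2) := by gcongr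
  have h13 : 4 * κ * (4 * β ^ 2 * ε * M ^ 2) ≤ 4 * (1 / 2) * (4 * β ^ 2 * ε * M ^ 2) := by gcongr
  have h14 : 4 * κ * (β * M ^ 2) = ε * (16 * β ^ 2 * M ^ 3) := by rw [hκdef]; ring
  linarith

end Weights

/-! ### Rate of convergence and local shifts on a typical sample. -/

section Deterministic

variable {n : ℕ} {T F : Type*} [NormedAddCommGroup T] [NormedSpace ℝ T]
  [NormedAddCommGroup F] [InnerProductSpace ℝ F]

/-- Lipschitz and Taylor estimates for the group means `G i` on the ball of radius `ρ₀`. -/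
structure IsRegular (G : Fin n → T → F) (D : Fin n → T →L[ℝ] F) (h : Fin n → ℝ) (θ₀ : T)
    (ρ₀ : ℝ) : Prop where
  nonneg : ∀ i, 0 ≤ h i
  lipschitz : ∀ i, ∀ θ ∈ Metric.closedBall θ₀ ρ₀, ‖G i θ - G i θ₀‖ ≤ h i * ‖θ - θ₀‖
  taylor : ∀ i, ∀ θ ∈ Metric.closedBall θ₀ ρ₀,
    ‖G i θ - G i θ₀ - D i (θ - θ₀)‖ ≤ h i * ‖θ - θ₀‖ ^ 2

/-- The sample is typical: the sample averages at `θ₀` are close to their expectations. -/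
structure IsTypical (m : ℕ) (G : Fin n → T → F) (D : Fin n → T →L[ℝ] F) (h : Fin n → ℝ) (θ₀ : T)
    (S : F →L[ℝ] F) (J : T →L[ℝ] F) (C M ε : ℝ) : Prop where
  normSum_le : ‖normSum fun i => √(m : ℝ) • G i θ₀‖ ≤ M
  max_le : ∀ i, ‖√(m : ℝ) • G i θ₀‖ ≤ ε * √(n : ℝ)
  envelope_le : ∀ i, h i ≤ ε * n
  sum_envelope_le : ∑ i, h i ≤ C * n
  moment : ∀ u, ‖sampleMoment (fun i => √(m : ℝ) • G i θ₀) u - S u‖ ≤ ε * ‖u‖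
  deriv : ∀ v, ‖(n : ℝ)⁻¹ • ∑ i, D i v - J v‖ ≤ ε * ‖v‖
  large : 1 ≤ ε * √(n : ℝ)

/-- Pair the sum v with itself: ‖v‖² = ∑ w_i ⟨v, z_i⟩, then apply Cauchy–Schwarz. The form ∑ ⟨v,
z_i⟩² is n times the sample moment form, hence at most n τ ‖v‖². -/
lemma norm_sum_smul_le {z : Fin n → F} {w : Fin n → ℝ} {τ C : ℝ} (hn : 0 < n)
    (hA : ∀ u, ‖sampleMoment z u‖ ≤ τ * ‖u‖) (hw : ∑ i, w i ^ 2 ≤ C) :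
    ‖∑ i, w i • z i‖ ≤ √(C * τ) * √(n : ℝ) := by
  set v := ∑ i, w i • z i with hv
  rcases eq_or_ne v 0 with h0 | h0
  · rw [h0, norm_zero]; positivity
  have hv0 : 0 < ‖v‖ := norm_pos_iff.2 h0
  have hn' : (0 : ℝ) < n := by exact_mod_cast hn
  have hC : 0 ≤ C := (Finset.sum_nonneg fun i _ => sq_nonneg _).trans hw
  have h1 : ‖v‖ ^ 2 = ∑ i, w i * inner ℝ v (z i) := by
    rw [← real_inner_self_eq_norm_sq]
    conv_lhs => rw [hv, inner_sum]
    simp_rw [real_inner_smul_right, ← hv]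
  have h2 : ∑ i, (inner ℝ v (z i) : ℝ) ^ 2 ≤ n * τ * ‖v‖ ^ 2 := by
    have h3 := inner_sampleMoment z v v
    have h4 : inner ℝ v (sampleMoment z v) ≤ ‖v‖ * (τ * ‖v‖) :=
      (real_inner_le_norm _ _).trans (by gcongr; exact hA v)
    rw [h3, inv_mul_le_iff₀ hn'] at h4
    simp_rw [sq]
    linarith
  have h5 : ‖v‖ ^ 2 ≤ √C * √(n * τ * ‖v‖ ^ 2) := by
    rw [h1]
    refine (Real.sum_mul_le_sqrt_mul_sqrt _ _ _).trans ?_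
    gcongr
    rw [← h1]
    exact h2
  have hτ : 0 ≤ τ := by
    have := (norm_nonneg _).trans (hA v)
    exact nonneg_of_mul_nonneg_left this hv0
  rw [Real.sqrt_mul (by positivity), Real.sqrt_sq hv0.le, Real.sqrt_mul hn'.le] at h5
  rw [Real.sqrt_mul hC]
  nlinarith

variable {m : ℕ} {G : Fin n → T → F} {D : Fin n → T →L[ℝ] F} {h : Fin n → ℝ} {θ₀ : T}
  {S B : F →L[ℝ] F} {J : T →L[ℝ] F} {C M ε ρ₀ c σ : ℝ}

/-- Parameter values at which the likelihood ratio statistic is bounded lie within a distance of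
order `(n m)^{-1/2}` of `θ₀`. -/
lemma IsTypical.norm_le (ht : IsTypical m G D h θ₀ S J C M ε) (hr : IsRegular G D h θ₀ ρ₀)
    (hn : 0 < n) (hm : 0 < m) (hc : 0 < c) (hJ : ∀ v, c * ‖v‖ ≤ ‖J v‖) (hC : 0 ≤ C)
    (hCρ : C * ρ₀ ≤ c / 4) (hε : 0 ≤ ε) (hε1 : ε ≤ 1) (hεc : ε ≤ c / 8)
    (hσ : ∀ u, ‖S u‖ ≤ σ * ‖u‖) {L : ℝ}
    (hL : √((2 + √L) ^ 2 * L * (ε * C)) ≤ c / 8) {θ : T} (hθ : θ ∈ Metric.closedBall θ₀ ρ₀)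
    {y : Fin n → ℝ} (hy : IsAdmissible (fun i => G i θ) y) (hyL : ∑ i, -Real.log (y i) ≤ L) :
    √((n : ℝ) * m) * ‖θ - θ₀‖ ≤ 2 * (√((2 + √L) ^ 2 * L * (σ + 1)) + M) / c := by
  set L' := (2 + √L) ^ 2 * L with hL'
  set δ := ‖θ - θ₀‖ with hδ
  have hn' : (0 : ℝ) < n := by exact_mod_cast hn
  have hm' : (0 : ℝ) < m := by exact_mod_cast hm
  have hsm : 0 < √(m : ℝ) := Real.sqrt_pos.2 hm'
  have hsn : 0 < √(n : ℝ) := Real.sqrt_pos.2 hn'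
  have hnn : √(n : ℝ) * √(n : ℝ) = n := Real.mul_self_sqrt hn'.le
  have hδ0 : 0 ≤ δ := norm_nonneg _
  have hδρ : δ ≤ ρ₀ := mem_closedBall_iff_norm.1 hθ
  have hw := hy.sum_sub_one_sq_le hyL
  rw [← hL'] at hw
  have hL0 : 0 ≤ L' := (Finset.sum_nonneg fun i _ => sq_nonneg _).trans hw
  -- the increment of the mean
  have h1 : n * (δ * (c - c / 8 - c / 4)) ≤ ‖∑ i, (G i θ - G i θ₀)‖ := by
    have h2 : ‖∑ i, (G i θ - G i θ₀ - D i (θ - θ₀))‖ ≤ C * n * δ ^ 2 := by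
      refine (norm_sum_le _ _).trans ((Finset.sum_le_sum fun i _ => hr.taylor i θ hθ).trans ?_)
      rw [← Finset.sum_mul]
      gcongr
      exact ht.sum_envelope_le
    have h3 : n * (c * δ) ≤ ‖∑ i, D i (θ - θ₀)‖ + n * (ε * δ) := by
      have h4 := ht.deriv (θ - θ₀)
      have h5 : J (θ - θ₀) = (n : ℝ)⁻¹ • ∑ i, D i (θ - θ₀) -
          ((n : ℝ)⁻¹ • ∑ i, D i (θ - θ₀) - J (θ - θ₀)) := by abel
      have h6 : ‖J (θ - θ₀)‖ ≤ (n : ℝ)⁻¹ * ‖∑ i, D i (θ - θ₀)‖ + ε * δ := by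
        rw [h5]
        refine (norm_sub_le _ _).trans (add_le_add ?_ h4)
        rw [norm_smul, Real.norm_of_nonneg (by positivity)]
      have h7 := (hJ (θ - θ₀)).trans h6
      calc n * (c * δ) ≤ n * ((n : ℝ)⁻¹ * ‖∑ i, D i (θ - θ₀)‖ + ε * δ) := by gcongr
        _ = _ := by field_simp
    have h8 : ∑ i, D i (θ - θ₀) =
        ∑ i, (G i θ - G i θ₀) - ∑ i, (G i θ - G i θ₀ - D i (θ - θ₀)) := by
      rw [← Finset.sum_sub_distrib]; simp
    have h9 : ‖∑ i, D i (θ - θ₀)‖ ≤ ‖∑ i, (G i θ - G i θ₀)‖ + C * n * δ ^ 2 := by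
      rw [h8]
      exact (norm_sub_le _ _).trans (by gcongr)
    have h10 : n * (ε * δ) ≤ n * (c / 8 * δ) := by gcongr
    have h11 : C * n * δ ^ 2 ≤ n * (c / 4 * δ) := by
      -- The choice of ρ₀ makes the quadratic Taylor remainder a fraction of the linear term on the
      -- whole ball, so no preliminary consistency is needed.
      have : C * δ ≤ c / 4 := (mul_le_mul_of_nonneg_left hδρ hC).trans hCρ
      calc C * n * δ ^ 2 = n * (C * δ * δ) := by ring
        _ ≤ _ := by gcongr
    nlinarith
  -- the same increment in terms of the weights
  have h2 : ∑ i, (G i θ - G i θ₀) = -∑ i, (y i - 1) • (G i θ - G i θ₀) -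
      ∑ i, (y i - 1) • G i θ₀ - ∑ i, G i θ₀ := by
    simp only [sub_smul, smul_sub, one_smul, Finset.sum_sub_distrib, hy.moment]
    abel
  have h3 : ‖∑ i, (y i - 1) • (G i θ - G i θ₀)‖ ≤ n * (δ * (c / 8)) := by
    have h4 : ∀ i, ‖(y i - 1) • (G i θ - G i θ₀)‖ ≤ |y i - 1| * h i * δ := by
      intro i
      rw [norm_smul, Real.norm_eq_abs, mul_assoc]
      gcongr
      exact hr.lipschitz i θ hθ
    refine (norm_sum_le _ _).trans ((Finset.sum_le_sum fun i _ => h4 i).trans ?_)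
    rw [← Finset.sum_mul]
    have h5 : ∑ i, |y i - 1| * h i ≤ n * (c / 8) := by
      refine (Real.sum_mul_le_sqrt_mul_sqrt _ _ _).trans ?_
      -- The envelope has only a first moment. Its sum of squares is bounded by maximum times sum,
      -- that is by εn · Cn, which suffices because ε is small.
      have h6 : ∑ i, h i ^ 2 ≤ ε * C * (n * n) := by
        calc ∑ i, h i ^ 2 ≤ ∑ i, ε * n * h i := by
              refine Finset.sum_le_sum fun i _ => ?_
              rw [sq]
              exact mul_le_mul_of_nonneg_right (ht.envelope_le i) (hr.nonneg i)
          _ = ε * n * ∑ i, h i := by rw [Finset.mul_sum]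
          _ ≤ ε * n * (C * n) := by gcongr; exact ht.sum_envelope_le
          _ = _ := by ring
      simp_rw [sq_abs]
      calc √(∑ i, (y i - 1) ^ 2) * √(∑ i, h i ^ 2) ≤ √L' * √(ε * C * (n * n)) := by gcongr
        _ = √(L' * (ε * C)) * n := by
            rw [Real.sqrt_mul (by positivity) ((n : ℝ) * n), Real.sqrt_mul_self hn'.le,
              Real.sqrt_mul hL0]
            ring
        _ ≤ c / 8 * n := by gcongr
        _ = _ := by ring
    nlinarith
  have hS : ∀ u, ‖sampleMoment (fun i => √(m : ℝ) • G i θ₀) u‖ ≤ (σ + 1) * ‖u‖ := by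
    intro u
    have h4 : sampleMoment (fun i => √(m : ℝ) • G i θ₀) u =
      (sampleMoment (fun i => √(m : ℝ) • G i θ₀) u - S u) + S u := by abel
    rw [h4]
    have h5 : ε * ‖u‖ ≤ 1 * ‖u‖ := by gcongr
    linarith [norm_add_le (sampleMoment (fun i => √(m : ℝ) • G i θ₀) u - S u) (S u),
      ht.moment u, hσ u]
  have h4 := norm_sum_smul_le hn hS hw
  have h5 : √(m : ℝ) * ‖∑ i, (y i - 1) • G i θ₀‖ ≤ √(L' * (σ + 1)) * √(n : ℝ) := by
    refine le_of_eq_of_le ?_ h4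
    simp_rw [smul_comm _ (√(m : ℝ)), ← Finset.smul_sum]
    rw [norm_smul, Real.norm_of_nonneg hsm.le]
  have h6 : √(m : ℝ) * ‖∑ i, G i θ₀‖ ≤ M * √(n : ℝ) := by
    have h7 := ht.normSum_le
    rw [normSum, ← Finset.smul_sum, norm_smul, norm_smul, Real.norm_of_nonneg hsm.le,
      Real.norm_of_nonneg (by positivity), inv_mul_le_iff₀ hsn] at h7
    linarith
  -- The three absorbed errors are c/8 (derivative), c/4 (Taylor) and c/8 (weights), leaving c/2 of
  -- the constant c. The right-hand side, multiplied by √m, is of order √n, and this is the rate.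
  have h7 : n * (δ * (c / 2)) ≤ ‖∑ i, (y i - 1) • G i θ₀‖ + ‖∑ i, G i θ₀‖ := by
    have h8 : ‖∑ i, (G i θ - G i θ₀)‖ ≤ ‖∑ i, (y i - 1) • (G i θ - G i θ₀)‖ +
        ‖∑ i, (y i - 1) • G i θ₀‖ + ‖∑ i, G i θ₀‖ := by
      rw [h2]
      refine (norm_sub_le _ _).trans ?_
      gcongr
      refine (norm_sub_le _ _).trans ?_
      rw [norm_neg]
    nlinarith
  rw [le_div_iff₀ hc, Real.sqrt_mul hn'.le]
  have h8 : √(m : ℝ) * (n * (δ * (c / 2))) ≤ (√(L' * (σ + 1)) + M) * √(n : ℝ) := by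
    calc _ ≤ √(m : ℝ) * (‖∑ i, (y i - 1) • G i θ₀‖ + ‖∑ i, G i θ₀‖) := by gcongr
      _ ≤ _ := by rw [mul_add]; linarith
  have h9 : √(n : ℝ) * √(m : ℝ) * δ * (c / 2) ≤ √(L' * (σ + 1)) + M := by
    refine le_of_mul_le_mul_right ?_ hsn
    calc _ = √(m : ℝ) * (√(n : ℝ) * √(n : ℝ) * (δ * (c / 2))) := by ring
      _ ≤ _ := by rw [hnn]; exact h8
  linarith

/-- Replacing `θ₀` by a value at a distance of order `(n m)^{-1/2}`. -/
lemma IsTypical.shift (ht : IsTypical m G D h θ₀ S J C M ε) (hr : IsRegular G D h θ₀ ρ₀)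
    (hn : 0 < n) (hm : 0 < m) (hC : 0 ≤ C) (hε : 0 ≤ ε) {θ : T}
    (hθ : θ ∈ Metric.closedBall θ₀ ρ₀) {R : ℝ} (hR : √((n : ℝ) * m) * ‖θ - θ₀‖ ≤ R) :
    (∀ i, ‖√(m : ℝ) • G i θ‖ ≤ ε * (1 + R) * √(n : ℝ)) ∧
    (∀ u, ‖sampleMoment (fun i => √(m : ℝ) • G i θ) u - S u‖ ≤
      ε * (1 + (2 + R) * R * C) * ‖u‖) ∧
    ‖normSum (fun i => √(m : ℝ) • G i θ) - (normSum (fun i => √(m : ℝ) • G i θ₀) +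
      J (√((n : ℝ) * m) • (θ - θ₀)))‖ ≤ ε * (R + C * R ^ 2) := by
  set δ := ‖θ - θ₀‖ with hδ
  have hn' : (0 : ℝ) < n := by exact_mod_cast hn
  have hm' : (1 : ℝ) ≤ m := by exact_mod_cast hm
  have hsm : 1 ≤ √(m : ℝ) := Real.one_le_sqrt.2 hm'
  have hsn : 0 < √(n : ℝ) := Real.sqrt_pos.2 hn'
  have hnn : √(n : ℝ) * √(n : ℝ) = n := Real.mul_self_sqrt hn'.le
  have hδ0 : 0 ≤ δ := norm_nonneg _
  have hsnm : √((n : ℝ) * m) = √(n : ℝ) * √(m : ℝ) := Real.sqrt_mul hn'.le _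
  have hR0 : 0 ≤ R := le_trans (by positivity) hR
  rw [hsnm] at hR ⊢
  have he : ∀ i, ‖√(m : ℝ) • G i θ - √(m : ℝ) • G i θ₀‖ ≤ h i * ((√(n : ℝ))⁻¹ * R) := by
    intro i
    rw [← smul_sub, norm_smul, Real.norm_of_nonneg (by positivity)]
    have h1 : √(m : ℝ) * δ ≤ (√(n : ℝ))⁻¹ * R := by
      rw [le_inv_mul_iff₀ hsn]; linarith
    calc √(m : ℝ) * ‖G i θ - G i θ₀‖ ≤ √(m : ℝ) * (h i * δ) := by
          gcongr; exact hr.lipschitz i θ hθ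
      _ = h i * (√(m : ℝ) * δ) := by ring
      _ ≤ _ := by gcongr; exact hr.nonneg i
  have hmax : ∀ i, ‖√(m : ℝ) • G i θ‖ ≤ ε * (1 + R) * √(n : ℝ) := by
    intro i
    have h1 : √(m : ℝ) • G i θ = √(m : ℝ) • G i θ₀ + (√(m : ℝ) • G i θ - √(m : ℝ) • G i θ₀) := by
      abel
    have h2 : h i * ((√(n : ℝ))⁻¹ * R) ≤ ε * n * ((√(n : ℝ))⁻¹ * R) := by
      gcongr; exact ht.envelope_le i
    have h3 : ε * n * ((√(n : ℝ))⁻¹ * R) = ε * R * √(n : ℝ) := by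
      have h4 : (n : ℝ) * (√(n : ℝ))⁻¹ = √(n : ℝ) := by rw [← div_eq_mul_inv, Real.div_sqrt]
      calc _ = ε * R * ((n : ℝ) * (√(n : ℝ))⁻¹) := by ring
        _ = _ := by rw [h4]
    rw [h1]
    linarith [norm_add_le (√(m : ℝ) • G i θ₀) (√(m : ℝ) • G i θ - √(m : ℝ) • G i θ₀),
      ht.max_le i, he i]
  refine ⟨hmax, ?_, ?_⟩
  · intro u
    -- The difference of ⟨u, z⟩ z at θ and at θ₀ is telescoped so that each term has one factor
    -- bounded by the maximum, of order ε√n, and one increment, of order h_i/√n. The powers of n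
    -- cancel and only ∑ h_i is needed.
    have h1 : sampleMoment (fun i => √(m : ℝ) • G i θ) u - S u =
        (n : ℝ)⁻¹ • ∑ i, ((inner ℝ u (√(m : ℝ) • G i θ) : ℝ) •
            (√(m : ℝ) • G i θ - √(m : ℝ) • G i θ₀) +
          (inner ℝ u (√(m : ℝ) • G i θ - √(m : ℝ) • G i θ₀) : ℝ) • (√(m : ℝ) • G i θ₀)) +
        (sampleMoment (fun i => √(m : ℝ) • G i θ₀) u - S u) := by
      have h2 : ∀ i, (inner ℝ u (√(m : ℝ) • G i θ) : ℝ) •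
            (√(m : ℝ) • G i θ - √(m : ℝ) • G i θ₀) +
          (inner ℝ u (√(m : ℝ) • G i θ - √(m : ℝ) • G i θ₀) : ℝ) • (√(m : ℝ) • G i θ₀) =
          (inner ℝ u (√(m : ℝ) • G i θ) : ℝ) • (√(m : ℝ) • G i θ) -
          (inner ℝ u (√(m : ℝ) • G i θ₀) : ℝ) • (√(m : ℝ) • G i θ₀) := by
        intro i
        rw [inner_sub_right, smul_sub, sub_smul]
        abel
      simp_rw [h2, sampleMoment, Finset.sum_sub_distrib, smul_sub]
      abel
    have h3 : ∀ i, ‖(inner ℝ u (√(m : ℝ) • G i θ) : ℝ) •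
            (√(m : ℝ) • G i θ - √(m : ℝ) • G i θ₀) +
          (inner ℝ u (√(m : ℝ) • G i θ - √(m : ℝ) • G i θ₀) : ℝ) • (√(m : ℝ) • G i θ₀)‖ ≤
          h i * (‖u‖ * (ε * (2 + R) * R)) := by
      intro i
      have h4 : ‖(inner ℝ u (√(m : ℝ) • G i θ) : ℝ) •
          (√(m : ℝ) • G i θ - √(m : ℝ) • G i θ₀)‖ ≤
          (‖u‖ * (ε * (1 + R) * √(n : ℝ))) * (h i * ((√(n : ℝ))⁻¹ * R)) := by
        rw [norm_smul]
        refine mul_le_mul ((norm_inner_le_norm _ _).trans ?_) (he i) (norm_nonneg _)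
          (by positivity)
        gcongr
        exact hmax i
      have h5 : ‖(inner ℝ u (√(m : ℝ) • G i θ - √(m : ℝ) • G i θ₀) : ℝ) •
          (√(m : ℝ) • G i θ₀)‖ ≤ (‖u‖ * (h i * ((√(n : ℝ))⁻¹ * R))) * (ε * √(n : ℝ)) := by
        rw [norm_smul]
        refine mul_le_mul ((norm_inner_le_norm _ _).trans ?_) (ht.max_le i) (norm_nonneg _)
          (mul_nonneg (norm_nonneg _) (mul_nonneg (hr.nonneg i) (by positivity)))
        gcongr
        exact he i
      refine (norm_add_le _ _).trans ((add_le_add h4 h5).trans (le_of_eq ?_))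
      field_simp
      ring
    rw [h1]
    refine (norm_add_le _ _).trans ?_
    have h6 : ‖(n : ℝ)⁻¹ • ∑ i, ((inner ℝ u (√(m : ℝ) • G i θ) : ℝ) •
            (√(m : ℝ) • G i θ - √(m : ℝ) • G i θ₀) +
          (inner ℝ u (√(m : ℝ) • G i θ - √(m : ℝ) • G i θ₀) : ℝ) • (√(m : ℝ) • G i θ₀))‖ ≤
        C * (‖u‖ * (ε * (2 + R) * R)) := by
      rw [norm_smul, Real.norm_of_nonneg (by positivity), inv_mul_le_iff₀ hn']
      refine (norm_sum_le _ _).trans ((Finset.sum_le_sum fun i _ => h3 i).trans ?_)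
      rw [← Finset.sum_mul]
      calc _ ≤ (C * n) * (‖u‖ * (ε * (2 + R) * R)) := by gcongr; exact ht.sum_envelope_le
        _ = _ := by ring
    have h7 := ht.moment u
    linarith
  · have h1 : normSum (fun i => √(m : ℝ) • G i θ) - (normSum (fun i => √(m : ℝ) • G i θ₀) +
        J ((√(n : ℝ) * √(m : ℝ)) • (θ - θ₀))) =
        ((√(n : ℝ))⁻¹ * √(m : ℝ)) • ∑ i, (G i θ - G i θ₀ - D i (θ - θ₀)) +
        (√(n : ℝ) * √(m : ℝ)) • ((n : ℝ)⁻¹ • ∑ i, D i (θ - θ₀) - J (θ - θ₀)) := by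
      have h2 : (√(n : ℝ) * √(m : ℝ)) * (n : ℝ)⁻¹ = (√(n : ℝ))⁻¹ * √(m : ℝ) := by
        nth_rw 2 [← hnn]
        rw [mul_inv]
        field_simp
      rw [map_smul, smul_sub, smul_smul, h2]
      simp only [normSum, Finset.sum_sub_distrib, smul_sub, ← Finset.smul_sum, smul_smul]
      abel
    have h3 : ‖((√(n : ℝ))⁻¹ * √(m : ℝ)) • ∑ i, (G i θ - G i θ₀ - D i (θ - θ₀))‖ ≤
        ε * (C * R ^ 2) := by
      have h4 : ‖∑ i, (G i θ - G i θ₀ - D i (θ - θ₀))‖ ≤ C * n * δ ^ 2 := by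
        refine (norm_sum_le _ _).trans ((Finset.sum_le_sum fun i _ => hr.taylor i θ hθ).trans ?_)
        rw [← Finset.sum_mul]
        gcongr
        exact ht.sum_envelope_le
      rw [norm_smul, Real.norm_of_nonneg (by positivity)]
      -- √N δ² = (√N δ)² / √N ≤ R² / √n, and 1/√n ≤ ε by `IsTypical.large`.
      have h5 : √(m : ℝ) * (√(n : ℝ) * δ ^ 2) ≤ ε * R ^ 2 := by
        have h6 : (√(n : ℝ) * √(m : ℝ) * δ) ^ 2 ≤ R ^ 2 := by gcongr
        calc √(m : ℝ) * (√(n : ℝ) * δ ^ 2) ≤ √(m : ℝ) * √(m : ℝ) * ((√(n : ℝ) * δ ^ 2) *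
              (ε * √(n : ℝ))) := by
              have := ht.large
              have h8 : √(m : ℝ) ≤ √(m : ℝ) * √(m : ℝ) := le_mul_of_one_le_left (by positivity) hsm
              have h9 : (√(n : ℝ) * δ ^ 2) ≤ (√(n : ℝ) * δ ^ 2) * (ε * √(n : ℝ)) :=
                le_mul_of_one_le_right (by positivity) this
              gcongr
          _ = ε * (√(n : ℝ) * √(m : ℝ) * δ) ^ 2 := by ring
          _ ≤ _ := by gcongr
      calc (√(n : ℝ))⁻¹ * √(m : ℝ) * ‖∑ i, (G i θ - G i θ₀ - D i (θ - θ₀))‖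
          ≤ (√(n : ℝ))⁻¹ * √(m : ℝ) * (C * n * δ ^ 2) := by gcongr
        _ = C * (√(m : ℝ) * (√(n : ℝ) * δ ^ 2)) := by
            nth_rw 2 [← hnn]
            field_simp
        _ ≤ C * (ε * R ^ 2) := by gcongr
        _ = _ := by ring
    have h4 : ‖(√(n : ℝ) * √(m : ℝ)) • ((n : ℝ)⁻¹ • ∑ i, D i (θ - θ₀) - J (θ - θ₀))‖ ≤ ε * R := by
      rw [norm_smul, Real.norm_of_nonneg (by positivity)]
      calc _ ≤ √(n : ℝ) * √(m : ℝ) * (ε * δ) := by gcongr; exact ht.deriv _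
        _ = ε * (√(n : ℝ) * √(m : ℝ) * δ) := by ring
        _ ≤ _ := by gcongr
    rw [h1]
    linarith [norm_add_le (((√(n : ℝ))⁻¹ * √(m : ℝ)) • ∑ i, (G i θ - G i θ₀ - D i (θ - θ₀)))
      ((√(n : ℝ) * √(m : ℝ)) • ((n : ℝ)⁻¹ • ∑ i, D i (θ - θ₀) - J (θ - θ₀)))]

end Deterministic

lemma eventually_mul_le (a : ℝ) {b : ℝ} (hb : 0 < b) : ∀ᶠ ε in 𝓝[>] (0 : ℝ), a * ε ≤ b := by
  have h : Tendsto (fun ε : ℝ => a * ε) (𝓝[>] 0) (𝓝 (a * 0)) :=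
    ((continuous_const.mul continuous_id).tendsto 0).mono_left nhdsWithin_le_nhds
  rw [mul_zero] at h
  exact h.eventually_le_const hb

/-! ### Quadratic expansion of the statistic and linearization of its minimizers. -/

section Expansion

variable {T F : Type*} [NormedAddCommGroup T] [NormedSpace ℝ T]
  [NormedAddCommGroup F] [InnerProductSpace ℝ F] [FiniteDimensional ℝ F]

/-- Quadratic approximation of the empirical log likelihood ratio statistic in a neighbourhood of
`θ₀` of radius of order `(n m)^{-1/2}`. -/
lemma exists_quadratic_approx {S B : F →L[ℝ] F} {J : T →L[ℝ] F} (hBS : ∀ u, B (S u) = u)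
    (hSB : ∀ u, S (B u) = u) {C : ℝ} (hC : 0 ≤ C) (θ₀ : T) (ρ₀ : ℝ)
    {M : ℝ} (hM : 0 ≤ M) {R : ℝ} (hR : 0 ≤ R) :
    ∃ K : ℝ, 0 ≤ K ∧ ∀ᶠ ε in 𝓝[>] (0 : ℝ), ∀ (n m : ℕ), 0 < n → 0 < m →
      ∀ (G : Fin n → T → F) (D : Fin n → T →L[ℝ] F) (h : Fin n → ℝ),
      IsTypical m G D h θ₀ S J C M ε → IsRegular G D h θ₀ ρ₀ →
      ∀ θ ∈ Metric.closedBall θ₀ ρ₀, √((n : ℝ) * m) * ‖θ - θ₀‖ ≤ R →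
      ∀ s, s = normSum (fun i => √(m : ℝ) • G i θ₀) + J (√((n : ℝ) * m) • (θ - θ₀)) →
      (∃ y, IsAdmissible (fun i => G i θ) y ∧
        2 * ∑ i, -Real.log (y i) ≤ inner ℝ (B s) s + K * ε) ∧
      ∀ y, IsAdmissible (fun i => G i θ) y →
        inner ℝ (B s) s - K * ε ≤ 2 * ∑ i, -Real.log (y i) := by
  set β := ‖B‖ with hβ
  have hβ0 : 0 ≤ β := norm_nonneg _
  have hβle : ∀ u, ‖B u‖ ≤ β * ‖u‖ := B.le_opNorm
  -- K₁ dominates the three constants of `IsTypical.shift`, and M₁ bounds the normalized sum at θ.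
  -- The bounds at θ therefore hold with ε K₁ and M₁ in place of ε and M.
  set K₁ : ℝ := 1 + R + (2 + R) * R * C + C * R ^ 2 with hK₁
  set M₁ : ℝ := M + ‖J‖ * R + 1 with hM₁
  have hK1 : 1 ≤ K₁ := by
    have : 0 ≤ R + (2 + R) * R * C + C * R ^ 2 := by positivity
    linarith
  have hM1 : 1 ≤ M₁ := by
    have : 0 ≤ M + ‖J‖ * R := by positivity
    linarith
  set K₂ : ℝ := K₁ * (16 * β ^ 2 * M₁ ^ 3 + 12 * β ^ 2 * M₁ ^ 2) + 2 * β * M₁ * K₁ with hK₂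
  refine ⟨K₂, by positivity, ?_⟩
  filter_upwards [self_mem_nhdsWithin, eventually_mul_le K₁ one_pos,
    eventually_mul_le (8 * β * M₁ * K₁) one_pos, eventually_mul_le (M₁ ^ 2) one_pos]
    with ε hε0 hε1 hε2 hε3 n m hn hm G D h ht hr θ hθ hθR s hs
  have hε : 0 ≤ ε := le_of_lt hε0
  obtain ⟨h1, h2, h3⟩ := ht.shift hr hn hm hC hε hθ hθR
  have hn' : (0 : ℝ) < n := by exact_mod_cast hn
  have hsm : √(m : ℝ) ≠ 0 := (Real.sqrt_pos.2 (by exact_mod_cast hm)).ne'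
  have e1 : 1 + R ≤ K₁ := by
    have : 0 ≤ (2 + R) * R * C + C * R ^ 2 := by positivity
    linarith
  have e2 : 1 + (2 + R) * R * C ≤ K₁ := by
    have : 0 ≤ R + C * R ^ 2 := by positivity
    linarith
  have e3 : R + C * R ^ 2 ≤ K₁ := by
    have : 0 ≤ 1 + (2 + R) * R * C := by positivity
    linarith
  set ε₁ := ε * K₁ with hε₁
  have hε₁0 : 0 ≤ ε₁ := by positivity
  have h1' : ∀ i, ‖√(m : ℝ) • G i θ‖ ≤ ε₁ * √(n : ℝ) := fun i => (h1 i).trans (by rw [hε₁]; gcongr)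
  have h2' : ∀ u, ‖sampleMoment (fun i => √(m : ℝ) • G i θ) u - S u‖ ≤ ε₁ * ‖u‖ :=
    fun u => (h2 u).trans (by rw [hε₁]; gcongr)
  rw [← hs] at h3
  set x := normSum (fun i => √(m : ℝ) • G i θ) with hx
  have h3' : ‖x - s‖ ≤ ε₁ := h3.trans (by rw [hε₁]; gcongr)
  have hsM : ‖s‖ ≤ M + ‖J‖ * R := by
    rw [hs]
    refine (norm_add_le _ _).trans (add_le_add ht.normSum_le ((J.le_opNorm _).trans ?_))
    gcongr
    rwa [norm_smul, Real.norm_of_nonneg (by positivity)]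
  have hsM1 : ‖s‖ ≤ M₁ := by linarith
  have hxM1 : ‖x‖ ≤ M₁ := by
    have : x = (x - s) + s := by abel
    rw [this]
    linarith [norm_add_le (x - s) s]
  have hQ : |inner ℝ (B x) x - inner ℝ (B s) s| ≤ 2 * β * M₁ * K₁ * ε := by
    have h4 : (inner ℝ (B x) x - inner ℝ (B s) s : ℝ) =
        inner ℝ (B (x - s)) x + inner ℝ (B s) (x - s) := by
      rw [map_sub, inner_sub_left, inner_sub_right]; ring
    rw [h4]
    have h5 : |(inner ℝ (B (x - s)) x : ℝ)| ≤ (β * ε₁) * M₁ :=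
      (abs_real_inner_le_norm _ _).trans (by gcongr; exact (hβle _).trans (by gcongr))
    have h6 : |(inner ℝ (B s) (x - s) : ℝ)| ≤ (β * M₁) * ε₁ :=
      (abs_real_inner_le_norm _ _).trans (by gcongr; exact (hβle _).trans (by gcongr))
    refine (abs_add_le _ _).trans ((add_le_add h5 h6).trans (le_of_eq ?_))
    rw [hε₁]; ring
  have hκ : 4 * β * M₁ * ε₁ ≤ 1 / 2 := by
    rw [hε₁]; linarith
  have hQ' := abs_le.1 hQ
  constructor
  -- A typical sample has ε² n ≥ 1, so M₁² ≤ (M₁² ε)(ε n), where M₁² ε ≤ 1 for small ε.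
  · have hMn : M₁ ^ 2 ≤ ε₁ * n := by
      have h4 : 1 ≤ ε ^ 2 * n := by
        have h5 := ht.large
        calc (1 : ℝ) ≤ (ε * √(n : ℝ)) ^ 2 := one_le_pow₀ h5
          _ = ε ^ 2 * n := by rw [mul_pow, Real.sq_sqrt hn'.le]
      calc M₁ ^ 2 ≤ M₁ ^ 2 * (ε ^ 2 * n) := le_mul_of_one_le_right (by positivity) h4
        _ = (M₁ ^ 2 * ε) * (ε * n) := by ring
        _ ≤ 1 * (ε * n) := by gcongr
        _ ≤ K₁ * (ε * n) := by gcongr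
        _ = _ := by rw [hε₁]; ring
    have hβε : 4 * β * ε₁ ≤ 1 := by
      have : 4 * β * ε₁ ≤ 4 * β * ε₁ * M₁ := le_mul_of_one_le_right (by positivity) hM1
      linarith
    obtain ⟨y, hy, hyL⟩ := exists_statistic_le hn hBS hβle hβ0 hε₁0 h2' h1' hxM1 hM1 hMn hβε hκ
    refine ⟨y, hy.of_smul hsm, hyL.trans ?_⟩
    have : K₂ * ε = ε₁ * (16 * β ^ 2 * M₁ ^ 3 + 12 * β ^ 2 * M₁ ^ 2) + 2 * β * M₁ * K₁ * ε := by
      rw [hK₂, hε₁]; ring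
    linarith
  · intro y hy
    have hκ' : β * M₁ * ε₁ ≤ 1 / 2 := by
      have : 0 ≤ β * M₁ * ε₁ := by positivity
      linarith
    have h4 := (hy.smul √(m : ℝ)).le_statistic hn hSB hβle hβ0 hε₁0 h2' h1' hxM1 hκ'
    have h5 : K₂ * ε = ε₁ * (16 * β ^ 2 * M₁ ^ 3 + 12 * β ^ 2 * M₁ ^ 2) + 2 * β * M₁ * K₁ * ε := by
      rw [hK₂, hε₁]; ring
    have h6 : ε₁ * (4 * β ^ 2 * M₁ ^ 3 + 3 * β ^ 2 * M₁ ^ 2) ≤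
        ε₁ * (16 * β ^ 2 * M₁ ^ 3 + 12 * β ^ 2 * M₁ ^ 2) := by gcongr <;> norm_num
    linarith

/-- For typical samples, a minimizer of the empirical likelihood ratio statistic over a ball that is
not too small is close to a linear function of the normalized sum at `θ₀`. -/
theorem exists_linear_approx {S B : F →L[ℝ] F} {J : T →L[ℝ] F} {Γ : F →L[ℝ] T}
    (hBS : ∀ u, B (S u) = u) (hSB : ∀ u, S (B u) = u)
    (hBsymm : ∀ u v : F, (inner ℝ (B u) v : ℝ) = inner ℝ u (B v))
    {b : ℝ} (hb : 0 < b) (hBpos : ∀ u : F, b * ‖u‖ ^ 2 ≤ inner ℝ (B u) u)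
    {c : ℝ} (hc : 0 < c) (hJ : ∀ v, c * ‖v‖ ≤ ‖J v‖)
    (hΓ : ∀ s v, (inner ℝ (B (s + J (Γ s))) (J v) : ℝ) = 0)
    {C : ℝ} (hC : 0 ≤ C) (θ₀ : T) {ρ₀ : ℝ} (hρ₀ : 0 ≤ ρ₀) (hCρ : C * ρ₀ ≤ c / 4)
    {M : ℝ} (hM : 0 ≤ M) {ε' : ℝ} (hε' : 0 < ε') :
    ∃ ε R : ℝ, 0 < ε ∧ ∀ (n m : ℕ), 0 < n → 0 < m →
      ∀ (G : Fin n → T → F) (D : Fin n → T →L[ℝ] F) (h : Fin n → ℝ),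
      IsTypical m G D h θ₀ S J C M ε → IsRegular G D h θ₀ ρ₀ →
      ∀ ρ ≤ ρ₀, R ≤ √((n : ℝ) * m) * ρ → ∀ θ ∈ Metric.closedBall θ₀ ρ,
      (∀ θ' ∈ Metric.closedBall θ₀ ρ, ∀ y', IsAdmissible (fun i => G i θ') y' → ∀ η > 0,
        ∃ y, IsAdmissible (fun i => G i θ) y ∧
          ∑ i, -Real.log (y i) ≤ ∑ i, -Real.log (y' i) + η) →
      ‖√((n : ℝ) * m) • (θ - θ₀) - Γ (normSum fun i => √(m : ℝ) • G i θ₀)‖ ≤ ε' := by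
  set β := ‖B‖ with hβ
  -- At θ₀ the statistic is at most β M² + 1 once Kε ≤ 1. Half of it bounds the sum of -log, and the
  -- last 1 is the slack η = 1 in the minimizing property.
  set L : ℝ := (β * M ^ 2 + 1) / 2 + 1 with hL
  set σ := ‖S‖ with hσ
  set T₁ : ℝ := 2 * (√((2 + √L) ^ 2 * L * (σ + 1)) + M) / c with hT₁
  have hT₁0 : 0 ≤ T₁ := by positivity
  -- The expansion must hold both at the minimizer, by the rate T₁, and at the comparison point Γ s.
  set R : ℝ := max T₁ (‖Γ‖ * M) with hR
  have hR0 : 0 ≤ R := le_max_of_le_left hT₁0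
  obtain ⟨K, hK0, hK⟩ := exists_quadratic_approx hBS hSB (J := J) hC θ₀ ρ₀ hM hR0
  have hsq : ∀ᶠ ε in 𝓝[>] (0 : ℝ), √((2 + √L) ^ 2 * L * (ε * C)) ≤ c / 8 := by
    filter_upwards [eventually_mul_le ((2 + √L) ^ 2 * L * C) (show 0 < (c / 8) ^ 2 by positivity)]
      with ε hε
    rw [Real.sqrt_le_left (by positivity)]
    linarith
  have hpos : ∀ᶠ ε in 𝓝[>] (0 : ℝ), 0 < ε := self_mem_nhdsWithin
  obtain ⟨ε, hK, hε0, hεL, hε1, hεc, hεK, hεf⟩ := (hK.and (hpos.and (hsq.and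
    ((eventually_mul_le 1 one_pos).and ((eventually_mul_le 1 (show 0 < c / 8 by positivity)).and
    ((eventually_mul_le K one_pos).and (eventually_mul_le (2 * K + 2)
      (show 0 < b * c ^ 2 * ε' ^ 2 by positivity)))))))).exists
  rw [one_mul] at hε1 hεc
  -- The ball only has to contain the comparison point θ₀ + N^{-1/2} Γ s.
  refine ⟨ε, ‖Γ‖ * M, hε0, ?_⟩
  intro n m hn hm G D h ht hr ρ hρ hRρ θ hθ hmin
  have hn' : (0 : ℝ) < n := by exact_mod_cast hn
  have hm' : (0 : ℝ) < m := by exact_mod_cast hm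
  have hN : 0 < √((n : ℝ) * m) := Real.sqrt_pos.2 (by positivity)
  have hρ0 : 0 ≤ ρ := nonneg_of_mul_nonneg_right (le_trans (by positivity) hRρ) hN
  have hsub : Metric.closedBall θ₀ ρ ⊆ Metric.closedBall θ₀ ρ₀ := Metric.closedBall_subset_closedBall hρ
  set s := normSum (fun i => √(m : ℝ) • G i θ₀) with hs
  have hsM : ‖s‖ ≤ M := ht.normSum_le
  have hBs : inner ℝ (B s) s ≤ β * M ^ 2 := by
    refine (real_inner_le_norm _ _).trans ?_
    calc ‖B s‖ * ‖s‖ ≤ (β * ‖s‖) * ‖s‖ := by gcongr; exact B.le_opNorm _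
      _ ≤ (β * M) * M := by gcongr
      _ = _ := by ring
  -- tightness
  have htight : √((n : ℝ) * m) * ‖θ - θ₀‖ ≤ T₁ := by
    obtain ⟨⟨y', hy', hy'L⟩, -⟩ := hK n m hn hm G D h ht hr θ₀ (Metric.mem_closedBall_self hρ₀)
      (by simpa using hR0) s (by simp [hs])
    obtain ⟨y, hy, hyL⟩ := hmin θ₀ (Metric.mem_closedBall_self hρ0) y' hy' 1 one_pos
    refine ht.norm_le hr hn hm hc hJ hC hCρ hε0.le hε1 hεc S.le_opNorm hεL (hsub hθ) hy ?_
    linarith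
  -- comparison with the minimizer of the quadratic approximation
  set t := √((n : ℝ) * m) • (θ - θ₀) with htdef
  set θ' := θ₀ + (√((n : ℝ) * m))⁻¹ • Γ s with hθ'
  have hθ't : √((n : ℝ) * m) • (θ' - θ₀) = Γ s := by
    rw [hθ', add_sub_cancel_left, smul_smul, mul_inv_cancel₀ hN.ne', one_smul]
  have hΓs : ‖Γ s‖ ≤ ‖Γ‖ * M := (Γ.le_opNorm _).trans (by gcongr)
  have hθ'N : √((n : ℝ) * m) * ‖θ' - θ₀‖ = ‖Γ s‖ := by
    rw [← hθ't, norm_smul, Real.norm_of_nonneg hN.le]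
  have hθ'mem : θ' ∈ Metric.closedBall θ₀ ρ := by
    rw [mem_closedBall_iff_norm]
    refine le_of_mul_le_mul_left ?_ hN
    rw [hθ'N]
    exact hΓs.trans hRρ
  obtain ⟨⟨y', hy', hy'L⟩, -⟩ := hK n m hn hm G D h ht hr θ' (hsub hθ'mem)
    (hθ'N.le.trans (hΓs.trans (le_max_right _ _))) _ (by rw [hθ't])
  obtain ⟨y, hy, hyL⟩ := hmin θ' hθ'mem y' hy' ε hε0
  obtain ⟨-, hlow⟩ := hK n m hn hm G D h ht hr θ (hsub hθ) (htight.trans (le_max_left _ _)) _ rfl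
  have hlow := hlow y hy
  rw [← hs, ← htdef] at hlow
  rw [← hs] at hy'L
  -- 2Kε comes from the two uses of the expansion, 2ε from the slack η = ε, doubled in the
  -- statistic.
  have hdiff : inner ℝ (B (s + J t)) (s + J t) - inner ℝ (B (s + J (Γ s))) (s + J (Γ s)) ≤
      (2 * K + 2) * ε := by linarith
  -- Pythagoras: by the normal equations the residual s + J Γ s is orthogonal to the range of J in
  -- the form of B. The excess is then bounded below by b c² ‖t - Γ s‖².
  have hexp : (inner ℝ (B (s + J t)) (s + J t) : ℝ) = inner ℝ (B (s + J (Γ s))) (s + J (Γ s)) +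
      inner ℝ (B (J (t - Γ s))) (J (t - Γ s)) := by
    have h1 : s + J t = (s + J (Γ s)) + J (t - Γ s) := by rw [map_sub]; abel
    set a := s + J (Γ s) with ha
    have h2 : (inner ℝ (B a) (J (t - Γ s)) : ℝ) = 0 := hΓ s _
    have h3 : (inner ℝ (B (J (t - Γ s))) a : ℝ) = 0 := by rw [hBsymm, real_inner_comm, h2]
    rw [h1, map_add B, inner_add_left, inner_add_right (B a) a,
      inner_add_right (B (J (t - Γ s))) a, h2, h3]
    ring
  have hfin : b * c ^ 2 * ‖t - Γ s‖ ^ 2 ≤ b * c ^ 2 * ε' ^ 2 := by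
    refine le_trans ?_ hεf
    refine le_trans ?_ hdiff
    rw [hexp, add_sub_cancel_left]
    refine le_trans ?_ (hBpos _)
    calc b * c ^ 2 * ‖t - Γ s‖ ^ 2 = b * (c * ‖t - Γ s‖) ^ 2 := by ring
      _ ≤ _ := by gcongr; exact hJ _
  exact (pow_le_pow_iff_left₀ (norm_nonneg _) hε'.le two_ne_zero).1
    (le_of_mul_le_mul_left hfin (by positivity))

end Expansion

/-! ### Third absolute moments of sums of independent variables. -/

section Moments

/-- An expansion of |·|³ whose linear term |s| s x integrates to zero when x is centred and
independent of s. After reduction to s + x ≥ 0, the case s ≤ 0 rests on s² + 3sx + 3x² ≥ 0, a form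
of negative discriminant. -/
lemma abs_add_cube_le (s x : ℝ) :
    |s + x| ^ 3 ≤ |s| ^ 3 + 3 * (|s| * s * x) + 3 * (|s| * x ^ 2) + |x| ^ 3 := by
  wlog h : 0 ≤ s + x generalizing s x
  · have h1 := this (-s) (-x) (by linarith)
    rw [← neg_add, abs_neg, abs_neg, abs_neg] at h1
    linarith
  rw [abs_of_nonneg h]
  have hx3 : x ^ 3 ≤ |x| ^ 3 := by rw [← abs_pow]; exact le_abs_self _
  rcases le_total 0 s with hs | hs
  · rw [abs_of_nonneg hs]
    linarith [show (s + x) ^ 3 = s ^ 3 + 3 * (s * s * x) + 3 * (s * x ^ 2) + x ^ 3 by ring]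
  · rw [abs_of_nonpos hs]
    have h1 : s * (s ^ 2 + 3 * s * x + 3 * x ^ 2) ≤ 0 := by
      refine mul_nonpos_of_nonpos_of_nonneg hs ?_
      nlinarith [sq_nonneg (2 * s + 3 * x), sq_nonneg s, sq_nonneg x]
    linarith [show (s + x) ^ 3 = s ^ 3 + 3 * (s * s * x) + 3 * (s * x ^ 2) + x ^ 3 by ring,
      show (-s) ^ 3 + 3 * (-s * s * x) + 3 * (-s * x ^ 2) =
        s ^ 3 + 3 * (s * s * x) + 3 * (s * x ^ 2) -
          2 * (s * (s ^ 2 + 3 * s * x + 3 * x ^ 2)) by ring]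

variable {Ω ι : Type*} [MeasurableSpace Ω] {P : Measure Ω}

lemma _root_.MeasureTheory.MemLp.two_of_three [IsProbabilityMeasure P] {Y : Ω → ℝ} (h : MemLp Y 3 P) : MemLp Y 2 P :=
  h.mono_exponent (by norm_num)

lemma _root_.MeasureTheory.MemLp.integrable_abs_cube {Y : Ω → ℝ} (h : MemLp Y 3 P) :
    Integrable (fun ω => |Y ω| ^ 3) P := by
  have h' : MemLp Y ((3 : ℕ) : ℝ≥0∞) P := by rwa [Nat.cast_ofNat]
  simpa only [Real.norm_eq_abs] using h'.integrable_norm_pow (by norm_num)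

/-- The second moments of sums of independent centred pairs. -/
lemma integral_sum_mul_sum [Fintype ι] {Y Z : ι → Ω → ℝ} (hY : ∀ i, MemLp (Y i) 2 P)
    (hZ : ∀ i, MemLp (Z i) 2 P) (hY0 : ∀ i, ∫ ω, Y i ω ∂P = 0)
    (hind : ∀ i j, i ≠ j → IndepFun (Y i) (Z j) P) :
    ∫ ω, (∑ i, Y i ω) * ∑ i, Z i ω ∂P = ∑ i, ∫ ω, Y i ω * Z i ω ∂P := by
  have h1 : ∀ ω, (∑ i, Y i ω) * ∑ i, Z i ω = ∑ i, ∑ j, Y i ω * Z j ω := fun ω => by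
    rw [Finset.sum_mul_sum]
  have hint : ∀ i j, Integrable (fun ω => Y i ω * Z j ω) P := fun i j =>
    (hY i).integrable_mul (hZ j)
  simp_rw [h1]
  rw [integral_finsetSum _ fun i _ => integrable_finsetSum _ fun j _ => hint i j]
  refine Finset.sum_congr rfl fun i _ => ?_
  rw [integral_finsetSum _ fun j _ => hint i j]
  refine Finset.sum_eq_single i (fun j _ hij => ?_) (by simp)
  have := (hind i j hij.symm).integral_fun_mul_eq_mul_integral (hY i).1 (hZ j).1
  rw [this, hY0 i, zero_mul]

/-- A bound for the third absolute moment of a sum of independent centred random variables. -/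
lemma integral_abs_sum_cube_le [IsProbabilityMeasure P] {Y : ι → Ω → ℝ} (hY : ∀ i, MemLp (Y i) 3 P)
    (hind : iIndepFun Y P) (hY0 : ∀ i, ∫ ω, Y i ω ∂P = 0) {C : ℝ}
    (hC : ∀ i, ∫ ω, |Y i ω| ^ 3 ∂P ≤ C) (s : Finset ι) :
    ∫ ω, |∑ i ∈ s, Y i ω| ^ 3 ∂P ≤ (3 * (C + 1) ^ 2 + C) * (s.card * √(s.card : ℝ)) := by
  classical
  have hsum : ∀ s : Finset ι, MemLp (fun ω => ∑ i ∈ s, Y i ω) 3 P := fun s =>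
    memLp_finsetSum s fun i _ => hY i
  rcases isEmpty_or_nonempty ι with hι | ⟨⟨i₀⟩⟩
  · simp [Finset.eq_empty_of_isEmpty s]
  have hC0 : 0 ≤ C := (integral_nonneg fun ω => by positivity).trans (hC i₀)
  have hsq : ∀ i, ∫ ω, Y i ω ^ 2 ∂P ≤ C + 1 := by
    intro i
    have h1 : ∀ ω, Y i ω ^ 2 ≤ |Y i ω| ^ 3 + 1 := by
      intro ω
      rw [← sq_abs]
      have := abs_nonneg (Y i ω)
      rcases le_total (|Y i ω|) 1 with h | h
      · nlinarith [pow_nonneg this 3]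
      · nlinarith [mul_le_mul_of_nonneg_left h (sq_nonneg (|Y i ω|))]
    calc ∫ ω, Y i ω ^ 2 ∂P ≤ ∫ ω, (|Y i ω| ^ 3 + 1) ∂P :=
          integral_mono (hY i).two_of_three.integrable_sq
            ((hY i).integrable_abs_cube.add (integrable_const _)) h1
      _ = ∫ ω, |Y i ω| ^ 3 ∂P + 1 := by
          rw [integral_add (hY i).integrable_abs_cube (integrable_const _)]; simp
      _ ≤ C + 1 := by linarith [hC i]
  induction s using Finset.induction_on with
  | empty => simp
  | insert i s hi ih =>
    set S : Ω → ℝ := fun ω => ∑ j ∈ s, Y j ω with hS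
    have hSm : MemLp S 3 P := hsum s
    have hSi : IndepFun S (Y i) P := by
      have := hind.indepFun_finsetSum_of_notMem₀ (fun i => (hY i).1.aemeasurable) hi
      convert this using 1
      ext ω
      simp [hS]
    have hSS : ∫ ω, S ω ^ 2 ∂P ≤ (C + 1) * s.card := by
      have h1 : ∫ ω, S ω ^ 2 ∂P = ∑ j : s, ∫ ω, Y j ω * Y j ω ∂P := by
        have := integral_sum_mul_sum (P := P) (Y := fun j : s => Y j) (Z := fun j : s => Y j)
          (fun j => (hY j).two_of_three) (fun j => (hY j).two_of_three) (fun j => hY0 j)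
          (fun j k hjk => hind.indepFun fun h => hjk (Subtype.ext h))
        rw [← this]
        congr 1 with ω
        rw [sq, hS]
        simp only [Finset.sum_coe_sort s (fun j => Y j ω)]
      rw [h1]
      calc ∑ j : s, ∫ ω, Y j ω * Y j ω ∂P ≤ ∑ j : s, (C + 1) :=
            Finset.sum_le_sum fun j _ => by simpa only [sq] using hsq j
        _ = _ := by simp; ring
    set k : ℝ := (s.card : ℝ) with hk
    have hk0 : 0 ≤ k := by positivity
    -- √(k + 1) rather than √k, so that it can be inverted when the sum is still empty.
    set a := √(k + 1) with ha
    have ha0 : 0 < a := Real.sqrt_pos.2 (by positivity)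
    have ha1 : 1 ≤ a := Real.one_le_sqrt.2 (by linarith)
    have ha2 : a * a = k + 1 := Real.mul_self_sqrt (by positivity)
    have hka : √k ≤ a := Real.sqrt_le_sqrt (by linarith)
    have hSabs : ∫ ω, |S ω| ∂P ≤ (C + 1) * a := by
      -- The inequality of arithmetic and geometric means, used in place of Cauchy–Schwarz to pass
      -- from the second moment to the first.
      have h1 : ∀ ω, |S ω| ≤ a⁻¹ * S ω ^ 2 / 2 + a / 2 := by
        intro ω
        rw [← sq_abs]
        have : 0 ≤ a⁻¹ * (|S ω| - a) ^ 2 := by positivity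
        have h2 : a⁻¹ * (|S ω| - a) ^ 2 = a⁻¹ * |S ω| ^ 2 - 2 * |S ω| + a := by field_simp; ring
        linarith
      calc ∫ ω, |S ω| ∂P ≤ ∫ ω, (a⁻¹ * S ω ^ 2 / 2 + a / 2) ∂P :=
            integral_mono (hSm.integrable (by norm_num)).abs
              (((hSm.two_of_three.integrable_sq.const_mul _).div_const _).add
                (integrable_const _)) h1
        _ = a⁻¹ * (∫ ω, S ω ^ 2 ∂P) / 2 + a / 2 := by
            rw [integral_add ((hSm.two_of_three.integrable_sq.const_mul _).div_const _)
              (integrable_const _), integral_div, integral_const_mul]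
            simp
        _ ≤ a⁻¹ * ((C + 1) * (a * a)) / 2 + a / 2 := by
            gcongr
            exact hSS.trans (by gcongr; linarith)
        _ = (C + 1) * a / 2 + a / 2 := by field_simp
        _ ≤ _ := by nlinarith
    have i1 : Integrable (fun ω => |S ω| ^ 3) P := hSm.integrable_abs_cube
    have i2 : Integrable (fun ω => |S ω| * S ω * Y i ω) P := by
      have hi : IndepFun (fun ω => |S ω| * S ω) (Y i) P :=
        hSi.comp (φ := fun x : ℝ => |x| * x) (ψ := id) (by fun_prop) measurable_id
      refine hi.integrable_mul ?_ ((hY i).integrable (by norm_num))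
      exact hSm.two_of_three.abs.integrable_mul hSm.two_of_three
    have e2 : ∫ ω, |S ω| * S ω * Y i ω ∂P = 0 := by
      have hi : IndepFun (fun ω => |S ω| * S ω) (Y i) P :=
        hSi.comp (φ := fun x : ℝ => |x| * x) (ψ := id) (by fun_prop) measurable_id
      rw [hi.integral_fun_mul_eq_mul_integral (hSm.1.norm.mul hSm.1) (hY i).1, hY0 i, mul_zero]
    have hi3 : IndepFun (fun ω => |S ω|) (fun ω => Y i ω ^ 2) P :=
      hSi.comp (φ := fun x : ℝ => |x|) (ψ := fun x => x ^ 2) (by fun_prop) (by fun_prop)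
    have i3 : Integrable (fun ω => |S ω| * Y i ω ^ 2) P :=
      hi3.integrable_mul (hSm.integrable (by norm_num)).abs (hY i).two_of_three.integrable_sq
    have e3 : ∫ ω, |S ω| * Y i ω ^ 2 ∂P ≤ (C + 1) * a * (C + 1) := by
      rw [hi3.integral_fun_mul_eq_mul_integral hSm.1.norm ((hY i).1.pow 2)]
      have : 0 ≤ ∫ ω, Y i ω ^ 2 ∂P := integral_nonneg fun ω => sq_nonneg _
      gcongr
      exact hsq i
    have j1 : Integrable (fun ω => |S ω| ^ 3 + 3 * (|S ω| * S ω * Y i ω)) P :=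
      i1.add (i2.const_mul 3)
    have j2 : Integrable (fun ω => |S ω| ^ 3 + 3 * (|S ω| * S ω * Y i ω) +
        3 * (|S ω| * Y i ω ^ 2)) P := j1.add (i3.const_mul 3)
    have hadd : ∫ ω, |S ω + Y i ω| ^ 3 ∂P ≤ ∫ ω, |S ω| ^ 3 ∂P +
        3 * ((C + 1) * a * (C + 1)) + C := by
      calc ∫ ω, |S ω + Y i ω| ^ 3 ∂P ≤ ∫ ω, (|S ω| ^ 3 + 3 * (|S ω| * S ω * Y i ω) +
            3 * (|S ω| * Y i ω ^ 2) + |Y i ω| ^ 3) ∂P := by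
            refine integral_mono ?_ ?_ fun ω => abs_add_cube_le _ _
            · exact (hSm.add (hY i)).integrable_abs_cube
            · exact j2.add (hY i).integrable_abs_cube
        _ = ∫ ω, |S ω| ^ 3 ∂P + 3 * ∫ ω, |S ω| * S ω * Y i ω ∂P +
            3 * ∫ ω, |S ω| * Y i ω ^ 2 ∂P + ∫ ω, |Y i ω| ^ 3 ∂P := by
            rw [integral_add j2 (hY i).integrable_abs_cube, integral_add j1 (i3.const_mul 3),
              integral_add i1 (i2.const_mul 3), integral_const_mul, integral_const_mul]
        _ ≤ _ := by rw [e2]; linarith [hC i]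
    have hcard : ((insert i s).card : ℝ) = k + 1 := by
      rw [Finset.card_insert_of_notMem hi]; push_cast; rfl
    have hins : ∀ ω, ∑ j ∈ insert i s, Y j ω = S ω + Y i ω := fun ω => by
      rw [Finset.sum_insert hi, add_comm]
    simp_rw [hins, hcard]
    -- Each new summand adds at most (3(C + 1)² + C) √(k + 1), so the total over k summands is at
    -- most this constant times k√k.
    have h9 : C ≤ C * a := le_mul_of_one_le_right hC0 ha1
    have h10 : (3 * (C + 1) ^ 2 + C) * (k * √k) ≤ (3 * (C + 1) ^ 2 + C) * (k * a) := by gcongr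
    have h11 : (3 * (C + 1) ^ 2 + C) * ((k + 1) * a) = (3 * (C + 1) ^ 2 + C) * (k * a) +
      3 * ((C + 1) * a * (C + 1)) + C * a := by ring
    linarith

end Moments

/-! ### Law of large numbers and maxima for uniformly integrable triangular arrays. -/

section LawOfLargeNumbers

/-- A weak law of large numbers with an explicit error, by truncation at the level `K`. -/
lemma integral_abs_average_sub_le {E : Type*} [MeasurableSpace E] {ν : Measure E}
    [IsProbabilityMeasure ν] {φ : E → ℝ} (hφ : Integrable φ ν) {K η : ℝ} (hK : 0 < K)
    (hη : ∫ x, max (|φ x| - K) 0 ∂ν ≤ η) {n : ℕ} (hn : 0 < n) :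
    ∫ x : Fin n → E, |(n : ℝ)⁻¹ * ∑ i, φ (x i) - ∫ y, φ y ∂ν| ∂(Measure.pi fun _ => ν) ≤
      K / √(n : ℝ) + 2 * η := by
  set P : Measure (Fin n → E) := Measure.pi fun _ => ν with hP
  have hn' : (0 : ℝ) < n := by exact_mod_cast hn
  -- Clipping makes |φ - ψ| exactly the excess (|φ| - K)⁺. It enters twice, in the sample average
  -- and in the mean, whence 2η; the bounded part has variance at most K².
  set ψ : E → ℝ := fun x => max (-K) (min K (φ x)) with hψ
  have hdiff : ∀ x, |φ x - ψ x| = max (|φ x| - K) 0 := by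
    intro x
    simp only [hψ]
    rcases le_total (φ x) (-K) with h | h
    · rw [min_eq_right (by linarith), max_eq_left h, abs_of_nonpos (by linarith : φ x ≤ 0),
        max_eq_left (by linarith), abs_of_nonpos (by linarith)]
      ring
    · rcases le_total (φ x) K with h' | h'
      · rw [min_eq_right h', max_eq_right h, sub_self, abs_zero, max_eq_right]
        linarith [abs_le.2 ⟨h, h'⟩]
      · rw [min_eq_left h', max_eq_right (by linarith), abs_of_nonneg (by linarith : 0 ≤ φ x),
          max_eq_left (by linarith), abs_of_nonneg (by linarith)]
  have hψK : ∀ x, |ψ x| ≤ K := fun x =>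
    abs_le.2 ⟨le_max_left _ _, max_le (by linarith) (min_le_left _ _)⟩
  have hψm : AEStronglyMeasurable ψ ν :=
    aestronglyMeasurable_const.sup (aestronglyMeasurable_const.inf hφ.1)
  have hψ2 : MemLp ψ 2 ν := MemLp.of_bound hψm K (ae_of_all _ hψK)
  have hψ1 : Integrable ψ ν := hψ2.integrable (by norm_num)
  have hψ2' : ∀ i : Fin n, MemLp (fun x : Fin n → E => ψ (x i)) 2 P := fun i =>
    hψ2.comp_measurePreserving (measurePreserving_eval _ i)
  set A : (Fin n → E) → ℝ := fun x => ∑ i, ψ (x i) with hA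
  have hA2 : MemLp A 2 P := memLp_finsetSum _ fun i _ => hψ2' i
  have hev : ∀ i : Fin n, ∀ f : E → ℝ, AEStronglyMeasurable f ν →
      ∫ x, f (x i) ∂P = ∫ y, f y ∂ν := fun i f hf =>
    integral_comp_eval (μ := fun _ : Fin n => ν) hf
  have hAmean : ∫ x, A x ∂P = n * ∫ y, ψ y ∂ν := by
    rw [hA, integral_finsetSum _ fun i _ => (hψ2' i).integrable (by norm_num)]
    simp [hev _ ψ hψm]
  have hAvar : ∫ x, (A x - n * ∫ y, ψ y ∂ν) ^ 2 ∂P ≤ n * K ^ 2 := by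
    have h1 : variance A P = ∑ i : Fin n, variance ψ ν := by
      have := variance_sum_pi (μ := fun _ : Fin n => ν) (X := fun _ => ψ) fun _ => hψ2
      rw [← this]
      congr 1
      ext x
      simp [hA]
    rw [variance_eq_integral hA2.1.aemeasurable, hAmean] at h1
    rw [h1]
    have h2 : variance ψ ν ≤ K ^ 2 := by
      refine (variance_le_expectation_sq hψm).trans ?_
      calc ∫ x, (ψ ^ 2) x ∂ν ≤ ∫ _, K ^ 2 ∂ν := by
            refine integral_mono hψ2.integrable_sq (integrable_const _) fun x => ?_
            simp only [Pi.pow_apply]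
            exact sq_le_sq' (abs_le.1 (hψK x)).1 (abs_le.1 (hψK x)).2
        _ = K ^ 2 := by simp
    calc ∑ i : Fin n, variance ψ ν ≤ ∑ i : Fin n, K ^ 2 := Finset.sum_le_sum fun _ _ => h2
      _ = _ := by simp
  have hsn : 0 < √(n : ℝ) := Real.sqrt_pos.2 hn'
  have hnn : √(n : ℝ) * √(n : ℝ) = n := Real.mul_self_sqrt hn'.le
  have hAc2 : MemLp (fun x => A x - n * ∫ y, ψ y ∂ν) 2 P := hA2.sub (memLp_const _)
  have hpart1 : ∫ x, |(n : ℝ)⁻¹ * (A x - n * ∫ y, ψ y ∂ν)| ∂P ≤ K / √(n : ℝ) := by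
    -- The weight is chosen so that, after the variance bound, both terms equal half of K/√n.
    have h1 : ∀ x, |(n : ℝ)⁻¹ * (A x - n * ∫ y, ψ y ∂ν)| ≤
        (2 * K * √(n : ℝ) * n)⁻¹ * (A x - n * ∫ y, ψ y ∂ν) ^ 2 + K / √(n : ℝ) / 2 := by
      intro x
      set b := A x - n * ∫ y, ψ y ∂ν
      rw [abs_mul, abs_of_pos (by positivity), ← sq_abs b]
      have h2 : 0 ≤ (2 * K * √(n : ℝ) * n)⁻¹ * (|b| - K * √(n : ℝ)) ^ 2 := by positivity
      have h3 : (2 * K * √(n : ℝ) * n)⁻¹ * (|b| - K * √(n : ℝ)) ^ 2 =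
          (2 * K * √(n : ℝ) * n)⁻¹ * |b| ^ 2 - (n : ℝ)⁻¹ * |b| + K / √(n : ℝ) / 2 := by
        generalize √(n : ℝ) = a at hsn hnn
        rw [← hnn]
        field_simp
        ring
      linarith
    calc _ ≤ ∫ x, ((2 * K * √(n : ℝ) * n)⁻¹ * (A x - n * ∫ y, ψ y ∂ν) ^ 2 +
            K / √(n : ℝ) / 2) ∂P :=
          integral_mono ((hAc2.integrable (by norm_num)).const_mul _).abs
            ((hAc2.integrable_sq.const_mul _).add (integrable_const _)) h1
      _ = (2 * K * √(n : ℝ) * n)⁻¹ * ∫ x, (A x - n * ∫ y, ψ y ∂ν) ^ 2 ∂P +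
            K / √(n : ℝ) / 2 := by
          rw [integral_add (hAc2.integrable_sq.const_mul _) (integrable_const _),
            integral_const_mul]
          simp
      _ ≤ (2 * K * √(n : ℝ) * n)⁻¹ * (n * K ^ 2) + K / √(n : ℝ) / 2 := by gcongr
      _ = _ := by field_simp; ring
  have hd : Integrable (fun x => |φ x - ψ x|) ν := (hφ.sub hψ1).abs
  have hd' : ∀ i : Fin n, Integrable (fun x : Fin n → E => |φ (x i) - ψ (x i)|) P := fun i =>
    (measurePreserving_eval (fun _ : Fin n => ν) i).integrable_comp_of_integrable hd
  have hφ' : ∀ i : Fin n, Integrable (fun x : Fin n → E => φ (x i)) P := fun i =>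
    (measurePreserving_eval (fun _ : Fin n => ν) i).integrable_comp_of_integrable hφ
  have hdη : ∫ x, |φ x - ψ x| ∂ν ≤ η := by simpa only [hdiff] using hη
  have hmean : |∫ y, ψ y ∂ν - ∫ y, φ y ∂ν| ≤ η := by
    rw [abs_sub_comm, ← integral_sub hφ hψ1]
    exact (abs_integral_le_integral_abs).trans hdη
  have hpt : ∀ x : Fin n → E, |(n : ℝ)⁻¹ * ∑ i, φ (x i) - ∫ y, φ y ∂ν| ≤
      |(n : ℝ)⁻¹ * (A x - n * ∫ y, ψ y ∂ν)| + (n : ℝ)⁻¹ * ∑ i, |φ (x i) - ψ (x i)| + η := by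
    intro x
    have h1 : (n : ℝ)⁻¹ * ∑ i, φ (x i) - ∫ y, φ y ∂ν = (n : ℝ)⁻¹ * (A x - n * ∫ y, ψ y ∂ν) +
        (n : ℝ)⁻¹ * ∑ i, (φ (x i) - ψ (x i)) + (∫ y, ψ y ∂ν - ∫ y, φ y ∂ν) := by
      rw [hA, Finset.sum_sub_distrib]
      field_simp
      ring
    rw [h1]
    refine (abs_add_three _ _ _).trans ?_
    gcongr
    rw [abs_mul, abs_of_pos (by positivity : 0 < (n : ℝ)⁻¹)]
    gcongr
    exact Finset.abs_sum_le_sum_abs _ _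
  have i1 : Integrable (fun x => |(n : ℝ)⁻¹ * (A x - n * ∫ y, ψ y ∂ν)|) P :=
    ((hAc2.integrable (by norm_num)).const_mul _).abs
  have i2 : Integrable (fun x : Fin n → E => (n : ℝ)⁻¹ * ∑ i, |φ (x i) - ψ (x i)|) P :=
    (integrable_finsetSum _ fun i _ => hd' i).const_mul _
  calc _ ≤ ∫ x : Fin n → E, (|(n : ℝ)⁻¹ * (A x - n * ∫ y, ψ y ∂ν)| +
        (n : ℝ)⁻¹ * ∑ i, |φ (x i) - ψ (x i)| + η) ∂P := by
        refine integral_mono ?_ ((i1.add i2).add (integrable_const _)) hpt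
        exact (((integrable_finsetSum _ fun i _ => hφ' i).const_mul _).sub
          (integrable_const _)).abs
    _ = ∫ x, |(n : ℝ)⁻¹ * (A x - n * ∫ y, ψ y ∂ν)| ∂P + ∫ x, |φ x - ψ x| ∂ν + η := by
        have i12 : Integrable (fun x : Fin n → E => |(n : ℝ)⁻¹ * (A x - n * ∫ y, ψ y ∂ν)| +
          (n : ℝ)⁻¹ * ∑ i, |φ (x i) - ψ (x i)|) P := i1.add i2
        rw [integral_add i12 (integrable_const _), integral_add i1 i2, integral_const_mul,
          integral_finsetSum _ fun i _ => hd' i]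
        simp_rw [fun i => hev i (fun x => |φ x - ψ x|) hd.1]
        simp [hn'.ne']
    _ ≤ _ := by linarith

variable {E : ℕ → Type*} [∀ n, MeasurableSpace (E n)]

/-- A uniform integrability condition for a sequence of functions on a sequence of spaces. -/
structure IsUnifIntegrable (ν : ∀ n, Measure (E n)) (φ : ∀ n, E n → ℝ) : Prop where
  integrable : ∀ n, Integrable (φ n) (ν n)
  small : ∀ η > 0, ∃ K > 0, ∀ n, ∫ x, max (|φ n x| - K) 0 ∂(ν n) ≤ η

variable {ν : ∀ n, Measure (E n)} [∀ n, IsProbabilityMeasure (ν n)] {φ : ∀ n, E n → ℝ}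

/-- The weak law of large numbers for a uniformly integrable triangular array. -/
lemma IsUnifIntegrable.tendsto_average (h : IsUnifIntegrable ν φ) {ε : ℝ} (hε : 0 < ε) :
    Tendsto (fun n => Measure.pi (fun _ : Fin n => ν n)
      {x | ε ≤ |(n : ℝ)⁻¹ * ∑ i, φ n (x i) - ∫ y, φ n y ∂(ν n)|}) atTop (𝓝 0) := by
  have hint : ∀ n, Integrable (fun x : Fin n → E n =>
      |(n : ℝ)⁻¹ * ∑ i, φ n (x i) - ∫ y, φ n y ∂(ν n)|) (Measure.pi (fun _ : Fin n => ν n)) :=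
    fun n => (((integrable_finsetSum _ fun i _ => (measurePreserving_eval (fun _ : Fin n => ν n)
      i).integrable_comp_of_integrable (h.integrable n)).const_mul _).sub
        (integrable_const _)).abs
  have hreal : Tendsto (fun n => (Measure.pi (fun _ : Fin n => ν n)).real
      {x | ε ≤ |(n : ℝ)⁻¹ * ∑ i, φ n (x i) - ∫ y, φ n y ∂(ν n)|}) atTop (𝓝 0) := by
    refine tendsto_order.2 ⟨fun a ha => Eventually.of_forall fun n =>
      ha.trans_le measureReal_nonneg, fun a ha => ?_⟩
    -- Markov's inequality needs a mean below ε a: 2η accounts for ε a/4 and K/√n eventually for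
    -- less than ε a/2.
    obtain ⟨K, hK, hKη⟩ := h.small (ε * a / 8) (by positivity)
    have hlim : Tendsto (fun n : ℕ => K / √(n : ℝ)) atTop (𝓝 0) :=
      tendsto_const_nhds.div_atTop (Real.tendsto_sqrt_atTop.comp tendsto_natCast_atTop_atTop)
    filter_upwards [hlim.eventually_lt_const (show 0 < ε * a / 2 by positivity),
      eventually_gt_atTop 0] with n hn hn0
    have h1 := integral_abs_average_sub_le (h.integrable n) hK (hKη n) hn0
    have h2 := mul_meas_ge_le_integral_of_nonneg (ae_of_all _ fun x => abs_nonneg _) (hint n) ε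
    refine lt_of_mul_lt_mul_left (h2.trans_lt (h1.trans_lt ?_)) hε.le
    have : 0 < ε * a := by positivity
    linarith
  rw [← ENNReal.toReal_zero, ← ENNReal.tendsto_toReal_iff (fun n => measure_ne_top _ _)
    ENNReal.zero_ne_top] at *
  simpa [measureReal_def] using hreal

/-- The maximum of a uniformly integrable triangular array is `o(n)`. -/
lemma IsUnifIntegrable.tendsto_max (h : IsUnifIntegrable ν φ) {ε : ℝ} (hε : 0 < ε) :
    Tendsto (fun n => Measure.pi (fun _ : Fin n => ν n)
      {x | ∃ i, ε * n ≤ |φ n (x i)|}) atTop (𝓝 0) := by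
  have hreal : Tendsto (fun n => n * (ν n).real {y | ε * n ≤ |φ n y|}) atTop (𝓝 0) := by
    refine tendsto_order.2 ⟨fun a ha => Eventually.of_forall fun n =>
      ha.trans_le (by positivity), fun a ha => ?_⟩
    -- Once εn ≥ 2K, the event |φ| ≥ εn forces an excess over K of at least εn/2. Markov's
    -- inequality then gives n times its probability at most a/2, ready for a union bound over n
    -- terms.
    obtain ⟨K, hK, hKη⟩ := h.small (ε * a / 4) (by positivity)
    have hlim : Tendsto (fun n : ℕ => ε * n) atTop atTop :=
      tendsto_natCast_atTop_atTop.const_mul_atTop hε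
    filter_upwards [hlim.eventually_ge_atTop (2 * K), eventually_gt_atTop 0] with n hn hn0
    have hn' : (0 : ℝ) < n := by exact_mod_cast hn0
    have hi : Integrable (fun x => max (|φ n x| - K) 0) (ν n) :=
      ((h.integrable n).abs.sub (integrable_const _)).pos_part
    have h2 := mul_meas_ge_le_integral_of_nonneg (ae_of_all _ fun x => le_max_right _ _) hi
      (ε * n / 2)
    have h3 : (ν n).real {y | ε * n ≤ |φ n y|} ≤
        (ν n).real {x | ε * n / 2 ≤ max (|φ n x| - K) 0} := by
      refine measureReal_mono fun y hy => ?_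
      simp only [Set.mem_ofPred_eq] at hy ⊢
      exact le_max_of_le_left (by linarith)
    have h4 : ε * n / 2 * (ν n).real {y | ε * n ≤ |φ n y|} ≤ ε * a / 4 :=
      (mul_le_mul_of_nonneg_left h3 (by positivity)).trans (h2.trans (hKη n))
    have h5 : ε * (n * (ν n).real {y | ε * n ≤ |φ n y|}) < ε * a := by
      have : 0 < ε * a := by positivity
      linarith
    exact lt_of_mul_lt_mul_left h5 hε.le
  have hle : ∀ n, Measure.pi (fun _ : Fin n => ν n) {x | ∃ i, ε * n ≤ |φ n (x i)|} ≤
      ENNReal.ofReal (n * (ν n).real {y | ε * n ≤ |φ n y|}) := by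
    intro n
    have h1 : {x : Fin n → E n | ∃ i, ε * n ≤ |φ n (x i)|} =
        ⋃ i, (Function.eval i) ⁻¹' {y | ε * n ≤ |φ n y|} := by ext x; simp
    have hnull : NullMeasurableSet {y | ε * n ≤ |φ n y|} (ν n) :=
      nullMeasurableSet_le aemeasurable_const (h.integrable n).abs.1.aemeasurable
    rw [h1]
    refine (measure_iUnion_le _).trans ?_
    simp_rw [fun i => (measurePreserving_eval (fun _ : Fin n => ν n) i).measure_preimage hnull]
    rw [tsum_fintype, Finset.sum_const, ENNReal.ofReal_mul (by positivity), ofReal_measureReal]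
    simp
  have := (ENNReal.tendsto_ofReal hreal)
  rw [ENNReal.ofReal_zero] at this
  exact tendsto_of_tendsto_of_tendsto_of_le_of_le tendsto_const_nhds this (fun _ => zero_le) hle

end LawOfLargeNumbers

/-! ### Moments and uniform integrability of group means, uniformly in the group size. -/

/-- The mean of `f` over the observations of a group. -/
noncomputable def groupMean {𝓧 V : Type*} [AddCommGroup V] [Module ℝ V] {m : ℕ} (f : 𝓧 → V)
    (x : Fin m → 𝓧) : V := (m : ℝ)⁻¹ • ∑ j, f (x j)

section Groups

variable {𝓧 : Type*} [MeasurableSpace 𝓧] {μ : Measure 𝓧} [IsProbabilityMeasure μ] {f g : 𝓧 → ℝ}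

lemma integrable_groupMean (hf : Integrable f μ) (m : ℕ) :
    Integrable (fun x : Fin m → 𝓧 => groupMean f x) (Measure.pi fun _ => μ) :=
  (integrable_finsetSum _ fun _ _ => integrable_comp_eval hf).smul (m : ℝ)⁻¹

lemma integral_groupMean (hf : Integrable f μ) {m : ℕ} (hm : 0 < m) :
    ∫ x : Fin m → 𝓧, groupMean f x ∂(Measure.pi fun _ => μ) = ∫ x, f x ∂μ := by
  have hm' : (m : ℝ) ≠ 0 := by exact_mod_cast hm.ne'
  simp_rw [groupMean, smul_eq_mul]
  rw [integral_const_mul, integral_finsetSum _ fun j _ => integrable_comp_eval hf]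
  simp_rw [fun j => integral_comp_eval (μ := fun _ : Fin m => μ) (i := j) hf.1]
  simp [hm']

lemma exists_integral_excess_le (hf : Integrable f μ) {η : ℝ} (hη : 0 < η) :
    ∃ K > 0, ∫ x, max (|f x| - K) 0 ∂μ ≤ η := by
  have hlim : Tendsto (fun k : ℕ => ∫ x, max (|f x| - k) 0 ∂μ) atTop (𝓝 (∫ _, (0 : ℝ) ∂μ)) := by
    refine tendsto_integral_of_dominated_convergence (fun x => |f x|)
      (fun k => ((hf.abs.sub (integrable_const _)).pos_part).1) hf.abs ?_ ?_
    · refine fun k => ae_of_all _ fun x => ?_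
      rw [Real.norm_of_nonneg (le_max_right _ _)]
      exact max_le (by linarith [Nat.cast_nonneg (α := ℝ) k]) (abs_nonneg _)
    · refine ae_of_all _ fun x => tendsto_const_nhds.congr' ?_
      filter_upwards [tendsto_natCast_atTop_atTop.eventually_ge_atTop |f x|] with k hk
      rw [max_eq_right]
      linarith
  rw [integral_zero] at hlim
  obtain ⟨k, hk, hk0⟩ := ((hlim.eventually_le_const hη).and (eventually_gt_atTop 0)).exists
  exact ⟨k, by exact_mod_cast hk0, hk⟩

/-- The function t ↦ (|t| - K)⁺ is convex, so the excess of a group mean is at most the group mean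
of the excesses. Its integral does not depend on the group size, and one K serves every n. -/
lemma isUnifIntegrable_groupMean (hf : Integrable f μ) {m : ℕ → ℕ} (hm : ∀ n, 0 < m n) :
    IsUnifIntegrable (E := fun n => Fin (m n) → 𝓧) (fun _ => Measure.pi fun _ => μ)
      (fun _ x => groupMean f x) := by
  refine ⟨fun n => integrable_groupMean hf _, fun η hη => ?_⟩
  obtain ⟨K, hK, hKη⟩ := exists_integral_excess_le hf hη
  refine ⟨K, hK, fun n => ?_⟩
  have hi : Integrable (fun x => max (|f x| - K) 0) μ :=
    (hf.abs.sub (integrable_const _)).pos_part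
  have hmn : (0 : ℝ) < m n := by exact_mod_cast hm n
  refine (integral_mono (((integrable_groupMean hf _).abs.sub (integrable_const _)).pos_part)
    (integrable_groupMean hi _) fun x => ?_).trans ((integral_groupMean hi (hm n)).le.trans hKη)
  have h1 : ∀ j, |f (x j)| ≤ max (|f (x j)| - K) 0 + K := fun j => by
    linarith [le_max_left (|f (x j)| - K) 0]
  have h2 : |groupMean f x| ≤ groupMean (fun x => max (|f x| - K) 0) x + K := by
    simp only [groupMean, smul_eq_mul]
    rw [abs_mul, abs_of_pos (by positivity)]
    calc (m n : ℝ)⁻¹ * |∑ j, f (x j)| ≤ (m n : ℝ)⁻¹ * ∑ j, (max (|f (x j)| - K) 0 + K) := by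
          gcongr
          exact (Finset.abs_sum_le_sum_abs _ _).trans (Finset.sum_le_sum fun j _ => h1 j)
      _ = _ := by
          rw [Finset.sum_add_distrib, mul_add]
          simp [hmn.ne']
  refine max_le (by simp only [Pi.sub_apply]; linarith) ?_
  simp only [groupMean, smul_eq_mul]
  exact mul_nonneg (by positivity) (Finset.sum_nonneg fun j _ => le_max_right _ _)

lemma iIndepFun_comp_eval {ι : Type*} [Fintype ι] (hf : AEStronglyMeasurable f μ) :
    iIndepFun (fun (i : ι) (x : ι → 𝓧) => f (x i)) (Measure.pi fun _ => μ) :=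
  iIndepFun_pi (μ := fun _ : ι => μ) (X := fun _ => f) fun _ => hf.aemeasurable

lemma memLp_comp_eval {ι : Type*} [Fintype ι] {q : ℝ≥0∞} (hf : MemLp f q μ) (i : ι) :
    MemLp (fun x : ι → 𝓧 => f (x i)) q (Measure.pi fun _ => μ) :=
  hf.comp_measurePreserving (measurePreserving_eval (fun _ : ι => μ) i)

lemma integral_sum_eval_mul_sum_eval {ι : Type*} [Fintype ι] (hf : MemLp f 2 μ) (hg : MemLp g 2 μ)
    (hf0 : ∫ x, f x ∂μ = 0) :
    ∫ x : ι → 𝓧, (∑ i, f (x i)) * ∑ i, g (x i) ∂(Measure.pi fun _ => μ) =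
      Fintype.card ι * ∫ x, f x * g x ∂μ := by
  rw [integral_sum_mul_sum (fun i => memLp_comp_eval hf i) (fun i => memLp_comp_eval hg i)]
  · simp_rw [fun i => integral_comp_eval (μ := fun _ : ι => μ) (i := i) (f := fun x => f x * g x)
      (hf.1.mul hg.1)]
    simp
  · intro i
    rw [integral_comp_eval (μ := fun _ : ι => μ) hf.1, hf0]
  · intro i j hij
    have h := iIndepFun_pi (μ := fun _ : ι => μ) (X := fun _ x => x) fun _ => aemeasurable_id
    exact (h.indepFun hij).comp₀ (measurable_pi_apply _).aemeasurable
      (measurable_pi_apply _).aemeasurable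
      (by rw [(measurePreserving_eval (fun _ : ι => μ) i).map_eq]; exact hf.1.aemeasurable)
      (by rw [(measurePreserving_eval (fun _ : ι => μ) j).map_eq]; exact hg.1.aemeasurable)

lemma memLp_groupMean {q : ℝ≥0∞} (hf : MemLp f q μ) (m : ℕ) :
    MemLp (fun x : Fin m → 𝓧 => groupMean f x) q (Measure.pi fun _ => μ) :=
  (memLp_finsetSum _ fun j _ => memLp_comp_eval hf j).const_smul (m : ℝ)⁻¹

/-- Cross terms between different observations vanish, and the factor √m · √m offsets the 1/m that
averaging leaves. This is why S does not depend on the grouping. -/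
lemma integral_groupMean_mul (hf : MemLp f 2 μ) (hg : MemLp g 2 μ)
    (hf0 : ∫ x, f x ∂μ = 0) {m : ℕ} (hm : 0 < m) :
    ∫ x : Fin m → 𝓧, (√(m : ℝ) * groupMean f x) * (√(m : ℝ) * groupMean g x)
      ∂(Measure.pi fun _ => μ) = ∫ x, f x * g x ∂μ := by
  have hm' : (0 : ℝ) < m := by exact_mod_cast hm
  have h1 : ∀ x : Fin m → 𝓧, (√(m : ℝ) * groupMean f x) * (√(m : ℝ) * groupMean g x) =
      (m : ℝ)⁻¹ * ((∑ j, f (x j)) * ∑ j, g (x j)) := by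
    intro x
    simp only [groupMean, smul_eq_mul]
    calc _ = (√(m : ℝ) * √(m : ℝ)) * (m : ℝ)⁻¹ * (m : ℝ)⁻¹ *
          ((∑ j, f (x j)) * ∑ j, g (x j)) := by ring
      _ = _ := by rw [Real.mul_self_sqrt hm'.le, mul_inv_cancel₀ hm'.ne', one_mul]
  simp_rw [h1]
  rw [integral_const_mul, integral_sum_eval_mul_sum_eval hf hg hf0, Fintype.card_fin, ← mul_assoc,
    inv_mul_cancel₀ hm'.ne', one_mul]

/-- The third moment of a sum of m terms grows at most like m√m, which the scaling by m^{-1/2}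
exactly compensates. -/
lemma exists_integral_abs_groupMean_cube_le (hf : MemLp f 3 μ) (hf0 : ∫ x, f x ∂μ = 0) :
    ∃ C, 0 ≤ C ∧ ∀ m : ℕ, 0 < m → ∫ x : Fin m → 𝓧, |√(m : ℝ) * groupMean f x| ^ 3
      ∂(Measure.pi fun _ => μ) ≤ C := by
  set C := ∫ x, |f x| ^ 3 ∂μ with hC
  have hC0 : 0 ≤ C := integral_nonneg fun x => by positivity
  refine ⟨3 * (C + 1) ^ 2 + C, by positivity, fun m hm => ?_⟩
  have hm' : (0 : ℝ) < m := by exact_mod_cast hm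
  have hsm : 0 < √(m : ℝ) := Real.sqrt_pos.2 hm'
  have h := integral_abs_sum_cube_le (P := Measure.pi fun _ : Fin m => μ)
    (Y := fun j x => f (x j)) (fun j => memLp_comp_eval hf j) (iIndepFun_comp_eval hf.1)
    (fun j => by rw [integral_comp_eval (μ := fun _ : Fin m => μ) hf.1, hf0]) (C := C)
    (fun j => by
      rw [integral_comp_eval (μ := fun _ : Fin m => μ) (f := fun x => |f x| ^ 3)
        hf.integrable_abs_cube.1]) Finset.univ
  rw [Finset.card_univ, Fintype.card_fin] at h
  have h1 : ∀ x : Fin m → 𝓧, |√(m : ℝ) * groupMean f x| ^ 3 =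
      (m * √(m : ℝ))⁻¹ * |∑ j, f (x j)| ^ 3 := by
    intro x
    simp only [groupMean, smul_eq_mul]
    have h2 : √(m : ℝ) * (m : ℝ)⁻¹ = (√(m : ℝ))⁻¹ := by
      rw [← div_eq_mul_inv, Real.sqrt_div_self']
      simp
    rw [← mul_assoc, h2, abs_mul, abs_of_pos (by positivity), mul_pow]
    congr 1
    rw [inv_pow, pow_succ, sq, Real.mul_self_sqrt hm'.le]
  simp_rw [h1]
  rw [integral_const_mul, inv_mul_le_iff₀ (by positivity)]
  linarith

/-- Bounded third moments make second order products uniformly integrable. The bounds are uniform in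
m, so arbitrary group sizes are allowed. -/
lemma isUnifIntegrable_groupMean_mul (hf : MemLp f 3 μ) (hg : MemLp g 3 μ)
    (hf0 : ∫ x, f x ∂μ = 0) (hg0 : ∫ x, g x ∂μ = 0) {m : ℕ → ℕ} (hm : ∀ n, 0 < m n) :
    IsUnifIntegrable (E := fun n => Fin (m n) → 𝓧) (fun _ => Measure.pi fun _ => μ)
      (fun n x => (√(m n : ℝ) * groupMean f x) * (√(m n : ℝ) * groupMean g x)) := by
  have hmem : ∀ {f : 𝓧 → ℝ}, MemLp f 3 μ → ∀ n, MemLp (fun x : Fin (m n) → 𝓧 =>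
      √(m n : ℝ) * groupMean f x) 3 (Measure.pi fun _ => μ) := fun hf n =>
    (memLp_groupMean hf _).const_mul _
  have hint : ∀ n, Integrable (fun x : Fin (m n) → 𝓧 =>
      (√(m n : ℝ) * groupMean f x) * (√(m n : ℝ) * groupMean g x)) (Measure.pi fun _ => μ) :=
    fun n => (hmem hf n).two_of_three.integrable_mul (hmem hg n).two_of_three
  refine ⟨hint, fun η hη => ?_⟩
  obtain ⟨C₁, hC₁, hfC⟩ := exists_integral_abs_groupMean_cube_le hf hf0
  obtain ⟨C₂, hC₂, hgC⟩ := exists_integral_abs_groupMean_cube_le hg hg0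
  set a := (C₁ + C₂ + 1) / η with ha
  have ha0 : 0 < a := by positivity
  refine ⟨a ^ 2, by positivity, fun n => ?_⟩
  -- Trivial for |y| ≤ a; otherwise |y|² ≤ |y|³/a. The product of two factors is first bounded by
  -- the half sum of their squares, and a is large enough that (C₁ + C₂)/a ≤ η.
  have hkey : ∀ y : ℝ, |y| ^ 2 - a ^ 2 ≤ a⁻¹ * |y| ^ 3 := by
    intro y
    have hy := abs_nonneg y
    rw [← sub_nonneg]
    have h1 : a⁻¹ * |y| ^ 3 - (|y| ^ 2 - a ^ 2) = a⁻¹ * (|y| ^ 3 - a * |y| ^ 2 + a ^ 3) := by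
      field_simp
      ring
    rw [h1]
    refine mul_nonneg (by positivity) ?_
    rcases le_total (|y|) a with h | h
    · nlinarith [pow_nonneg hy 3, mul_le_mul h h hy ha0.le]
    · nlinarith [mul_le_mul_of_nonneg_right h (sq_nonneg |y|), pow_pos ha0 3]
  calc _ ≤ ∫ x : Fin (m n) → 𝓧, (a⁻¹ * |√(m n : ℝ) * groupMean f x| ^ 3 +
        a⁻¹ * |√(m n : ℝ) * groupMean g x| ^ 3) ∂(Measure.pi fun _ => μ) := by
        refine integral_mono (((hint n).abs.sub (integrable_const _)).pos_part)
          (((hmem hf n).integrable_abs_cube.const_mul _).add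
            ((hmem hg n).integrable_abs_cube.const_mul _)) fun x => ?_
        simp only
        have h1 := hkey (√(m n : ℝ) * groupMean f x)
        have h2 := hkey (√(m n : ℝ) * groupMean g x)
        have h3 : 0 ≤ a⁻¹ * |√(m n : ℝ) * groupMean f x| ^ 3 := by positivity
        have h4 : 0 ≤ a⁻¹ * |√(m n : ℝ) * groupMean g x| ^ 3 := by positivity
        refine max_le ?_ (by positivity)
        rw [abs_mul]
        nlinarith [sq_nonneg (|√(m n : ℝ) * groupMean f x| - |√(m n : ℝ) * groupMean g x|)]
    _ = a⁻¹ * ∫ x : Fin (m n) → 𝓧, |√(m n : ℝ) * groupMean f x| ^ 3 ∂(Measure.pi fun _ => μ) +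
        a⁻¹ * ∫ x : Fin (m n) → 𝓧, |√(m n : ℝ) * groupMean g x| ^ 3 ∂(Measure.pi fun _ => μ) := by
        rw [integral_add ((hmem hf n).integrable_abs_cube.const_mul _)
          ((hmem hg n).integrable_abs_cube.const_mul _), integral_const_mul, integral_const_mul]
    _ ≤ a⁻¹ * C₁ + a⁻¹ * C₂ := by
        gcongr
        · exact hfC _ (hm n)
        · exact hgC _ (hm n)
    _ ≤ η := by
        rw [← mul_add, inv_mul_le_iff₀ ha0, ha, div_mul_cancel₀ _ hη.ne']
        linarith

end Groups

/-! ### Norm bounds from coordinates, and finite unions of events. -/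

section Coordinates

variable {r p : ℕ}

lemma norm_le_sum_abs (v : EuclideanSpace ℝ (Fin r)) : ‖v‖ ≤ ∑ k, |v k| := by
  have h : v = ∑ k, v k • EuclideanSpace.single k (1 : ℝ) := by
    ext l
    simp [Finset.sum_apply, Pi.single_apply]
  calc ‖v‖ = ‖∑ k, v k • EuclideanSpace.single k (1 : ℝ)‖ := by rw [← h]
    _ ≤ ∑ k, ‖v k • EuclideanSpace.single k (1 : ℝ)‖ := norm_sum_le _ _
    _ = ∑ k, |v k| := by simp [norm_smul]

/-- Turns entrywise closeness of an r × p matrix into an operator bound. The crude constant r p is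
harmless because the entrywise error can be chosen afterwards. -/
lemma norm_le_of_coord_le {v : EuclideanSpace ℝ (Fin r)} {u : EuclideanSpace ℝ (Fin p)}
    {a : Fin r → Fin p → ℝ} {e : ℝ} (ha : ∀ k l, |a k l| ≤ e)
    (hv : ∀ k, v k = ∑ l, u l * a k l) : ‖v‖ ≤ r * p * e * ‖u‖ := by
  have h1 : ∀ k, |v k| ≤ p * e * ‖u‖ := by
    intro k
    rw [hv k]
    calc |∑ l, u l * a k l| ≤ ∑ l, |u l * a k l| := Finset.abs_sum_le_sum_abs _ _
      _ ≤ ∑ l : Fin p, ‖u‖ * e := by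
          refine Finset.sum_le_sum fun l _ => ?_
          rw [abs_mul]
          exact mul_le_mul (by simpa using EuclideanSpace.norm_eq u ▸ PiLp.norm_apply_le u l)
            (ha k l) (abs_nonneg _) (norm_nonneg _)
      _ = _ := by simp; ring
  calc ‖v‖ ≤ ∑ k, |v k| := norm_le_sum_abs v
    _ ≤ ∑ k : Fin r, p * e * ‖u‖ := Finset.sum_le_sum fun k _ => h1 k
    _ = _ := by simp; ring

end Coordinates

lemma tendsto_measure_exists {Ω : ℕ → Type*} [∀ n, MeasurableSpace (Ω n)]
    {P : ∀ n, Measure (Ω n)} {κ : Type*} [Fintype κ] {q : ∀ n, κ → Ω n → Prop}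
    (h : ∀ k, Tendsto (fun n => P n {ω | q n k ω}) atTop (𝓝 0)) :
    Tendsto (fun n => P n {ω | ∃ k, q n k ω}) atTop (𝓝 0) := by
  have h1 : Tendsto (fun n => ∑ k, P n {ω | q n k ω}) atTop (𝓝 (∑ _ : κ, 0)) :=
    tendsto_finsetSum _ fun k _ => h k
  rw [Finset.sum_const_zero] at h1
  refine tendsto_of_tendsto_of_tendsto_of_le_of_le tendsto_const_nhds h1 (fun _ => zero_le)
    fun n => ?_
  have h2 : {ω | ∃ k, q n k ω} = ⋃ k, {ω | q n k ω} := by ext; simp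
  simp only [h2]
  exact (measure_iUnion_le _).trans (by rw [tsum_fintype])

lemma tendsto_measure_or {Ω : ℕ → Type*} [∀ n, MeasurableSpace (Ω n)]
    {P : ∀ n, Measure (Ω n)} {q₁ q₂ : ∀ n, Ω n → Prop}
    (h₁ : Tendsto (fun n => P n {ω | q₁ n ω}) atTop (𝓝 0))
    (h₂ : Tendsto (fun n => P n {ω | q₂ n ω}) atTop (𝓝 0)) :
    Tendsto (fun n => P n {ω | q₁ n ω ∨ q₂ n ω}) atTop (𝓝 0) := by
  have h := h₁.add h₂
  rw [add_zero] at h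
  exact tendsto_of_tendsto_of_tendsto_of_le_of_le tendsto_const_nhds h (fun _ => zero_le)
    fun n => measure_union_le _ _

/-! ### Samples are typical with high probability. -/

section Typical

lemma groupMean_apply {𝓧 : Type*} {m r : ℕ} (f : 𝓧 → EuclideanSpace ℝ (Fin r)) (x : Fin m → 𝓧) (k : Fin r) :
    groupMean f x k = groupMean (fun y => f y k) x := by
  simp [groupMean]

variable {𝓧 : Type*} [MeasurableSpace 𝓧] {μ : Measure 𝓧} [IsProbabilityMeasure μ] {r p : ℕ}
  {m : ℕ → ℕ}

/-- Chebyshev's inequality: the mean squared norm of the normalized sum equals the sum of E f_k² for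
all n and m. -/
lemma measure_normSum_le {f : 𝓧 → EuclideanSpace ℝ (Fin r)}
    (hf : ∀ k, MemLp (fun x => f x k) 2 μ) (hf0 : ∀ k, ∫ x, f x k ∂μ = 0) {n m : ℕ} (hn : 0 < n)
    (hm : 0 < m) {M : ℝ} (hM : 0 ≤ M) :
    M ^ 2 * (Measure.pi fun _ : Fin n => Measure.pi fun _ : Fin m => μ).real
      {x | M < ‖normSum fun i => √(m : ℝ) • groupMean f (x i)‖} ≤
      ∑ k, ∫ x, f x k * f x k ∂μ := by
  set P := Measure.pi fun _ : Fin n => Measure.pi fun _ : Fin m => μ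
  have hn' : (0 : ℝ) < n := by exact_mod_cast hn
  set φ : Fin r → (Fin m → 𝓧) → ℝ := fun k x => √(m : ℝ) * groupMean (fun y => f y k) x with hφ
  have hφ2 : ∀ k, MemLp (φ k) 2 (Measure.pi fun _ : Fin m => μ) := fun k =>
    (memLp_groupMean (hf k) m).const_mul _
  have hφ0 : ∀ k, ∫ x, φ k x ∂(Measure.pi fun _ : Fin m => μ) = 0 := fun k => by
    simp only [hφ]
    rw [integral_const_mul, integral_groupMean ((hf k).integrable (by norm_num)) hm, hf0, mul_zero]
  have hsum2 : ∀ k, MemLp (fun x : Fin n → Fin m → 𝓧 => ∑ i, φ k (x i)) 2 P := fun k =>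
    memLp_finsetSum _ fun i _ => memLp_comp_eval (hφ2 k) i
  have hsint : ∀ k, Integrable (fun x : Fin n → Fin m → 𝓧 =>
      (n : ℝ)⁻¹ * ((∑ i, φ k (x i)) * ∑ i, φ k (x i))) P := fun k =>
    ((hsum2 k).integrable_mul (hsum2 k)).const_mul _
  have hcoord : ∀ x : Fin n → Fin m → 𝓧, ‖normSum fun i => √(m : ℝ) • groupMean f (x i)‖ ^ 2 =
      ∑ k, (n : ℝ)⁻¹ * ((∑ i, φ k (x i)) * ∑ i, φ k (x i)) := by
    intro x
    rw [EuclideanSpace.norm_sq_eq]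
    refine Finset.sum_congr rfl fun k _ => ?_
    have h1 : (normSum fun i => √(m : ℝ) • groupMean f (x i)) k =
        (√(n : ℝ))⁻¹ * ∑ i, φ k (x i) := by
      simp [normSum, groupMean_apply, hφ]
    rw [h1, Real.norm_eq_abs, sq_abs, mul_pow, inv_pow, Real.sq_sqrt hn'.le, sq (∑ i, φ k (x i))]
  have hsq := mul_meas_ge_le_integral_of_nonneg (μ := P)
    (f := fun x => ‖normSum fun i => √(m : ℝ) • groupMean f (x i)‖ ^ 2)
    (ae_of_all _ fun x => sq_nonneg _)
    (by simp_rw [hcoord]; exact integrable_finsetSum _ fun k _ => hsint k) (M ^ 2)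
  refine le_trans ?_ (hsq.trans (le_of_eq ?_))
  · refine mul_le_mul_of_nonneg_left (measureReal_mono fun x hx => ?_) (sq_nonneg M)
    simp only [Set.mem_ofPred_eq] at hx ⊢
    gcongr
  · simp_rw [hcoord]
    rw [integral_finsetSum _ fun k _ => hsint k]
    refine Finset.sum_congr rfl fun k _ => ?_
    rw [integral_const_mul, integral_sum_eval_mul_sum_eval (hφ2 k) (hφ2 k) (hφ0 k),
      Fintype.card_fin, ← mul_assoc, inv_mul_cancel₀ hn'.ne', one_mul]
    exact integral_groupMean_mul (hf k) (hf k) (hf0 k) hm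

/-- Samples are typical with high probability. -/
theorem exists_measure_not_isTypical_le
    {g : 𝓧 → EuclideanSpace ℝ (Fin p) → EuclideanSpace ℝ (Fin r)} {θ₀ : EuclideanSpace ℝ (Fin p)}
    {D : 𝓧 → EuclideanSpace ℝ (Fin p) →L[ℝ] EuclideanSpace ℝ (Fin r)} {h : 𝓧 → ℝ}
    {S : EuclideanSpace ℝ (Fin r) →L[ℝ] EuclideanSpace ℝ (Fin r)}
    {J : EuclideanSpace ℝ (Fin p) →L[ℝ] EuclideanSpace ℝ (Fin r)}
    (hf : ∀ k, MemLp (fun x => g x θ₀ k) 3 μ) (hf0 : ∀ k, ∫ x, g x θ₀ k ∂μ = 0)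
    (hD : ∀ k l, Integrable (fun x => D x (EuclideanSpace.single l 1) k) μ) (hh : Integrable h μ)
    (hS : ∀ u k, S u k = ∑ l, u l * ∫ x, g x θ₀ k * g x θ₀ l ∂μ)
    (hJ : ∀ v k, J v k = ∑ l, v l * ∫ x, D x (EuclideanSpace.single l 1) k ∂μ)
    (hm : ∀ n, 0 < m n) {η : ℝ} (hη : 0 < η) :
    ∃ M, 0 ≤ M ∧ ∀ ε > 0, ∀ᶠ n : ℕ in atTop,
      (Measure.pi fun _ : Fin n => Measure.pi fun _ : Fin (m n) => μ)
        {x | ¬ IsTypical (m n) (fun i θ => groupMean (fun y => g y θ) (x i))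
          (fun i => groupMean D (x i)) (fun i => groupMean h (x i)) θ₀ S J (∫ x, h x ∂μ + 1) M ε} ≤
        ENNReal.ofReal η := by
  set V := ∑ k, ∫ x, g x θ₀ k * g x θ₀ k ∂μ with hV
  have hV0 : 0 ≤ V := Finset.sum_nonneg fun k _ => integral_nonneg fun x => mul_self_nonneg _
  -- Chebyshev's inequality then bounds the probability of a large normalized sum by V/M² ≤ η/2. M
  -- depends on η but not on ε.
  set M := √(2 * (V + 1) / η) with hM
  have hM0 : 0 < M := Real.sqrt_pos.2 (by positivity)
  have hM2 : M ^ 2 = 2 * (V + 1) / η := Real.sq_sqrt (by positivity)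
  refine ⟨M, hM0.le, fun ε hε => ?_⟩
  set z : ∀ n, Fin r → (Fin (m n) → 𝓧) → ℝ :=
    fun n k x => √(m n : ℝ) * groupMean (fun y => g y θ₀ k) x with hz
  -- Coordinatewise tolerances: e₁ for r squared coordinates, e₂ and e₃ for r·r and r·p matrix
  -- entries. The added 1 covers dimension zero.
  set e₁ := ε ^ 2 / (r + 1) with he₁
  set e₂ := ε / (r * r + 1) with he₂
  set e₃ := ε / (r * p + 1) with he₃
  -- the exceptional events
  have hA1 : Tendsto (fun n => (Measure.pi fun _ : Fin n => Measure.pi fun _ : Fin (m n) => μ)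
      {x | ∃ k, ∃ i, e₁ * n ≤ |z n k (x i) * z n k (x i)|}) atTop (𝓝 0) :=
    tendsto_measure_exists fun k =>
      (isUnifIntegrable_groupMean_mul (hf k) (hf k) (hf0 k) (hf0 k) hm).tendsto_max (by positivity)
  have hA2 : Tendsto (fun n => (Measure.pi fun _ : Fin n => Measure.pi fun _ : Fin (m n) => μ)
      {x | ∃ i, ε * n ≤ |groupMean h (x i)|}) atTop (𝓝 0) :=
    (isUnifIntegrable_groupMean hh hm).tendsto_max hε
  have hA3 : Tendsto (fun n => (Measure.pi fun _ : Fin n => Measure.pi fun _ : Fin (m n) => μ)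
      {x | 1 ≤ |(n : ℝ)⁻¹ * ∑ i, groupMean h (x i) - ∫ x, h x ∂μ|}) atTop (𝓝 0) := by
    have := (isUnifIntegrable_groupMean hh hm).tendsto_average one_pos
    simpa only [integral_groupMean hh (hm _)] using this
  have hA4 : Tendsto (fun n => (Measure.pi fun _ : Fin n => Measure.pi fun _ : Fin (m n) => μ)
      {x | ∃ k, ∃ l, e₂ ≤ |(n : ℝ)⁻¹ * ∑ i, z n k (x i) * z n l (x i) -
        ∫ x, g x θ₀ k * g x θ₀ l ∂μ|}) atTop (𝓝 0) := by
    refine tendsto_measure_exists fun k => tendsto_measure_exists fun l => ?_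
    have := (isUnifIntegrable_groupMean_mul (hf k) (hf l) (hf0 k) (hf0 l) hm).tendsto_average
      (ε := e₂) (by positivity)
    simpa only [integral_groupMean_mul (hf k).two_of_three (hf l).two_of_three (hf0 k) (hm _)]
      using this
  have hA5 : Tendsto (fun n => (Measure.pi fun _ : Fin n => Measure.pi fun _ : Fin (m n) => μ)
      {x | ∃ k, ∃ l, e₃ ≤ |(n : ℝ)⁻¹ * ∑ i, groupMean (fun y =>
        D y (EuclideanSpace.single l 1) k) (x i) -
        ∫ x, D x (EuclideanSpace.single l 1) k ∂μ|}) atTop (𝓝 0) := by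
    refine tendsto_measure_exists fun k => tendsto_measure_exists fun l => ?_
    have := (isUnifIntegrable_groupMean (hD k l) hm).tendsto_average (ε := e₃) (by positivity)
    simpa only [integral_groupMean (hD k l) (hm _)] using this
  have hA := tendsto_measure_or hA1 (tendsto_measure_or hA2 (tendsto_measure_or hA3
    (tendsto_measure_or hA4 hA5)))
  have hsqrt : Tendsto (fun n : ℕ => ε * √(n : ℝ)) atTop atTop :=
    (Real.tendsto_sqrt_atTop.comp tendsto_natCast_atTop_atTop).const_mul_atTop hε
  filter_upwards [hA.eventually_le_const (show 0 < ENNReal.ofReal (η / 2) by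
    rw [ENNReal.ofReal_pos]; positivity), hsqrt.eventually_ge_atTop 1, eventually_gt_atTop 0]
    with n hnA hnε hn
  have hn' : (0 : ℝ) < n := by exact_mod_cast hn
  have hB : (Measure.pi fun _ : Fin n => Measure.pi fun _ : Fin (m n) => μ)
      {x | M < ‖normSum fun i => √(m n : ℝ) • groupMean (fun y => g y θ₀) (x i)‖} ≤
      ENNReal.ofReal (η / 2) := by
    have h1 := measure_normSum_le (f := fun y => g y θ₀) (fun k => (hf k).two_of_three) hf0 hn (hm n)
      hM0.le
    rw [← hV, hM2] at h1
    rw [← ofReal_measureReal]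
    refine ENNReal.ofReal_le_ofReal ?_
    rw [div_mul_eq_mul_div, div_le_iff₀ hη] at h1
    have h2 : (V + 1) * (2 * (Measure.pi fun _ : Fin n => Measure.pi fun _ : Fin (m n) => μ).real
      {x | M < ‖normSum fun i => √(m n : ℝ) • groupMean (fun y => g y θ₀) (x i)‖}) ≤
      (V + 1) * η := by linarith
    have := le_of_mul_le_mul_left h2 (by positivity)
    linarith
  have hη2 : ENNReal.ofReal η = ENNReal.ofReal (η / 2) + ENNReal.ofReal (η / 2) := by
    rw [← ENNReal.ofReal_add (by positivity) (by positivity), add_halves]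
  rw [hη2]
  refine (measure_mono ?_).trans ((measure_union_le _ _).trans (add_le_add hB hnA))
  intro x hx
  by_contra hcon
  apply hx
  simp only [Set.mem_union, Set.mem_ofPred_eq, not_or, not_exists, not_le, not_lt] at hcon
  obtain ⟨c0, c1, c2, c3, c4, c5⟩ := hcon
  have hzk : ∀ i k, (√(m n : ℝ) • groupMean (fun y => g y θ₀) (x i)) k = z n k (x i) := by
    intro i k
    simp [hz, groupMean_apply]
  refine ⟨c0, fun i => ?_, fun i => (le_abs_self _).trans (c2 i).le, ?_, fun u => ?_, fun v => ?_,
    hnε⟩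
  · have h1 : ‖√(m n : ℝ) • groupMean (fun y => g y θ₀) (x i)‖ ^ 2 ≤ (ε * √(n : ℝ)) ^ 2 := by
      rw [EuclideanSpace.norm_sq_eq, mul_pow, Real.sq_sqrt hn'.le]
      calc ∑ k, ‖(√(m n : ℝ) • groupMean (fun y => g y θ₀) (x i)) k‖ ^ 2 ≤
            ∑ k : Fin r, e₁ * n := by
            refine Finset.sum_le_sum fun k _ => ?_
            rw [hzk, Real.norm_eq_abs, sq, ← abs_mul]
            exact (c1 k i).le
        _ = r * (e₁ * n) := by simp
        _ ≤ (r + 1) * (e₁ * n) := by gcongr; linarith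
        _ = _ := by rw [he₁]; field_simp
    exact (pow_le_pow_iff_left₀ (norm_nonneg _) (by positivity) two_ne_zero).1 h1
  · have h1 := (abs_lt.1 c3).2
    rw [sub_lt_iff_lt_add', inv_mul_lt_iff₀ hn'] at h1
    linarith
  · have h1 := norm_le_of_coord_le (u := u)
      (v := sampleMoment (fun i => √(m n : ℝ) • groupMean (fun y => g y θ₀) (x i)) u - S u)
      (a := fun k l => (n : ℝ)⁻¹ * ∑ i, z n k (x i) * z n l (x i) -
        ∫ x, g x θ₀ k * g x θ₀ l ∂μ) (fun k l => (c4 k l).le) fun k => ?_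
    · refine h1.trans ?_
      gcongr
      calc (r : ℝ) * r * e₂ ≤ (r * r + 1) * e₂ := by gcongr; linarith
        _ = ε := by rw [he₂]; field_simp
    · have h2 : (sampleMoment (fun i => √(m n : ℝ) • groupMean (fun y => g y θ₀) (x i)) u) k =
          ∑ l, u l * ((n : ℝ)⁻¹ * ∑ i, z n k (x i) * z n l (x i)) := by
        have h3 : ∀ w : EuclideanSpace ℝ (Fin r), ((inner ℝ u w : ℝ) • w) k =
            ∑ l, u l * (w k * w l) := by
          intro w
          simp only [PiLp.smul_apply, smul_eq_mul, PiLp.inner_apply, RCLike.inner_apply,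
            conj_trivial, Finset.sum_mul]
          exact Finset.sum_congr rfl fun l _ => by ring
        rw [sampleMoment, PiLp.smul_apply, WithLp.ofLp_sum, Finset.sum_apply]
        simp only [h3, hzk, smul_eq_mul, Finset.mul_sum]
        rw [Finset.sum_comm]
        exact Finset.sum_congr rfl fun l _ => Finset.sum_congr rfl fun i _ => by ring
      rw [PiLp.sub_apply, h2, hS]
      simp only [mul_sub, Finset.sum_sub_distrib]
  · have h1 := norm_le_of_coord_le (u := v)
      (v := (n : ℝ)⁻¹ • ∑ i, groupMean D (x i) v - J v)
      (a := fun k l => (n : ℝ)⁻¹ * ∑ i, groupMean (fun y =>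
        D y (EuclideanSpace.single l 1) k) (x i) -
        ∫ x, D x (EuclideanSpace.single l 1) k ∂μ) (fun k l => (c5 k l).le) fun k => ?_
    · refine h1.trans ?_
      gcongr
      calc (r : ℝ) * p * e₃ ≤ (r * p + 1) * e₃ := by gcongr; linarith
        _ = ε := by rw [he₃]; field_simp
    · have hDv : ∀ y, D y v k = ∑ l, v l * D y (EuclideanSpace.single l 1) k := by
        intro y
        have hv : v = ∑ l, v l • EuclideanSpace.single l (1 : ℝ) := by
          ext l
          simp [Finset.sum_apply, Pi.single_apply]
        conv_lhs => rw [hv]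
        simp [map_sum]
      have h2 : ((n : ℝ)⁻¹ • ∑ i, groupMean D (x i) v) k = ∑ l, v l * ((n : ℝ)⁻¹ *
          ∑ i, groupMean (fun y => D y (EuclideanSpace.single l 1) k) (x i)) := by
        simp only [groupMean, _root_.smul_apply, _root_.sum_apply,
          PiLp.smul_apply, WithLp.ofLp_sum, Finset.sum_apply, smul_eq_mul, hDv, Finset.mul_sum]
        rw [Finset.sum_congr rfl fun i _ => Finset.sum_comm, Finset.sum_comm]
        refine Finset.sum_congr rfl fun l _ => Finset.sum_congr rfl fun i _ =>
          Finset.sum_congr rfl fun j _ => by ring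
      rw [PiLp.sub_apply, h2, hJ]
      simp only [mul_sub, Finset.sum_sub_distrib]

end Typical

/-! ### Slutsky's lemma on varying spaces and the central limit theorem. -/

section WeakConvergence

/-- Slutsky's lemma for random variables on varying probability spaces. -/
lemma tendstoInDistribution_of_sub_tendsto_zero {V Ω' : Type*} [NormedAddCommGroup V]
    [MeasurableSpace V] [SecondCountableTopology V] [BorelSpace V] [MeasurableSpace Ω']
    {P' : Measure Ω'} [IsProbabilityMeasure P'] {Z : Ω' → V}
    {Ω : ℕ → Type*} [∀ n, MeasurableSpace (Ω n)] {P : ∀ n, Measure (Ω n)}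
    [∀ n, IsProbabilityMeasure (P n)] {X Y : ∀ n, Ω n → V}
    (hX : TendstoInDistribution X atTop Z P P') (hY : ∀ n, AEMeasurable (Y n) (P n))
    (hXY : ∀ ε > 0, Tendsto (fun n => P n {ω | ε ≤ ‖Y n ω - X n ω‖}) atTop (𝓝 0)) :
    TendstoInDistribution Y atTop Z P P' := by
  -- All variables are moved to one product space. Convergence in distribution sees only the
  -- individual laws, and convergence of the difference in probability only the joint law of X_n and
  -- Y_n, so the coupling across n is immaterial.
  set Q : Measure (∀ n, Ω n) := Measure.infinitePi P with hQ
  have hev : ∀ n, MeasurePreserving (Function.eval n) Q (P n) := fun n =>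
    ⟨measurable_pi_apply n, Measure.infinitePi_map_eval P n⟩
  have hlaw : ∀ {W : ∀ n, Ω n → V}, (∀ n, AEMeasurable (W n) (P n)) → ∀ n,
      Q.map (fun ω => W n (ω n)) = (P n).map (W n) := by
    intro W hW n
    have h1 : AEMeasurable (W n) (Q.map (Function.eval n)) := by rw [(hev n).map_eq]; exact hW n
    have h2 := AEMeasurable.map_map_of_aemeasurable h1 (hev n).measurable.aemeasurable
    rw [(hev n).map_eq] at h2
    exact h2.symm
  have hmeas : ∀ {W : ∀ n, Ω n → V}, (∀ n, AEMeasurable (W n) (P n)) → ∀ n,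
      AEMeasurable (fun ω : ∀ n, Ω n => W n (ω n)) Q := fun hW n =>
    (hW n).comp_quasiMeasurePreserving (hev n).quasiMeasurePreserving
  have hX' : TendstoInDistribution (fun n (ω : ∀ n, Ω n) => X n (ω n)) atTop Z (fun _ => Q) P' := by
    refine ⟨hmeas hX.forall_aemeasurable, hX.aemeasurable_limit, ?_⟩
    have := hX.tendsto
    simpa only [hlaw hX.forall_aemeasurable] using this
  have hsub : TendstoInMeasure Q ((fun n (ω : ∀ n, Ω n) => Y n (ω n)) -
      fun n (ω : ∀ n, Ω n) => X n (ω n)) atTop 0 := by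
    rw [tendstoInMeasure_iff_norm]
    intro ε hε
    refine tendsto_of_tendsto_of_tendsto_of_le_of_le tendsto_const_nhds (hXY ε hε)
      (fun _ => zero_le) fun n => ?_
    have h1 := Measure.le_map_apply (μ := Q) (hev n).measurable.aemeasurable {ω | ε ≤ ‖Y n ω - X n ω‖}
    rw [(hev n).map_eq] at h1
    simpa using h1
  have hY' := tendstoInDistribution_of_tendstoInMeasure_sub _ Z hX' hsub (hmeas hY)
  refine ⟨hY, hX.aemeasurable_limit, ?_⟩
  have := hY'.tendsto
  simpa only [hlaw hY] using this

/-- The pointwise form of the central limit theorem for characteristic functions. -/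
lemma tendsto_charFun_pow {𝓧 : Type*} [MeasurableSpace 𝓧] {μ : Measure 𝓧} [IsProbabilityMeasure μ]
    {f : 𝓧 → ℝ} (hf : MemLp f 2 μ) (hf0 : ∫ x, f x ∂μ = 0) :
    Tendsto (fun n : ℕ => charFun (μ.map f) (√(n : ℝ))⁻¹ ^ n) atTop
      (𝓝 (Complex.exp (-((∫ x, f x ^ 2 ∂μ : ℝ) : ℂ) / 2))) := by
  set v := ∫ x, f x ^ 2 ∂μ with hv
  have hv0 : 0 ≤ v := integral_nonneg fun x => sq_nonneg _
  -- A degenerate direction cannot be standardized. Otherwise the limit for f/σ is evaluated at σ.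
  rcases hv0.eq_or_lt with h0 | hpos
  · have hae : f =ᵐ[μ] fun _ => 0 := by
      have := (integral_eq_zero_iff_of_nonneg (fun x => sq_nonneg (f x)) hf.integrable_sq).1
        (hv.symm.trans h0.symm)
      filter_upwards [this] with x hx
      simpa using hx
    rw [← h0, Measure.map_congr hae]
    simp
  · set σ := √v with hσ
    have hσ0 : 0 < σ := Real.sqrt_pos.2 hpos
    have hσ2 : σ ^ 2 = v := Real.sq_sqrt hv0
    have h := tendsto_charFun_inv_sqrt_mul_pow (P := μ) (X := fun x => σ⁻¹ * f x)
      (hf.1.aemeasurable.const_mul _) (by rw [integral_const_mul, hf0, mul_zero])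
      (by
        simp only [Pi.pow_apply, mul_pow]
        rw [integral_const_mul, ← hv, ← hσ2, inv_pow, inv_mul_cancel₀ (by positivity)]) σ
    have h1 : -((σ : ℂ)) ^ 2 / 2 = -(v : ℂ) / 2 := by rw [← hσ2]; push_cast; rfl
    rw [h1] at h
    refine h.congr fun n => ?_
    congr 1
    rw [charFun_map_mul_comp hf.1.aemeasurable]
    congr 1
    field_simp

/-- The central limit theorem for independent random vectors with a fixed law, along an arbitrary
sequence of sample sizes tending to infinity. -/
theorem tendstoInDistribution_multivariateGaussian {𝓧 : Type*} [MeasurableSpace 𝓧] {μ : Measure 𝓧}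
    [IsProbabilityMeasure μ] {p : ℕ} {f : 𝓧 → EuclideanSpace ℝ (Fin p)} (hfm : Measurable f)
    (hf : ∀ t, MemLp (fun x => (inner ℝ (f x) t : ℝ)) 2 μ)
    (hf0 : ∀ t, ∫ x, (inner ℝ (f x) t : ℝ) ∂μ = 0) {V : Matrix (Fin p) (Fin p) ℝ}
    (hV : V.PosSemidef) (hfV : ∀ t : EuclideanSpace ℝ (Fin p),
      ∫ x, (inner ℝ (f x) t : ℝ) ^ 2 ∂μ = t ⬝ᵥ V *ᵥ t)
    {Ω : ℕ → Type*} [∀ n, MeasurableSpace (Ω n)] {P : ∀ n, Measure (Ω n)}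
    [∀ n, IsProbabilityMeasure (P n)] {ι : ℕ → Type*} [∀ n, Fintype (ι n)]
    (hι : Tendsto (fun n => Fintype.card (ι n)) atTop atTop)
    {X : ∀ n, ι n → Ω n → 𝓧} (hX : ∀ n k, HasLaw (X n k) μ (P n)) (hind : ∀ n, iIndepFun (X n) (P n)) :
    TendstoInDistribution
      (fun n ω => (√(Fintype.card (ι n) : ℝ))⁻¹ • ∑ k, f (X n k ω)) atTop
      (id : EuclideanSpace ℝ (Fin p) → EuclideanSpace ℝ (Fin p)) P (multivariateGaussian 0 V) := by
  have hYm : ∀ n k, AEMeasurable (fun ω => f (X n k ω)) (P n) := fun n k =>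
    hfm.comp_aemeasurable (hX n k).aemeasurable
  have hsum : ∀ n, AEMeasurable (fun ω => ∑ k, f (X n k ω)) (P n) := fun n =>
    Finset.aemeasurable_fun_sum _ fun k _ => hYm n k
  refine ⟨fun n => (hsum n).const_smul (√(Fintype.card (ι n) : ℝ))⁻¹, aemeasurable_id, ?_⟩
  refine ProbabilityMeasure.tendsto_iff_tendsto_charFun.2 fun t => ?_
  simp only [ProbabilityMeasure.coe_mk, Measure.map_id]
  rw [charFun_multivariateGaussian hV]
  -- The characteristic function of the normalized sum depends only on the number of observations.
  -- The scalar limit for ⟨f, t⟩ can therefore be composed with any sample sizes tending to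
  -- infinity, although the spaces vary.
  have hlim := (tendsto_charFun_pow (hf t) (hf0 t)).comp hι
  rw [hfV t] at hlim
  have hexp : ((inner ℝ t (0 : EuclideanSpace ℝ (Fin p)) : ℝ) : ℂ) * Complex.I -
      ((t ⬝ᵥ V *ᵥ t : ℝ) : ℂ) / 2 = -((t ⬝ᵥ V *ᵥ t : ℝ) : ℂ) / 2 := by
    rw [inner_zero_right]; simp [neg_div]
  rw [hexp]
  refine hlim.congr fun n => ?_
  simp only [Function.comp_apply]
  have hYind : iIndepFun (fun k ω => f (X n k ω)) (P n) :=
    (hind n).comp (fun _ => f) fun _ => hfm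
  rw [charFun_map_smul_comp (hsum n), hYind.charFun_map_fun_sum_eq_prod (hYm n)]
  have hlaw : ∀ k, (P n).map (fun ω => f (X n k ω)) = μ.map f := fun k => by
    rw [← (hX n k).map_eq, AEMeasurable.map_map_of_aemeasurable hfm.aemeasurable
      (hX n k).aemeasurable]
    rfl
  simp only [hlaw, Finset.prod_const, Finset.card_univ, Finset.prod_apply]
  congr 1
  simp only [charFun_apply]
  rw [integral_map hfm.aemeasurable (by fun_prop), integral_map (hf t).1.aemeasurable (by fun_prop)]
  refine integral_congr_ae (ae_of_all _ fun x => ?_)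
  simp [inner_smul_right, mul_comm]

end WeakConvergence

/-! ### From the likelihood ratio to relative weights; existence of estimates. -/

section Estimates

variable {𝓧 : Type*} {p r n m : ℕ}
  {g : 𝓧 → EuclideanSpace ℝ (Fin p) → EuclideanSpace ℝ (Fin r)} {x : Fin n → Fin m → 𝓧}

lemma negTwoLogRatio_le_iff {θ θ' : EuclideanSpace ℝ (Fin p)} :
    negTwoLogRatio g x θ ≤ negTwoLogRatio g x θ' ↔ ratio g x θ' ≤ ratio g x θ := by
  have h2 : StrictMono fun a : EReal => 2 * a := by
    intro a b hab
    have hpos : (0 : EReal) < 2 := by norm_num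
    induction a with
    | bot =>
      induction b with
      | bot => exact absurd hab (lt_irrefl _)
      | coe b =>
        simp only [EReal.mul_bot_of_pos hpos]
        change ⊥ < ((2 : ℝ) : EReal) * b
        rw [← EReal.coe_mul]
        exact EReal.bot_lt_coe _
      | top => simp [EReal.mul_bot_of_pos hpos, EReal.mul_top_of_pos hpos]
    | coe a =>
      induction b with
      | bot => exact absurd hab not_lt_bot
      | coe b =>
        have h : 2 * a < 2 * b := by linarith [EReal.coe_lt_coe_iff.1 hab]
        change ((2 : ℝ) : EReal) * a < ((2 : ℝ) : EReal) * b
        rw [← EReal.coe_mul, ← EReal.coe_mul]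
        exact EReal.coe_lt_coe_iff.2 h
      | top =>
        simp only [EReal.mul_top_of_pos hpos]
        change ((2 : ℝ) : EReal) * a < ⊤
        rw [← EReal.coe_mul]
        exact EReal.coe_lt_top _
    | top => exact absurd hab not_top_lt
  rw [negTwoLogRatio, negTwoLogRatio, EReal.neg_mul, EReal.neg_mul, EReal.neg_le_neg_iff,
    h2.le_iff_le, ENNReal.log_le_log_iff]

/-- Minimizers of the empirical likelihood ratio statistic over compact balls exist. -/
lemma exists_isEstimate {θ₀ : EuclideanSpace ℝ (Fin p)} {ρ : ℝ} (hρ : 0 ≤ ρ)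
    (hg : ∀ y, ContinuousOn (g y) (Metric.closedBall θ₀ ρ)) :
    ∃ θ, IsEstimate g x (Metric.closedBall θ₀ ρ) θ := by
  set L : (Fin n → ℝ) → ℝ := fun q => ∏ i, ((n : ℝ) * (m : ℝ) * q i) ^ m with hL
  set s : Set (EuclideanSpace ℝ (Fin p) × (Fin n → ℝ)) :=
    Metric.closedBall θ₀ ρ ×ˢ Set.Icc (0 : Fin n → ℝ) (fun _ => 1 / (m : ℝ)) with hs
  have hsc : IsCompact s := (isCompact_closedBall _ _).prod isCompact_Icc
  set Φ : EuclideanSpace ℝ (Fin p) × (Fin n → ℝ) → ℝ × EuclideanSpace ℝ (Fin r) :=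
    fun z => (∑ i, z.2 i, ∑ i, z.2 i • ∑ j, g (x i j) z.1) with hΦ
  have hΦc : ContinuousOn Φ s := by
    have h1 : ∀ y, ContinuousOn (fun z : EuclideanSpace ℝ (Fin p) × (Fin n → ℝ) => g y z.1) s :=
      fun y => (hg y).comp continuousOn_fst fun z hz => hz.1
    have h2 : ∀ i, ContinuousOn
        (fun z : EuclideanSpace ℝ (Fin p) × (Fin n → ℝ) => z.2 i • ∑ j, g (x i j) z.1) s :=
      fun i => ContinuousOn.smul ((continuous_apply i).comp continuous_snd).continuousOn
        (continuousOn_finsetSum _ fun j _ => h1 (x i j))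
    exact ContinuousOn.prodMk (Continuous.continuousOn (continuous_finsetSum _ fun i _ =>
        (continuous_apply i).comp continuous_snd))
      (continuousOn_finsetSum _ fun i _ => h2 i)
  -- The likelihood is maximized jointly in (θ, q) over the compact set of feasible pairs, which
  -- avoids a semicontinuity proof for the ratio. If the set is empty, the ratio vanishes on the
  -- ball and every point is a minimizer.
  set K := s ∩ Φ ⁻¹' {(1 / (m : ℝ), 0)} with hK
  have hKc : IsCompact K := hsc.of_isClosed_subset
    (hΦc.preimage_isClosed_of_isClosed hsc.isClosed isClosed_singleton) Set.inter_subset_left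
  have hKmem : ∀ θ ∈ Metric.closedBall θ₀ ρ, ∀ q, IsFeasible g x θ q → (θ, q) ∈ K := by
    intro θ hθ q hq
    refine ⟨⟨hθ, fun i => hq.1 i, fun i => ?_⟩, ?_⟩
    · rw [← hq.2.1]
      exact Finset.single_le_sum (fun i _ => hq.1 i) (Finset.mem_univ i)
    · simp [hΦ, hq.2.1, hq.2.2]
  rcases K.eq_empty_or_nonempty with hKe | hKn
  · refine ⟨θ₀, Metric.mem_closedBall_self hρ, fun θ' hθ' => negTwoLogRatio_le_iff.2 ?_⟩
    refine iSup₂_le fun q hq => ?_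
    have := hKmem θ' hθ' q hq
    simp [hKe] at this
  · obtain ⟨⟨θ, q⟩, hθq, hmax⟩ := hKc.exists_isMaxOn hKn
      (f := fun z => L z.2) (by simp only [hL]; fun_prop)
    have hq : IsFeasible g x θ q := by
      have h1 : Φ (θ, q) = (1 / (m : ℝ), 0) := hθq.2
      rw [hΦ, Prod.mk.injEq] at h1
      exact ⟨fun i => hθq.1.2.1 i, h1.1, h1.2⟩
    refine ⟨θ, hθq.1.1, fun θ' hθ' => negTwoLogRatio_le_iff.2 ?_⟩
    refine iSup₂_le fun q' hq' => ?_
    refine le_trans (ENNReal.ofReal_le_ofReal (hmax (hKmem θ' hθ' q' hq'))) ?_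
    exact le_iSup₂ (f := fun q (_ : q ∈ {q | IsFeasible g x θ q}) => ENNReal.ofReal (L q)) q hq

lemma IsAdmissible.le_ratio {θ : EuclideanSpace ℝ (Fin p)} (hn : 0 < n) (hm : 0 < m)
    {y : Fin n → ℝ} (hy : IsAdmissible (fun i => groupMean (fun z => g z θ) (x i)) y) :
    ENNReal.ofReal (∏ i, y i ^ m) ≤ ratio g x θ := by
  have hn' : (0 : ℝ) < n := by exact_mod_cast hn
  have hm' : (0 : ℝ) < m := by exact_mod_cast hm
  have hq : IsFeasible g x θ fun i => y i / (n * m) := by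
    refine ⟨fun i => div_nonneg (hy.pos i).le (by positivity), ?_, ?_⟩
    · rw [← Finset.sum_div, hy.sum_eq]
      field_simp
    · have h := hy.moment
      simp only [groupMean] at h
      have h1 : ∀ i, (y i / (n * m)) • ∑ j, g (x i j) θ =
          (n : ℝ)⁻¹ • (y i • ((m : ℝ)⁻¹ • ∑ j, g (x i j) θ)) := by
        intro i
        rw [smul_smul, smul_smul]
        congr 1
        field_simp
      simp_rw [h1, ← Finset.smul_sum, h, smul_zero]
  refine le_trans (le_of_eq ?_) (le_iSup₂ (f := fun q (_ : q ∈ {q | IsFeasible g x θ q}) =>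
    ENNReal.ofReal (∏ i, ((n : ℝ) * (m : ℝ) * q i) ^ m)) _ hq)
  congr 1
  refine Finset.prod_congr rfl fun i _ => ?_
  congr 1
  field_simp

/-- Some feasible weights beat any level below the supremum. Their product is then positive, and as
m > 0 no weight can be zero, so the logarithms are meaningful. -/
lemma exists_isAdmissible_of_lt_ratio {θ : EuclideanSpace ℝ (Fin p)} (hn : 0 < n) (hm : 0 < m)
    {a : ℝ≥0∞} (ha : a < ratio g x θ) :
    ∃ y, IsAdmissible (fun i => groupMean (fun z => g z θ) (x i)) y ∧
      a < ENNReal.ofReal (∏ i, y i ^ m) := by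
  have hn' : (0 : ℝ) < n := by exact_mod_cast hn
  have hm' : (0 : ℝ) < m := by exact_mod_cast hm
  obtain ⟨q, hq⟩ := lt_iSup_iff.1 ha
  obtain ⟨hqf, hq⟩ := lt_iSup_iff.1 hq
  have hqf : IsFeasible g x θ q := hqf
  have hprod : 0 < ∏ i, ((n : ℝ) * (m : ℝ) * q i) ^ m := ENNReal.ofReal_pos.1 (pos_of_gt hq)
  refine ⟨fun i => n * m * q i, ⟨fun i => ?_, ?_, ?_⟩, hq⟩
  · refine lt_of_le_of_ne (mul_nonneg (by positivity) (hqf.1 i)) fun h => hprod.ne' ?_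
    exact Finset.prod_eq_zero (Finset.mem_univ i) (by rw [← h, zero_pow hm.ne'])
  · rw [← Finset.mul_sum, hqf.2.1]
    field_simp
  · have h1 : ∀ i, ((n : ℝ) * m * q i) • groupMean (fun z => g z θ) (x i) =
        (n : ℝ) • (q i • ∑ j, g (x i j) θ) := by
      intro i
      rw [groupMean, smul_smul, smul_smul]
      congr 1
      field_simp
    simp_rw [h1, ← Finset.smul_sum, hqf.2.2, smul_zero]

lemma prod_pow_eq_exp {y : Fin n → ℝ} (hy : ∀ i, 0 < y i) :
    ∏ i, y i ^ m = Real.exp (-(m * ∑ i, -Real.log (y i))) := by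
  rw [Finset.sum_neg_distrib, mul_neg, neg_neg, Finset.mul_sum, Real.exp_sum]
  refine Finset.prod_congr rfl fun i _ => ?_
  rw [mul_comm, Real.exp_mul, Real.exp_log (hy i), Real.rpow_natCast]

/-- An estimate almost minimizes the sums `∑ -log yᵢ` over admissible relative weights. -/
lemma IsEstimate.exists_isAdmissible {A : Set (EuclideanSpace ℝ (Fin p))}
    {θ θ' : EuclideanSpace ℝ (Fin p)} (h : IsEstimate g x A θ) (hn : 0 < n) (hm : 0 < m)
    (hθ' : θ' ∈ A) {y' : Fin n → ℝ}
    (hy' : IsAdmissible (fun i => groupMean (fun z => g z θ') (x i)) y') {η : ℝ} (hη : 0 < η) :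
    ∃ y, IsAdmissible (fun i => groupMean (fun z => g z θ) (x i)) y ∧
      ∑ i, -Real.log (y i) ≤ ∑ i, -Real.log (y' i) + η := by
  have hm' : (0 : ℝ) < m := by exact_mod_cast hm
  -- The slack η puts this level strictly below the ratio at the estimate, so attainment of the
  -- supremum over the weights is not needed.
  have h1 : ENNReal.ofReal (Real.exp (-(m * (∑ i, -Real.log (y' i) + η)))) < ratio g x θ := by
    refine lt_of_lt_of_le ?_ ((hy'.le_ratio hn hm).trans (negTwoLogRatio_le_iff.1 (h.2 θ' hθ')))
    rw [prod_pow_eq_exp hy'.pos, ENNReal.ofReal_lt_ofReal_iff (Real.exp_pos _), Real.exp_lt_exp]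
    have := mul_pos hm' hη
    linarith
  obtain ⟨y, hy, hlt⟩ := exists_isAdmissible_of_lt_ratio hn hm h1
  refine ⟨y, hy, ?_⟩
  rw [prod_pow_eq_exp hy.pos, ENNReal.ofReal_lt_ofReal_iff (Real.exp_pos _), Real.exp_lt_exp,
    neg_lt_neg_iff] at hlt
  exact (lt_of_mul_lt_mul_left hlt hm'.le).le

end Estimates

/-! ### Matrices as operators, and the algebra of generalized least squares. -/

section MatrixOperator

lemma posDef_normalMatrix {ι κ : Type*} [Fintype ι] [Fintype κ] [DecidableEq ι]
    {S : Matrix ι ι ℝ} {J : Matrix ι κ ℝ} (hS : S.PosDef)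
    (hJ : Function.Injective J.mulVec) :
    (Jᵀ * S⁻¹ * J).PosDef := by
  simpa using hS.inv.conjTranspose_mul_mul_same hJ

lemma mulVec_injective_of_rank_eq {ι κ : Type*} [Finite ι] [Fintype κ] {A : Matrix ι κ ℝ}
    (hA : A.rank = Fintype.card κ) : Function.Injective A.mulVec := by
  rw [Matrix.mulVec_injective_iff, linearIndependent_iff_card_eq_finrank_span, ← hA,
    Matrix.rank_eq_finrank_span_cols, Set.finrank]

variable {ι κ ν : Type*} [Fintype ι] [Fintype κ] [Fintype ν]
  [DecidableEq κ] [DecidableEq ν]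

/-- The operator between Euclidean spaces given by a matrix. -/
noncomputable def matrixOp (A : Matrix ι κ ℝ) : EuclideanSpace ℝ κ →L[ℝ] EuclideanSpace ℝ ι :=
  LinearMap.toContinuousLinearMap (Matrix.toLpLin 2 2 A)

lemma ofLp_matrixOp (A : Matrix ι κ ℝ) (u : EuclideanSpace ℝ κ) :
    (matrixOp A u).ofLp = A *ᵥ u.ofLp := by
  simp [matrixOp]

lemma matrixOp_apply (A : Matrix ι κ ℝ) (u : EuclideanSpace ℝ κ) (i : ι) :
    matrixOp A u i = ∑ l, u l * A i l := by
  rw [ofLp_matrixOp, Matrix.mulVec, dotProduct]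
  simp_rw [mul_comm]

lemma matrixOp_mul (A : Matrix ι κ ℝ) (B : Matrix κ ν ℝ) (u : EuclideanSpace ℝ ν) :
    matrixOp (A * B) u = matrixOp A (matrixOp B u) := by
  apply WithLp.ofLp_injective 2
  simp [ofLp_matrixOp]

lemma matrixOp_one [DecidableEq ι] (u : EuclideanSpace ℝ ι) : matrixOp (1 : Matrix ι ι ℝ) u = u := by
  apply WithLp.ofLp_injective 2
  simp [ofLp_matrixOp]

lemma matrixOp_add (A B : Matrix ι κ ℝ) (u : EuclideanSpace ℝ κ) :
    matrixOp (A + B) u = matrixOp A u + matrixOp B u := by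
  simp [matrixOp]

lemma inner_matrixOp_left [DecidableEq ι] (A : Matrix ι κ ℝ) (u : EuclideanSpace ℝ κ) (v : EuclideanSpace ℝ ι) :
    inner ℝ (matrixOp A u) v = inner ℝ u (matrixOp Aᵀ v) := by
  simp only [EuclideanSpace.inner_eq_star_dotProduct, ofLp_matrixOp, star_trivial]
  rw [Matrix.dotProduct_mulVec, Matrix.mulVec_transpose, dotProduct_comm]

lemma inner_matrixOp_self [DecidableEq ι] (A : Matrix ι ι ℝ) (u : EuclideanSpace ℝ ι) :
    inner ℝ (matrixOp A u) u = u.ofLp ⬝ᵥ A *ᵥ u.ofLp := by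
  simp only [EuclideanSpace.inner_eq_star_dotProduct, ofLp_matrixOp, star_trivial]

lemma exists_pos_le_inner_matrixOp [DecidableEq ι] {A : Matrix ι ι ℝ} (hA : A.PosDef) :
    ∃ b > 0, ∀ u, b * ‖u‖ ^ 2 ≤ inner ℝ (matrixOp A u) u := by
  have hpos : ∀ u : EuclideanSpace ℝ ι, u ≠ 0 → 0 < inner ℝ (matrixOp A u) u := by
    intro u hu
    rw [inner_matrixOp_self]
    have := hA.dotProduct_mulVec_pos (x := u.ofLp) (by simpa using hu)
    simpa using this
  -- The minimum over the unit sphere is the constant; the sphere is empty in dimension zero.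
  rcases (Metric.sphere (0 : EuclideanSpace ℝ ι) 1).eq_empty_or_nonempty with he | hne
  · refine ⟨1, one_pos, fun u => ?_⟩
    rcases eq_or_ne u 0 with rfl | hu
    · simp
    · have : (‖u‖⁻¹ • u) ∈ Metric.sphere (0 : EuclideanSpace ℝ ι) 1 := by
        simp [norm_smul, hu]
      simp [he] at this
  · obtain ⟨w, hw, hmin⟩ := (isCompact_sphere (0 : EuclideanSpace ℝ ι) 1).exists_isMinOn hne
      (f := fun u => inner ℝ (matrixOp A u) u) (by fun_prop)
    have hw0 : w ≠ 0 := by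
      rintro rfl
      simp at hw
    refine ⟨_, hpos w hw0, fun u => ?_⟩
    rcases eq_or_ne u 0 with rfl | hu
    · simp
    have hu' : 0 < ‖u‖ := norm_pos_iff.2 hu
    have hmem : (‖u‖⁻¹ • u) ∈ Metric.sphere (0 : EuclideanSpace ℝ ι) 1 := by
      simp [norm_smul, hu]
    have h := hmin hmem
    simp only [map_smul, inner_smul_left, inner_smul_right, conj_trivial, Set.mem_ofPred_eq] at h
    calc _ ≤ (‖u‖⁻¹ * (‖u‖⁻¹ * inner ℝ (matrixOp A u) u)) * ‖u‖ ^ 2 := by gcongr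
      _ = _ := by field_simp

lemma exists_pos_le_norm_matrixOp {A : Matrix ι κ ℝ} (hA : Function.Injective A.mulVec) :
    ∃ c > 0, ∀ v, c * ‖v‖ ≤ ‖matrixOp A v‖ := by
  have hker : (matrixOp A).toLinearMap.ker = ⊥ := by
    rw [LinearMap.ker_eq_bot]
    intro u v huv
    have h : matrixOp A u = matrixOp A v := huv
    apply WithLp.ofLp_injective 2
    apply hA
    rw [← ofLp_matrixOp, ← ofLp_matrixOp, h]
  obtain ⟨K, hK, h⟩ := (matrixOp A).toLinearMap.exists_antilipschitzWith hker
  refine ⟨(K : ℝ)⁻¹, by positivity, fun v => ?_⟩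
  rw [inv_mul_le_iff₀ (by exact_mod_cast hK)]
  simpa using h.le_mul_dist v 0

/-- The matrix of the generalized least squares estimator, up to sign. -/
noncomputable def glsMatrix [DecidableEq ι] (S : Matrix ι ι ℝ) (J : Matrix ι κ ℝ) : Matrix κ ι ℝ :=
  -((Jᵀ * S⁻¹ * J)⁻¹ * (Jᵀ * S⁻¹))

variable [DecidableEq ι] {S : Matrix ι ι ℝ} {J : Matrix ι κ ℝ}

lemma transpose_inv_of_posDef (hS : S.PosDef) : (S⁻¹)ᵀ = S⁻¹ := by
  simpa using hS.inv.isHermitian.eq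

/-- The normal equations: t = Γ s is the stationary point of ⟨S⁻¹ (s + J t), s + J t⟩. -/
lemma transpose_mul_glsMatrix (hS : S.PosDef) (hJ : Function.Injective J.mulVec) :
    Jᵀ * S⁻¹ * (1 + J * glsMatrix S J) = 0 := by
  have hu := (Matrix.isUnit_iff_isUnit_det _).1 (posDef_normalMatrix hS hJ).isUnit
  rw [glsMatrix, Matrix.mul_add, Matrix.mul_one, Matrix.mul_neg, Matrix.mul_neg, ← Matrix.mul_assoc,
    ← Matrix.mul_assoc, Matrix.mul_nonsing_inv _ hu, Matrix.one_mul, add_neg_cancel]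

/-- The weight matrix S⁻¹ matches the covariance S, so the sandwich V Jᵀ S⁻¹ · S · S⁻¹ J V collapses
to V. -/
lemma glsMatrix_mul_mul_transpose (hS : S.PosDef) (hJ : Function.Injective J.mulVec) :
    glsMatrix S J * S * (glsMatrix S J)ᵀ = (Jᵀ * S⁻¹ * J)⁻¹ := by
  have hu := (Matrix.isUnit_iff_isUnit_det _).1 (posDef_normalMatrix hS hJ).isUnit
  have hu' := (Matrix.isUnit_iff_isUnit_det _).1 hS.isUnit
  have hV : ((Jᵀ * S⁻¹ * J)⁻¹)ᵀ = (Jᵀ * S⁻¹ * J)⁻¹ := by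
    simpa using (posDef_normalMatrix hS hJ).inv.isHermitian.eq
  rw [glsMatrix, Matrix.transpose_neg, Matrix.neg_mul, Matrix.neg_mul, Matrix.mul_neg, neg_neg,
    Matrix.transpose_mul, Matrix.transpose_mul, Matrix.transpose_transpose, hV,
    transpose_inv_of_posDef hS]
  set V := (Jᵀ * S⁻¹ * J)⁻¹ with hVdef
  calc V * (Jᵀ * S⁻¹) * S * (S⁻¹ * J * V) = V * Jᵀ * (S⁻¹ * S) * S⁻¹ * J * V := by
        simp only [Matrix.mul_assoc]
    _ = V * (Jᵀ * S⁻¹ * J) * V := by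
        rw [Matrix.nonsing_inv_mul _ hu']
        simp only [Matrix.mul_assoc, Matrix.one_mul]
    _ = V := by rw [hVdef, Matrix.nonsing_inv_mul _ hu, Matrix.one_mul]

end MatrixOperator

/-! ### Taylor estimates and measurability of the derivative. -/

section Calculus

variable {T F : Type*} [NormedAddCommGroup T] [NormedSpace ℝ T] [NormedAddCommGroup F]
  [NormedSpace ℝ F]

lemma norm_sub_le_of_contDiffOn {f : T → F} {U : Set T} (hU : IsOpen U) (hf : ContDiffOn ℝ 2 f U)
    {θ₀ θ : T} {ρ₀ h : ℝ} (hsub : Metric.closedBall θ₀ ρ₀ ⊆ U)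
    (h1 : ∀ θ ∈ U, ‖fderiv ℝ f θ‖ ≤ h) (hθ : θ ∈ Metric.closedBall θ₀ ρ₀) :
    ‖f θ - f θ₀‖ ≤ h * ‖θ - θ₀‖ := by
  have hρ : 0 ≤ ρ₀ := dist_nonneg.trans (Metric.mem_closedBall.1 hθ)
  refine (convex_closedBall θ₀ ρ₀).norm_image_sub_le_of_norm_fderiv_le (𝕜 := ℝ)
    (fun x hx => ?_) (fun x hx => h1 x (hsub hx)) (Metric.mem_closedBall_self hρ) hθ
  exact (hf.contDiffAt (hU.mem_nhds (hsub hx))).differentiableAt (by norm_num)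

/-- The mean value inequality twice: for the derivative on the large ball, then for the function on
the ball of radius ‖θ - θ₀‖. The factor 1/2 of Taylor's formula is given up. -/
lemma norm_sub_sub_le_of_contDiffOn {f : T → F} {U : Set T} (hU : IsOpen U)
    (hf : ContDiffOn ℝ 2 f U) {θ₀ θ : T} {ρ₀ h : ℝ} (hh : 0 ≤ h)
    (hsub : Metric.closedBall θ₀ ρ₀ ⊆ U) (h2 : ∀ θ ∈ U, ‖fderiv ℝ (fderiv ℝ f) θ‖ ≤ h)
    (hθ : θ ∈ Metric.closedBall θ₀ ρ₀) :
    ‖f θ - f θ₀ - fderiv ℝ f θ₀ (θ - θ₀)‖ ≤ h * ‖θ - θ₀‖ ^ 2 := by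
  have hle : ‖θ - θ₀‖ ≤ ρ₀ := by simpa [dist_eq_norm] using hθ
  have hρ : 0 ≤ ρ₀ := (norm_nonneg _).trans hle
  have hf' : ContDiffOn ℝ 1 (fderiv ℝ f) U := hf.fderiv_of_isOpen hU (by norm_num)
  have hd : ∀ x ∈ Metric.closedBall θ₀ ρ₀, ‖fderiv ℝ f x - fderiv ℝ f θ₀‖ ≤ h * ‖x - θ₀‖ := by
    intro x hx
    refine (convex_closedBall θ₀ ρ₀).norm_image_sub_le_of_norm_fderiv_le (𝕜 := ℝ)
      (fun x hx => ?_) (fun x hx => h2 x (hsub hx)) (Metric.mem_closedBall_self hρ) hx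
    exact (hf'.contDiffAt (hU.mem_nhds (hsub hx))).differentiableAt (by norm_num)
  have hsub' : Metric.closedBall θ₀ ‖θ - θ₀‖ ⊆ Metric.closedBall θ₀ ρ₀ :=
    Metric.closedBall_subset_closedBall hle
  rw [sq, ← mul_assoc]
  refine (convex_closedBall θ₀ ‖θ - θ₀‖).norm_image_sub_le_of_norm_fderiv_le' (𝕜 := ℝ)
    (fun x hx => ?_) (fun x hx => ?_) (Metric.mem_closedBall_self (norm_nonneg _))
    (by simp [dist_eq_norm])
  · exact (hf.contDiffAt (hU.mem_nhds (hsub (hsub' hx)))).differentiableAt (by norm_num)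
  · refine (hd x (hsub' hx)).trans ?_
    have : ‖x - θ₀‖ ≤ ‖θ - θ₀‖ := by simpa [dist_eq_norm] using hx
    gcongr

/-- Joint measurability of g is not assumed. The directional derivative at θ₀ is a limit of
difference quotients that involve countably many parameter values. -/
lemma measurable_fderiv_apply {𝓧 : Type*} [MeasurableSpace 𝓧] [MeasurableSpace F] [BorelSpace F]
    [SecondCountableTopology F] {g : 𝓧 → T → F} {U : Set T} (hU : IsOpen U) {θ₀ : T}
    (hθ₀ : θ₀ ∈ U) (hmeas : ∀ θ ∈ U, Measurable fun x => g x θ)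
    (hg : ∀ x, DifferentiableAt ℝ (g x) θ₀) (v : T) :
    Measurable fun x => fderiv ℝ (g x) θ₀ v := by
  have hlim : Tendsto (fun k : ℕ => θ₀ + (k : ℝ)⁻¹ • v) atTop (𝓝 θ₀) := by
    have h : Tendsto (fun k : ℕ => (k : ℝ)⁻¹) atTop (𝓝 0) :=
      tendsto_inv_atTop_zero.comp tendsto_natCast_atTop_atTop
    simpa using tendsto_const_nhds.add (h.smul_const v)
  -- Starting at index N keeps all the parameter values used in U.
  obtain ⟨N, hN⟩ := eventually_atTop.1 (hlim.eventually (hU.mem_nhds hθ₀))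
  refine measurable_of_tendsto_metrizable
    (f := fun (k : ℕ) x => ((k + N : ℕ) : ℝ) •
      (g x (θ₀ + (((k + N : ℕ) : ℝ))⁻¹ • v) - g x θ₀)) (fun k => ?_) ?_
  · exact ((hmeas _ (hN _ (Nat.le_add_left N k))).sub (hmeas _ hθ₀)).const_smul _
  · refine tendsto_pi_nhds.2 fun x => (hg x).hasFDerivAt.lim v ?_
    simp only [norm_natCast]
    exact tendsto_natCast_atTop_atTop.comp (tendsto_add_atTop_nat N)

end Calculus

section Regular

variable {𝓧 T F : Type*} [NormedAddCommGroup T] [NormedSpace ℝ T] [NormedAddCommGroup F]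
  [NormedSpace ℝ F] {n m : ℕ}

lemma norm_groupMean_le {f : 𝓧 → F} {h : 𝓧 → ℝ} {c : ℝ} (hfh : ∀ y, ‖f y‖ ≤ h y * c)
    (x : Fin m → 𝓧) : ‖groupMean f x‖ ≤ groupMean h x * c := by
  rw [groupMean, groupMean, norm_smul, Real.norm_of_nonneg (by positivity), smul_eq_mul, mul_assoc,
    Finset.sum_mul]
  gcongr
  exact (norm_sum_le _ _).trans (Finset.sum_le_sum fun j _ => hfh _)

lemma groupMean_sub (f g : 𝓧 → F) (x : Fin m → 𝓧) :
    groupMean (fun y => f y - g y) x = groupMean f x - groupMean g x := by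
  simp [groupMean, smul_sub]

end Regular

section Regular

variable {𝓧 T F : Type*} [NormedAddCommGroup T] [NormedSpace ℝ T] [NormedAddCommGroup F]
  [InnerProductSpace ℝ F] {n m : ℕ}

lemma isRegular_groupMean {g : 𝓧 → T → F} {D : 𝓧 → T →L[ℝ] F} {h : 𝓧 → ℝ} {θ₀ : T} {ρ₀ : ℝ}
    (hh : ∀ y, 0 ≤ h y)
    (hlip : ∀ y, ∀ θ ∈ Metric.closedBall θ₀ ρ₀, ‖g y θ - g y θ₀‖ ≤ h y * ‖θ - θ₀‖)
    (htaylor : ∀ y, ∀ θ ∈ Metric.closedBall θ₀ ρ₀,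
      ‖g y θ - g y θ₀ - D y (θ - θ₀)‖ ≤ h y * ‖θ - θ₀‖ ^ 2) (x : Fin n → Fin m → 𝓧) :
    IsRegular (fun i θ => groupMean (fun y => g y θ) (x i)) (fun i => groupMean D (x i))
      (fun i => groupMean h (x i)) θ₀ ρ₀ := by
  refine ⟨fun i => ?_, fun i θ hθ => ?_, fun i θ hθ => ?_⟩
  · exact smul_nonneg (by positivity) (Finset.sum_nonneg fun j _ => hh _)
  · rw [← groupMean_sub]
    exact norm_groupMean_le (fun y => hlip y θ hθ) _
  · have hD : groupMean D (x i) (θ - θ₀) = groupMean (fun y => D y (θ - θ₀)) (x i) := by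
      simp [groupMean]
    rw [hD, ← groupMean_sub, ← groupMean_sub]
    exact norm_groupMean_le (fun y => htaylor y θ hθ) _

end Regular

/-! ### Moments and laws of the estimating function and of the grouped sample. -/

section Integrability

variable {𝓧 : Type*} [MeasurableSpace 𝓧] {μ : Measure 𝓧} {r : ℕ}

lemma memLp_three_apply {f : 𝓧 → EuclideanSpace ℝ (Fin r)} {h : 𝓧 → ℝ} (hf : Measurable f)
    (hh : Integrable h μ) (hfh : ∀ x, ‖f x‖ ^ 3 ≤ h x) (k : Fin r) :
    MemLp (fun x => f x k) 3 μ := by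
  have hfk : Measurable fun x => f x k := by fun_prop
  rw [← integrable_norm_rpow_iff hfk.aestronglyMeasurable (by norm_num) (by norm_num)]
  refine hh.mono' (hfk.norm.pow_const _).aestronglyMeasurable (ae_of_all _ fun x => ?_)
  have h3 : (3 : ℝ≥0∞).toReal = ((3 : ℕ) : ℝ) := by norm_num
  rw [h3, Real.rpow_natCast, Real.norm_of_nonneg (by positivity)]
  exact (pow_le_pow_left₀ (norm_nonneg _) (PiLp.norm_apply_le _ _) 3).trans (hfh x)

lemma integral_apply_euclideanSpace {f : 𝓧 → EuclideanSpace ℝ (Fin r)} (hf : Integrable f μ)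
    (k : Fin r) : ∫ x, f x k ∂μ = (∫ x, f x ∂μ) k :=
  (EuclideanSpace.proj (𝕜 := ℝ) k).integral_comp_comm hf

end Integrability

section Probability

variable {𝓧 : Type*} [MeasurableSpace 𝓧] {μ : Measure 𝓧} {p r : ℕ}

lemma integral_inner_sq {f : 𝓧 → EuclideanSpace ℝ (Fin r)} (hf : ∀ k, MemLp (fun x => f x k) 2 μ)
    {S : Matrix (Fin r) (Fin r) ℝ} (hS : ∀ k l, S k l = ∫ x, f x k * f x l ∂μ)
    (s : EuclideanSpace ℝ (Fin r)) :
    ∫ x, (inner ℝ (f x) s : ℝ) ^ 2 ∂μ = s.ofLp ⬝ᵥ S *ᵥ s.ofLp := by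
  have hint : ∀ k l, Integrable (fun x => s k * (s l * (f x k * f x l))) μ := fun k l =>
    (((hf k).integrable_mul (hf l)).const_mul (s l)).const_mul (s k)
  have h1 : ∀ x, (inner ℝ (f x) s : ℝ) ^ 2 = ∑ k, ∑ l, s k * (s l * (f x k * f x l)) := by
    intro x
    rw [PiLp.inner_apply, sq, Finset.sum_mul_sum]
    refine Finset.sum_congr rfl fun k _ => Finset.sum_congr rfl fun l _ => ?_
    simp only [RCLike.inner_apply, conj_trivial]
    ring
  simp_rw [h1]
  rw [integral_finsetSum _ fun k _ => integrable_finsetSum _ fun l _ => hint k l]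
  simp only [dotProduct, Matrix.mulVec, Finset.mul_sum]
  refine Finset.sum_congr rfl fun k _ => ?_
  rw [integral_finsetSum _ fun l _ => hint k l]
  refine Finset.sum_congr rfl fun l _ => ?_
  rw [integral_const_mul, integral_const_mul, hS]
  ring

lemma integral_inner_matrixOp_sq {f : 𝓧 → EuclideanSpace ℝ (Fin r)}
    (hf : ∀ k, MemLp (fun x => f x k) 2 μ) {S : Matrix (Fin r) (Fin r) ℝ}
    (hS : ∀ k l, S k l = ∫ x, f x k * f x l ∂μ) (A : Matrix (Fin p) (Fin r) ℝ)
    (t : EuclideanSpace ℝ (Fin p)) :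
    ∫ x, (inner ℝ (matrixOp A (f x)) t : ℝ) ^ 2 ∂μ = t.ofLp ⬝ᵥ (A * S * Aᵀ) *ᵥ t.ofLp := by
  simp_rw [inner_matrixOp_left]
  rw [integral_inner_sq hf hS, ofLp_matrixOp, ← Matrix.mulVec_mulVec, ← Matrix.mulVec_mulVec,
    Matrix.dotProduct_mulVec t.ofLp A, ← Matrix.mulVec_transpose]

lemma memLp_inner {f : 𝓧 → EuclideanSpace ℝ (Fin r)} {q : ℝ≥0∞}
    (hf : ∀ k, MemLp (fun x => f x k) q μ) (s : EuclideanSpace ℝ (Fin r)) :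
    MemLp (fun x => (inner ℝ (f x) s : ℝ)) q μ := by
  simp_rw [PiLp.inner_apply]
  refine memLp_finsetSum _ fun k _ => ?_
  simpa using (hf k).const_mul (s k)

lemma integral_inner_eq_zero {f : 𝓧 → EuclideanSpace ℝ (Fin r)}
    (hf : ∀ k, Integrable (fun x => f x k) μ) (hf0 : ∀ k, ∫ x, f x k ∂μ = 0)
    (s : EuclideanSpace ℝ (Fin r)) : ∫ x, (inner ℝ (f x) s : ℝ) ∂μ = 0 := by
  simp_rw [PiLp.inner_apply, RCLike.inner_apply, conj_trivial]
  rw [integral_finsetSum _ fun k _ => (hf k).const_mul (s k)]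
  simp [integral_const_mul, hf0]

variable [IsProbabilityMeasure μ]

/-- Joint independence over pairs (i, j) gives the product law on all observations; currying turns
it into independent groups with a common product law. Events can thus be estimated on the canonical
space. -/
lemma hasLaw_pi_pi {Ω : Type*} [MeasurableSpace Ω] {P : Measure Ω} {n m : ℕ}
    {X : Fin n → Fin m → Ω → 𝓧} (hX : ∀ i j, HasLaw (X i j) μ P)
    (hind : iIndepFun (fun k : Fin n × Fin m => X k.1 k.2) P) :
    HasLaw (fun ω i j => X i j ω) (Measure.pi fun _ : Fin n => Measure.pi fun _ : Fin m => μ) P := by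
  have h1 := iIndepFun.hasLaw_pi (μ := fun _ => μ) (fun k : Fin n × Fin m => hX k.1 k.2) hind
  have h2 := Measure.infinitePi_map_curry fun (_ : Fin n) (_ : Fin m) => μ
  simp only [Measure.infinitePi_eq_pi] at h2
  have h3 : HasLaw (MeasurableEquiv.curry (Fin n) (Fin m) 𝓧)
      (Measure.pi fun _ : Fin n => Measure.pi fun _ : Fin m => μ)
      (Measure.pi fun _ : Fin n × Fin m => μ) :=
    ⟨(MeasurableEquiv.measurable _).aemeasurable, h2⟩
  exact h3.comp h1

/-- The grouping cancels: √m/(m√n) = N^{-1/2}. The leading term is the ungrouped normalized sum,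
which explains a limit law independent of the group sizes. -/
lemma normSum_smul_groupMean {𝓧 F : Type*} [NormedAddCommGroup F] [InnerProductSpace ℝ F]
    {n m : ℕ} (f : 𝓧 → F) (x : Fin n → Fin m → 𝓧) :
    (normSum fun i => √(m : ℝ) • groupMean f (x i)) =
      (√(Fintype.card (Fin n × Fin m) : ℝ))⁻¹ • ∑ k : Fin n × Fin m, f (x k.1 k.2) := by
  have hm : √(m : ℝ) * (m : ℝ)⁻¹ = (√(m : ℝ))⁻¹ := by
    rcases Nat.eq_zero_or_pos m with rfl | hm
    · simp
    · have : (0 : ℝ) < m := by exact_mod_cast hm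
      rw [← div_eq_mul_inv, Real.sqrt_div_self]
  simp only [normSum, groupMean, smul_smul, hm, ← Finset.smul_sum]
  rw [Fintype.sum_prod_type, Fintype.card_prod, Fintype.card_fin, Fintype.card_fin, Nat.cast_mul,
    Real.sqrt_mul (Nat.cast_nonneg _), mul_inv]

end Probability

/-! ### Asymptotic linearity of the estimator in probability. -/

section Remainder

variable {𝓧 : Type*} [MeasurableSpace 𝓧] {μ : Measure 𝓧} [IsProbabilityMeasure μ] {p r : ℕ}
  {g : 𝓧 → EuclideanSpace ℝ (Fin p) → EuclideanSpace ℝ (Fin r)} {θ₀ : EuclideanSpace ℝ (Fin p)}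
  {D : 𝓧 → EuclideanSpace ℝ (Fin p) →L[ℝ] EuclideanSpace ℝ (Fin r)} {h : 𝓧 → ℝ}
  {S B : EuclideanSpace ℝ (Fin r) →L[ℝ] EuclideanSpace ℝ (Fin r)}
  {J : EuclideanSpace ℝ (Fin p) →L[ℝ] EuclideanSpace ℝ (Fin r)}
  {Γ : EuclideanSpace ℝ (Fin r) →L[ℝ] EuclideanSpace ℝ (Fin p)} {b c ρ₀ : ℝ}

/-- The estimator is asymptotically a linear function of the sample mean of the estimating function
at the true parameter value. -/
theorem tendsto_measure_le_norm_sub (hf : ∀ k, MemLp (fun x => g x θ₀ k) 3 μ)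
    (hf0 : ∀ k, ∫ x, g x θ₀ k ∂μ = 0)
    (hD : ∀ k l, Integrable (fun x => D x (EuclideanSpace.single l 1) k) μ) (hh : Integrable h μ)
    (hh0 : ∀ x, 0 ≤ h x)
    (hS : ∀ u k, S u k = ∑ l, u l * ∫ x, g x θ₀ k * g x θ₀ l ∂μ)
    (hJ : ∀ v k, J v k = ∑ l, v l * ∫ x, D x (EuclideanSpace.single l 1) k ∂μ)
    (hBS : ∀ u, B (S u) = u) (hSB : ∀ u, S (B u) = u)
    (hBsymm : ∀ u v, inner ℝ (B u) v = inner ℝ u (B v)) (hb : 0 < b)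
    (hBpos : ∀ u, b * ‖u‖ ^ 2 ≤ inner ℝ (B u) u) (hc : 0 < c) (hJc : ∀ v, c * ‖v‖ ≤ ‖J v‖)
    (hΓ : ∀ s v, inner ℝ (B (s + J (Γ s))) (J v) = 0) (hρ₀ : 0 ≤ ρ₀)
    (hCρ : (∫ x, h x ∂μ + 1) * ρ₀ ≤ c / 4)
    (hlip : ∀ y, ∀ θ ∈ Metric.closedBall θ₀ ρ₀, ‖g y θ - g y θ₀‖ ≤ h y * ‖θ - θ₀‖)
    (htaylor : ∀ y, ∀ θ ∈ Metric.closedBall θ₀ ρ₀,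
      ‖g y θ - g y θ₀ - D y (θ - θ₀)‖ ≤ h y * ‖θ - θ₀‖ ^ 2)
    {m : ℕ → ℕ} (hm : ∀ n, 0 < m n) {Ω : ℕ → Type*} [∀ n, MeasurableSpace (Ω n)]
    {P : ∀ n, Measure (Ω n)} {X : ∀ n, Fin n → Fin (m n) → Ω n → 𝓧}
    (hX : ∀ n i j, HasLaw (X n i j) μ (P n))
    (hind : ∀ n, iIndepFun (fun (k : Fin n × Fin (m n)) => X n k.1 k.2) (P n))
    {ρ : ℕ → ℝ} (hρ : ∀ᶠ n in atTop, ρ n ≤ ρ₀)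
    (hρ' : Tendsto (fun n : ℕ => √((n : ℝ) * (m n : ℝ)) * ρ n) atTop atTop)
    {θhat : ∀ n, Ω n → EuclideanSpace ℝ (Fin p)}
    (hθ : Tendsto (fun n => P n {ω | ¬ IsEstimate g (fun i j => X n i j ω)
        (Metric.closedBall θ₀ (ρ n)) (θhat n ω)}) atTop (𝓝 0)) {ε : ℝ} (hε : 0 < ε) :
    Tendsto (fun n => P n {ω | ε ≤ ‖√((n : ℝ) * (m n : ℝ)) • (θhat n ω - θ₀) -
      Γ (normSum fun i => √(m n : ℝ) • groupMean (fun y => g y θ₀) (fun j => X n i j ω))‖})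
      atTop (𝓝 0) := by
  refine ENNReal.tendsto_nhds_zero.2 fun δ hδ => ?_
  obtain ⟨η, hη, hηδ⟩ : ∃ η : ℝ, 0 < η ∧ ENNReal.ofReal η + ENNReal.ofReal η ≤ δ := by
    have h1 : min δ 1 ≠ ⊤ := ne_top_of_le_ne_top ENNReal.one_ne_top (min_le_right _ _)
    have h2 : 0 < (min δ 1).toReal :=
      ENNReal.toReal_pos (lt_min hδ one_pos).ne' h1
    refine ⟨(min δ 1).toReal / 2, by positivity, ?_⟩
    rw [← ENNReal.ofReal_add (by positivity) (by positivity), add_halves, ENNReal.ofReal_toReal h1]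
    exact min_le_left _ _
  -- The order of choices matters: M from the probability η, then the accuracy e and the radius R
  -- from M and ε, and n last.
  obtain ⟨M, hM, htyp⟩ := exists_measure_not_isTypical_le (m := m) hf hf0 hD hh hS hJ hm hη
  obtain ⟨e, R, he, hmain⟩ := exists_linear_approx hBS hSB hBsymm hb hBpos hc hJc hΓ
    (add_nonneg (integral_nonneg hh0) zero_le_one) θ₀ hρ₀ hCρ hM (half_pos hε)
  filter_upwards [htyp e he, ENNReal.tendsto_nhds_zero.1 hθ _ (ENNReal.ofReal_pos.2 hη), hρ,
    hρ'.eventually_ge_atTop R, eventually_gt_atTop 0] with n h1 h2 h3 h4 h5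
  have hlaw := hasLaw_pi_pi (hX n) (hind n)
  rw [← hlaw.map_eq] at h1
  -- Only this inequality is needed, so the set of atypical samples need not be measurable.
  have h6 := (Measure.le_map_apply hlaw.aemeasurable _).trans h1
  refine le_trans (le_trans (measure_mono fun ω hω => ?_) (measure_union_le _ _))
    ((add_le_add h2 h6).trans hηδ)
  by_contra hcon
  simp only [Set.mem_union, Set.mem_ofPred_eq, Set.mem_preimage, not_or, not_not] at hcon hω
  obtain ⟨hest, ht⟩ := hcon
  have := hmain n (m n) h5 (hm n) _ _ _ ht (isRegular_groupMean hh0 hlip htaylor _) (ρ n) h3 h4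
    (θhat n ω) hest.1 fun θ' hθ' y' hy' η hη => hest.exists_isAdmissible h5 (hm n) hθ' hy' hη
  linarith

end Remainder

end GEL

/-! ### The main theorem. -/

theorem theorem1 {d p r : ℕ}
    -- the law of `X`, the estimating function and the true parameter value
    (μ : Measure (EuclideanSpace ℝ (Fin d))) [IsProbabilityMeasure μ]
    (g : EuclideanSpace ℝ (Fin d) → EuclideanSpace ℝ (Fin p) → EuclideanSpace ℝ (Fin r))
    (θ₀ : EuclideanSpace ℝ (Fin p))
    (U : Set (EuclideanSpace ℝ (Fin p))) (hUo : IsOpen U) (hθ₀ : θ₀ ∈ U)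
    (hmeas : ∀ θ ∈ U, Measurable fun x => g x θ)
    (hzero : ∫ x, g x θ₀ ∂μ = 0)
    -- Condition 1
    (h1 : (GEL.secondMoment μ g θ₀).PosDef)
    -- Condition 2
    (h2 : ∀ x, ContDiffOn ℝ 2 (g x) U)
    -- Condition 3
    (H : EuclideanSpace ℝ (Fin d) → ℝ) (hH : Integrable H μ)
    (h3a : ∀ x, ∀ θ ∈ U, ‖fderiv ℝ (g x) θ‖ ≤ H x)
    (h3b : ∀ x, ∀ θ ∈ U, ‖fderiv ℝ (fderiv ℝ (g x)) θ‖ ≤ H x)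
    (h3c : ∀ x, ∀ θ ∈ U, ‖g x θ‖ ^ 3 ≤ H x)
    -- Condition 4
    (h4 : (GEL.meanJacobian μ g θ₀).rank = p) :
    ∃ ρ₀ : ℝ, 0 < ρ₀ ∧
      -- minimizers over small balls around `θ₀` exist, for every sample
      (∀ (n m : ℕ), 0 < n → 0 < m → ∀ x : Fin n → Fin m → EuclideanSpace ℝ (Fin d),
        ∀ ρ : ℝ, 0 ≤ ρ → ρ ≤ ρ₀ → ∃ θ, GEL.IsEstimate g x (Metric.closedBall θ₀ ρ) θ) ∧
      -- and they are asymptotically normal, whatever the group sizes `m n` are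
      ∀ (m : ℕ → ℕ), (∀ n, 0 < m n) →
      ∀ (Ω : ℕ → Type*) [∀ n, MeasurableSpace (Ω n)] (P : ∀ n, Measure (Ω n))
        [∀ n, IsProbabilityMeasure (P n)]
        (X : ∀ n, Fin n → Fin (m n) → Ω n → EuclideanSpace ℝ (Fin d)),
      (∀ n i j, HasLaw (X n i j) μ (P n)) →
      (∀ n, iIndepFun (fun (k : Fin n × Fin (m n)) => X n k.1 k.2) (P n)) →
      ∀ ρ : ℕ → ℝ, (∀ᶠ n in atTop, ρ n ≤ ρ₀) →
        Tendsto (fun n : ℕ => √((n : ℝ) * (m n : ℝ)) * ρ n) atTop atTop →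
      ∀ θhat : ∀ n, Ω n → EuclideanSpace ℝ (Fin p),
      (∀ n, AEMeasurable (θhat n) (P n)) →
      -- `θhat n` is a minimizer with probability tending to one
      Tendsto (fun n => P n {ω | ¬ GEL.IsEstimate g (fun i j => X n i j ω)
        (Metric.closedBall θ₀ (ρ n)) (θhat n ω)}) atTop (𝓝 0) →
      TendstoInDistribution
        (fun (n : ℕ) (ω : Ω n) => √((n : ℝ) * (m n : ℝ)) • (θhat n ω - θ₀)) atTop
        (id : EuclideanSpace ℝ (Fin p) → EuclideanSpace ℝ (Fin p)) P
        (multivariateGaussian 0 (GEL.asympCov μ g θ₀)) := by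
  have hH0 : ∀ x, 0 ≤ H x := fun x => (norm_nonneg _).trans (h3a x θ₀ hθ₀)
  have hdiff : ∀ x, DifferentiableAt ℝ (g x) θ₀ := fun x =>
    ((h2 x).contDiffAt (hUo.mem_nhds hθ₀)).differentiableAt (by norm_num)
  have hf : ∀ k, MemLp (fun x => g x θ₀ k) 3 μ :=
    GEL.memLp_three_apply (hmeas θ₀ hθ₀) hH fun x => h3c x θ₀ hθ₀
  have hf0 : ∀ k, ∫ x, g x θ₀ k ∂μ = 0 := by
    intro k
    have hint : Integrable (fun x => g x θ₀) μ :=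
      (MemLp.of_eval_piLp hf).integrable (by norm_num)
    rw [GEL.integral_apply_euclideanSpace hint, hzero, PiLp.zero_apply]
  have hD : ∀ k l, Integrable (fun x => fderiv ℝ (g x) θ₀ (EuclideanSpace.single l 1) k) μ := by
    intro k l
    have hm := GEL.measurable_fderiv_apply hUo hθ₀ hmeas hdiff (EuclideanSpace.single l 1)
    have hmk : Measurable fun x => fderiv ℝ (g x) θ₀ (EuclideanSpace.single l 1) k := by fun_prop
    refine hH.mono' hmk.aestronglyMeasurable (ae_of_all _ fun x => ?_)
    refine (PiLp.norm_apply_le _ _).trans (((fderiv ℝ (g x) θ₀).le_opNorm _).trans ?_)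
    simpa using h3a x θ₀ hθ₀
  set S := GEL.secondMoment μ g θ₀ with hS
  set J := GEL.meanJacobian μ g θ₀ with hJ
  have hJinj : Function.Injective J.mulVec := GEL.mulVec_injective_of_rank_eq (by simpa using h4)
  have hSu : IsUnit S.det := (Matrix.isUnit_iff_isUnit_det _).1 h1.isUnit
  obtain ⟨b, hb, hBpos⟩ := GEL.exists_pos_le_inner_matrixOp h1.inv
  obtain ⟨c, hc, hJc⟩ := GEL.exists_pos_le_norm_matrixOp hJinj
  obtain ⟨δ, hδ, hδU⟩ := Metric.nhds_basis_closedBall.mem_iff.1 (hUo.mem_nhds hθ₀)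
  have hC : 0 < ∫ x, H x ∂μ + 1 := add_pos_of_nonneg_of_pos (integral_nonneg hH0) one_pos
  -- The first bound keeps the ball inside U. The second keeps the Taylor remainder below a quarter
  -- of the linear term, where E H + 1 bounds the average envelope on typical samples.
  set ρ₀ := min δ (c / 4 / (∫ x, H x ∂μ + 1)) with hρ₀
  have hρ₀pos : 0 < ρ₀ := lt_min hδ (by positivity)
  have hball : Metric.closedBall θ₀ ρ₀ ⊆ U :=
    (Metric.closedBall_subset_closedBall (min_le_left _ _)).trans hδU
  refine ⟨ρ₀, hρ₀pos, fun n m _ _ x ρ hρ hρ' => GEL.exists_isEstimate hρ fun y =>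
    ((h2 y).continuousOn.mono hball).mono (Metric.closedBall_subset_closedBall hρ'), ?_⟩
  intro m hm Ω _ P _ X hX hind ρ hρ hρ' θhat hθm hθ
  have hcard : Tendsto (fun n => Fintype.card (Fin n × Fin (m n))) atTop atTop := by
    simp only [Fintype.card_prod, Fintype.card_fin]
    exact tendsto_atTop_mono (fun n => Nat.le_mul_of_pos_right n (hm n)) tendsto_id
  set A := GEL.glsMatrix S J with hA
  have hf2 : ∀ k, MemLp (fun x => g x θ₀ k) 2 μ := fun k => (hf k).mono_exponent (by norm_num)
  have hclt := GEL.tendstoInDistribution_multivariateGaussian (μ := μ)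
    (f := fun x => GEL.matrixOp A (g x θ₀)) (V := GEL.asympCov μ g θ₀)
    ((GEL.matrixOp A).continuous.measurable.comp (hmeas θ₀ hθ₀))
    (fun t => by
      simp_rw [GEL.inner_matrixOp_left]
      exact GEL.memLp_inner hf2 _)
    (fun t => by
      simp_rw [GEL.inner_matrixOp_left]
      exact GEL.integral_inner_eq_zero (fun k => (hf2 k).integrable (by norm_num)) hf0 _)
    (GEL.posDef_normalMatrix h1 hJinj).inv.posSemidef
    (fun t => by
      rw [GEL.integral_inner_matrixOp_sq (S := S) hf2 (fun k l => rfl),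
        GEL.glsMatrix_mul_mul_transpose h1 hJinj]
      rfl)
    hcard (X := fun n (k : Fin n × Fin (m n)) => X n k.1 k.2) (fun n k => hX n k.1 k.2) hind
  -- Slutsky's lemma: it remains to compare the normalized error of the estimator with the linear
  -- statistic just treated.
  refine GEL.tendstoInDistribution_of_sub_tendsto_zero hclt
    (fun n => ((hθm n).sub_const θ₀).const_smul (√((n : ℝ) * (m n : ℝ)))) fun ε hε => ?_
  have hrem := GEL.tendsto_measure_le_norm_sub (D := fun x => fderiv ℝ (g x) θ₀)
    (S := GEL.matrixOp S) (B := GEL.matrixOp S⁻¹) (J := GEL.matrixOp J) (Γ := GEL.matrixOp A)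
    hf hf0 hD hH hH0 (GEL.matrixOp_apply S) (GEL.matrixOp_apply J)
    (fun u => by rw [← GEL.matrixOp_mul, Matrix.nonsing_inv_mul _ hSu, GEL.matrixOp_one])
    (fun u => by rw [← GEL.matrixOp_mul, Matrix.mul_nonsing_inv _ hSu, GEL.matrixOp_one])
    (fun u v => by rw [GEL.inner_matrixOp_left, GEL.transpose_inv_of_posDef h1])
    hb hBpos hc hJc
    (fun s v => by
      -- The orthogonality required of Γ, rewritten as the matrix form of the normal equations.
      have h : GEL.matrixOp Jᵀ (GEL.matrixOp S⁻¹ (s + GEL.matrixOp J (GEL.matrixOp A s))) =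
          GEL.matrixOp (Jᵀ * S⁻¹ * (1 + J * A)) s := by
        rw [GEL.matrixOp_mul, GEL.matrixOp_mul, GEL.matrixOp_add, GEL.matrixOp_one,
          GEL.matrixOp_mul]
      rw [real_inner_comm, GEL.inner_matrixOp_left, h, hA, GEL.transpose_mul_glsMatrix h1 hJinj]
      simp [GEL.matrixOp])
    hρ₀pos.le
    (by
      rw [mul_comm, ← le_div_iff₀ hC]
      exact min_le_right _ _)
    (fun y θ hθ => GEL.norm_sub_le_of_contDiffOn hUo (h2 y) hball (h3a y) hθ)
    (fun y θ hθ => GEL.norm_sub_sub_le_of_contDiffOn hUo (h2 y) (hH0 y) hball (h3b y) hθ)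
    hm hX hind hρ hρ' hθ hε
  refine hrem.congr fun n => ?_
  have hsum : ∀ ω, GEL.matrixOp A (GEL.normSum fun i => √(m n : ℝ) •
      GEL.groupMean (fun y => g y θ₀) (fun j => X n i j ω)) =
      (√(Fintype.card (Fin n × Fin (m n)) : ℝ))⁻¹ •
        ∑ k : Fin n × Fin (m n), GEL.matrixOp A (g (X n k.1 k.2 ω) θ₀) := fun ω => by
    have h := GEL.normSum_smul_groupMean (fun y => g y θ₀) fun i j => X n i j ω
    rw [h, map_smul, map_sum]
  simp only [hsum]
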